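/- Let $p$ be a prime and $C_p$ the cyclic group of order $p$. A $C_p$-Mackey functor $\underline{M}$ consists of abelian groups $\underline{M}(C_p/C_p)$ and $\underline{M}(C_p/e)$, the latter with a $C_p$-action, together with equivariant homomorphisms $\mathrm{res}\colon \underline{M}(C_p/C_p)\to \underline{M}(C_p/e)$ and $\mathrm{tr}\colon \underline{M}(C_p/e)\to \underline{M}(C_p/C_p)$ (for the trivial action on $\underline{M}(C_p/C_p)$) such that $\mathrm{res}\,\mathrm{tr}(y)=\sum_{\gamma\in C_p}\gamma y$. Let $\underline{A}$ be the Burnside Tambara functor: $\underline{A}(C_p/C_p)=\mathbb{Z}[t]/(t^2-pt)$, $\underline{A}(C_p/e)=\mathbb{Z}$ with trivial action, $\mathrm{res}(t)=p$, $\mathrm{tr}(a)=at$, and norm $\mathrm{nm}(a)=a+\frac{a^p-a}{p}t$. Let $\underline{L}$ be the quotient of the Mackey functor $\underline{A}$ by the Mackey subfunctor generated by $\mathrm{res}(1)\in\underline{A}(C_p/e)$, and let $\underline{g}$ be the Mackey functor with $\underline{g}(C_p/C_p)=\mathbb{Z}/p$ and $\underline{g}(C_p/e)=0$. The free $C_p$-Tambara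 functor $\underline{R}=\underline{A}[x_G]$ on a generator $x\in\underline{R}(C_p/C_p)$ exists; it is characterized by the property that for every $C_p$-Tambara functor $\underline{T}$ and every $y\in\underline{T}(C_p/C_p)$ there is a unique morphism of Tambara functors $\underline{R}\to\underline{T}$ with $x\mapsto y$. Regard $\underline{A}$ as an $\underline{R}$-module through the unique morphism of Tambara functors $\underline{R}\to\underline{A}$ with $x\mapsto 0$. This module has a projective resolution. For every projective resolution $\underline{P}_\bullet\to\underline{A}$ by $\underline{R}$-modules, the Mackey functors $\underline{T}_i:=\underline{\operatorname{Tor}}_i^{\underline{R}}(\underline{A},\underline{A})=H_i(\underline{P}_\bullet\boxtimes_{\underline{R}}\underline{A})$, where $\boxtimes_{\underline{R}}$ is the relative box product, satisfy, as Mackey functors, \[ \underline{T}_i\cong \begin{cases} \underline{A} & i=0,\\ \underline{A}\oplus\underline{L} & i=1,\\ \underline{L} & i=2,\\ 0 & i=3,4,\\ \underline{g} & i=5,6,\\ 0 & i=7,8,\\ \underline{T}_{i-4}\oplus\underline{T}_{i-4}\oplus\underline{T}_{i-5} & i\ge 9. \end{cases} \] Moreover, define the rank of a Mackey functor to be the least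 number of elements, at either level, that generate it as a Mackey functor. Then every $\underline{T}_i$ has finite rank, and the rank of $\underline{T}_i$ tends to infinity as $i\to\infty$. -/

import Mathlib

open scoped TensorProduct Polynomial

/-! ## Mackey functors for the cyclic group of prime order -/

/-- The cyclic group `C_p` of order `p`, written multiplicatively. -/
abbrev Cp (p : ℕ) : Type := Multiplicative (ZMod p)

/-- A `C_p`-Mackey functor, given by its Lewis diagram: `top` is the value at `C_p/C_p`,
`bot` is the value at `C_p/e` with its `C_p`-action. -/
structure MackeyFunctor (p : ℕ) [Fact p.Prime] where
  top : Type
  bot : Type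
  [topGroup : AddCommGroup top]
  [botGroup : AddCommGroup bot]
  [act : DistribMulAction (Cp p) bot]
  res : top →+ bot
  tr : bot →+ top
  smul_res : ∀ (g : Cp p) (x : top), g • res x = res x
  tr_smul : ∀ (g : Cp p) (y : bot), tr (g • y) = tr y
  res_tr : ∀ y : bot, res (tr y) = ∑ g : Cp p, g • y

attribute [instance] MackeyFunctor.topGroup MackeyFunctor.botGroup MackeyFunctor.act

namespace MackeyFunctor

variable {p : ℕ} [Fact p.Prime]

/-- Morphisms of Mackey functors. -/
@[ext]
structure Hom (M N : MackeyFunctor p) where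
  top : M.top →+ N.top
  bot : M.bot →+ N.bot
  map_res : ∀ x, bot (M.res x) = N.res (top x)
  map_tr : ∀ y, top (M.tr y) = N.tr (bot y)
  map_smul : ∀ (g : Cp p) (y : M.bot), bot (g • y) = g • bot y

/-- Two Mackey functors are isomorphic if there is a morphism between them that is bijective at
both levels. -/
def IsIsomorphic (M N : MackeyFunctor p) : Prop :=
  ∃ f : Hom M N, Function.Bijective f.top ∧ Function.Bijective f.bot

/-- The zero Mackey functor. -/
def zero (p : ℕ) [Fact p.Prime] : MackeyFunctor p where
  top := PUnit
  bot := PUnit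
  act :=
    { smul := fun _ x => x
      one_smul := fun _ => rfl
      mul_smul := fun _ _ _ => rfl
      smul_zero := fun _ => rfl
      smul_add := fun _ _ _ => rfl }
  res := 0
  tr := 0
  smul_res := fun _ _ => rfl
  tr_smul := fun _ _ => rfl
  res_tr := fun _ => rfl

/-- The zero morphism to the zero Mackey functor. -/
def toZero (M : MackeyFunctor p) : Hom M (zero p) where
  top := 0
  bot := 0
  map_res := fun _ => rfl
  map_tr := fun _ => rfl
  map_smul := fun _ _ => rfl

/-- The direct sum of two Mackey functors. -/
def sum (M N : MackeyFunctor p) : MackeyFunctor p where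
  top := M.top × N.top
  bot := M.bot × N.bot
  res := M.res.prodMap N.res
  tr := M.tr.prodMap N.tr
  smul_res := fun g x => Prod.ext (M.smul_res g x.1) (N.smul_res g x.2)
  tr_smul := fun g y => Prod.ext (M.tr_smul g y.1) (N.tr_smul g y.2)
  res_tr := fun y => by
    refine Prod.ext ?_ ?_
    · rw [Prod.fst_sum]; exact M.res_tr y.1
    · rw [Prod.snd_sum]; exact N.res_tr y.2

/-- The Mackey functor `g` with `g(C_p/C_p) = ℤ/p` and `g(C_p/e) = 0`. -/
def g (p : ℕ) [Fact p.Prime] : MackeyFunctor p where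
  top := ZMod p
  bot := PUnit
  act :=
    { smul := fun _ x => x
      one_smul := fun _ => rfl
      mul_smul := fun _ _ _ => rfl
      smul_zero := fun _ => rfl
      smul_add := fun _ _ _ => rfl }
  res := 0
  tr := 0
  smul_res := fun _ _ => rfl
  tr_smul := fun _ _ => rfl
  res_tr := fun _ => rfl

/-- A Mackey subfunctor. -/
structure Sub (M : MackeyFunctor p) where
  top : AddSubgroup M.top
  bot : AddSubgroup M.bot
  res_mem : ∀ x ∈ top, M.res x ∈ bot
  tr_mem : ∀ y ∈ bot, M.tr y ∈ top
  smul_mem : ∀ (g : Cp p), ∀ y ∈ bot, g • y ∈ bot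

/-- A Mackey subfunctor, as a Mackey functor. -/
def Sub.toMackey {M : MackeyFunctor p} (S : Sub M) : MackeyFunctor p where
  top := S.top
  bot := S.bot
  act :=
    { smul := fun g y => ⟨g • y.1, S.smul_mem g y.1 y.2⟩
      one_smul := fun y => Subtype.ext (one_smul _ y.1)
      mul_smul := fun g h y => Subtype.ext (mul_smul g h y.1)
      smul_zero := fun g => Subtype.ext (smul_zero g)
      smul_add := fun g y z => Subtype.ext (smul_add g y.1 z.1) }
  res := (M.res.comp S.top.subtype).codRestrict S.bot fun x => S.res_mem x.1 x.2
  tr := (M.tr.comp S.bot.subtype).codRestrict S.top fun y => S.tr_mem y.1 y.2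
  smul_res := fun g x => Subtype.ext (M.smul_res g x.1)
  tr_smul := fun g y => Subtype.ext (M.tr_smul g y.1)
  res_tr := fun y => Subtype.ext (by
    rw [AddSubgroup.val_finsetSum]
    exact M.res_tr y.1)

/-- The quotient of a Mackey functor by a Mackey subfunctor. -/
def quot (M : MackeyFunctor p) (S : Sub M) : MackeyFunctor p where
  top := M.top ⧸ S.top
  bot := M.bot ⧸ S.bot
  act :=
    { smul := fun g =>
        QuotientAddGroup.map S.bot S.bot (DistribSMul.toAddMonoidHom M.bot g) (S.smul_mem g)
      one_smul := by
        rintro ⟨y⟩; exact congrArg (QuotientAddGroup.mk (s := S.bot)) (one_smul _ y)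
      mul_smul := by
        rintro g h ⟨y⟩; exact congrArg (QuotientAddGroup.mk (s := S.bot)) (mul_smul g h y)
      smul_zero := fun g => map_zero (QuotientAddGroup.map S.bot S.bot
        (DistribSMul.toAddMonoidHom M.bot g) (S.smul_mem g))
      smul_add := fun g => map_add (QuotientAddGroup.map S.bot S.bot
        (DistribSMul.toAddMonoidHom M.bot g) (S.smul_mem g)) }
  res := QuotientAddGroup.map S.top S.bot M.res S.res_mem
  tr := QuotientAddGroup.map S.bot S.top M.tr S.tr_mem
  smul_res := by
    rintro g ⟨x⟩; exact congrArg (QuotientAddGroup.mk (s := S.bot)) (M.smul_res g x)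
  tr_smul := by
    rintro g ⟨y⟩; exact congrArg (QuotientAddGroup.mk (s := S.top)) (M.tr_smul g y)
  res_tr := by
    rintro ⟨y⟩
    refine (congrArg (QuotientAddGroup.mk' S.bot) (M.res_tr y)).trans ?_
    rw [map_sum]
    rfl

/-- The Mackey subfunctor generated by a set of elements at each level: the intersection of all
Mackey subfunctors that contain them. -/
def span (M : MackeyFunctor p) (s : Set M.top) (t : Set M.bot) : Sub M where
  top := ⨅ S : {S : Sub M // s ⊆ S.top ∧ t ⊆ S.bot}, S.1.top
  bot := ⨅ S : {S : Sub M // s ⊆ S.top ∧ t ⊆ S.bot}, S.1.bot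
  res_mem := fun x hx => by
    rw [AddSubgroup.mem_iInf] at hx ⊢
    exact fun S => S.1.res_mem x (hx S)
  tr_mem := fun y hy => by
    rw [AddSubgroup.mem_iInf] at hy ⊢
    exact fun S => S.1.tr_mem y (hy S)
  smul_mem := fun g y hy => by
    rw [AddSubgroup.mem_iInf] at hy ⊢
    exact fun S => S.1.smul_mem g y (hy S)

/-- Elements `s` at level `C_p/C_p` and `t` at level `C_p/e` generate `M` as a Mackey functor. -/
def Generates (M : MackeyFunctor p) (s : Set M.top) (t : Set M.bot) : Prop :=
  (M.span s t).top = ⊤ ∧ (M.span s t).bot = ⊤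

/-- The rank of a Mackey functor: the least number of elements (at either level) that generate
it as a Mackey functor. It is `⊤` if the Mackey functor is not finitely generated. -/
noncomputable def rank (M : MackeyFunctor p) : ℕ∞ :=
  sInf {n : ℕ∞ | ∃ (s : Set M.top) (t : Set M.bot), M.Generates s t ∧ n = s.encard + t.encard}

/-- The kernel of a morphism of Mackey functors. -/
def Hom.ker {M N : MackeyFunctor p} (f : Hom M N) : Sub M where
  top := f.top.ker
  bot := f.bot.ker
  res_mem := fun x hx => by
    rw [AddMonoidHom.mem_ker] at hx ⊢
    rw [f.map_res, hx, map_zero]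
  tr_mem := fun y hy => by
    rw [AddMonoidHom.mem_ker] at hy ⊢
    rw [f.map_tr, hy, map_zero]
  smul_mem := fun g y hy => by
    rw [AddMonoidHom.mem_ker] at hy ⊢
    rw [f.map_smul, hy, smul_zero]

/-- For `f : M ⟶ N`, the preimage in a subfunctor `S` of `N` of the image of `f`. -/
def Hom.rangeIn {M N : MackeyFunctor p} (f : Hom M N) (S : Sub N) : Sub S.toMackey where
  top := f.top.range.addSubgroupOf S.top
  bot := f.bot.range.addSubgroupOf S.bot
  res_mem := by
    rintro ⟨_, h⟩ ⟨x, rfl⟩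
    exact ⟨M.res x, f.map_res x⟩
  tr_mem := by
    rintro ⟨_, h⟩ ⟨y, rfl⟩
    exact ⟨M.tr y, f.map_tr y⟩
  smul_mem := by
    rintro g ⟨_, h⟩ ⟨y, rfl⟩
    exact ⟨g • y, f.map_smul g y⟩

/-- The homology `ker g / im f` of `M ⟶ N ⟶ P` at `N`. -/
def homology {M N P : MackeyFunctor p} (f : Hom M N) (g : Hom N P) : MackeyFunctor p :=
  g.ker.toMackey.quot (f.rangeIn g.ker)

end MackeyFunctor

/-! ## Green functors and Tambara functors -/

/-- A (commutative) `C_p`-Green functor. -/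
structure GreenFunctor (p : ℕ) [Fact p.Prime] where
  top : Type
  bot : Type
  [topRing : CommRing top]
  [botRing : CommRing bot]
  [act : MulSemiringAction (Cp p) bot]
  res : top →+* bot
  tr : bot →+ top
  smul_res : ∀ (g : Cp p) (x : top), g • res x = res x
  tr_smul : ∀ (g : Cp p) (y : bot), tr (g • y) = tr y
  res_tr : ∀ y : bot, res (tr y) = ∑ g : Cp p, g • y
  tr_res_mul : ∀ (x : top) (y : bot), tr (res x * y) = x * tr y

attribute [instance] GreenFunctor.topRing GreenFunctor.botRing GreenFunctor.act

/-- The underlying Mackey functor of a Green functor. -/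
def GreenFunctor.toMackey {p : ℕ} [Fact p.Prime] (R : GreenFunctor p) : MackeyFunctor p where
  top := R.top
  bot := R.bot
  res := R.res
  tr := R.tr
  smul_res := R.smul_res
  tr_smul := R.tr_smul
  res_tr := R.res_tr

/-- The nonempty proper subsets of `C_p`. A subset `S` stands for the non-constant function
`C_p → {a, b}` with value `a` exactly on `S`. -/
def ProperPart (p : ℕ) [Fact p.Prime] : Type :=
  {S : Finset (Cp p) // S ≠ ∅ ∧ S ≠ Finset.univ}

noncomputable instance (p : ℕ) [Fact p.Prime] : Fintype (ProperPart p) := by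
  classical exact inferInstanceAs (Fintype {S : Finset (Cp p) // S ≠ ∅ ∧ S ≠ Finset.univ})

open scoped Pointwise in
/-- `C_p` acts on its nonempty proper subsets by translation. -/
instance (p : ℕ) [Fact p.Prime] : MulAction (Cp p) (ProperPart p) where
  smul := fun g S => ⟨g • S.1, by
    refine ⟨fun h => S.2.1 (Finset.smul_finset_eq_empty.1 h), fun h => S.2.2 ?_⟩
    rw [← inv_smul_smul g S.1, h, Finset.smul_finset_univ]⟩
  one_smul := fun S => Subtype.ext (one_smul _ S.1)
  mul_smul := fun g h S => Subtype.ext (mul_smul g h S.1)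

/-- The translation orbits of nonempty proper subsets of `C_p`. -/
abbrev ProperOrbit (p : ℕ) [Fact p.Prime] : Type :=
  MulAction.orbitRel.Quotient (Cp p) (ProperPart p)

noncomputable instance (p : ℕ) [Fact p.Prime] : Fintype (ProperOrbit p) := by
  classical exact Fintype.ofFinite _

/-- The product of all `g • a` with `g ∈ S` and all `g • b` with `g ∉ S`. -/
noncomputable def mixedProduct {p : ℕ} [Fact p.Prime] {B : Type} [CommRing B]
    [MulSemiringAction (Cp p) B] (a b : B) (S : ProperPart p) : B :=
  (∏ g ∈ S.1, g • a) * ∏ g ∈ Finset.univ \ S.1, g • b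

/-- A `C_p`-Tambara functor: a Green functor with a multiplicative norm that satisfies the
multiplicative double coset formula and the distributive law for the norm of a sum
`nm (a + b) = nm a + nm b + ∑ tr (mixed product)`, where the sum has one term for each
`C_p`-orbit of non-constant functions `C_p → {a, b}`. Mixed products of functions in one orbit are
conjugate under `C_p`, so their transfers do not depend on the chosen representative. -/
structure TambaraFunctor (p : ℕ) [Fact p.Prime] extends GreenFunctor p where
  nm : bot →* top
  nm_smul : ∀ (g : Cp p) (y : bot), nm (g • y) = nm y
  res_nm : ∀ y : bot, res (nm y) = ∏ g : Cp p, g • y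
  nm_add : ∀ a b : bot, nm (a + b) =
    nm a + nm b + ∑ o : ProperOrbit p, tr (mixedProduct a b (Quotient.out o))

/-- Morphisms of Green functors. -/
@[ext]
structure GreenFunctor.Hom {p : ℕ} [Fact p.Prime] (R S : GreenFunctor p) where
  top : R.top →+* S.top
  bot : R.bot →+* S.bot
  map_res : ∀ x, bot (R.res x) = S.res (top x)
  map_tr : ∀ y, top (R.tr y) = S.tr (bot y)
  map_smul : ∀ (g : Cp p) (y : R.bot), bot (g • y) = g • bot y

/-- Morphisms of Tambara functors. -/
@[ext]
structure TambaraFunctor.Hom {p : ℕ} [Fact p.Prime] (R S : TambaraFunctor p) extends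
    GreenFunctor.Hom R.toGreenFunctor S.toGreenFunctor where
  map_nm : ∀ y, top (R.nm y) = S.nm (bot y)

/-- `R` is the free Tambara functor on the generator `x` at level `C_p/C_p`: Tambara morphisms
`R ⟶ T` correspond to elements of `T(C_p/C_p)` by evaluation at `x`. -/
def TambaraFunctor.IsFreeOnFixed {p : ℕ} [Fact p.Prime] (R : TambaraFunctor p) (x : R.top) :
    Prop :=
  ∀ (T : TambaraFunctor p) (y : T.top), ∃! f : TambaraFunctor.Hom R T, f.top x = y

/-! ## The Burnside Tambara functor -/

section Burnside

/-- The Burnside ring `ℤ[t]/(t² - pt)` of `C_p`. -/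
abbrev BurnsideRing (p : ℕ) : Type := AdjoinRoot (Polynomial.X ^ 2 - (p : ℤ[X]) * Polynomial.X)

/-- The class `t` of the free orbit. -/
noncomputable abbrev BurnsideRing.t (p : ℕ) : BurnsideRing p :=
  AdjoinRoot.root (Polynomial.X ^ 2 - (p : ℤ[X]) * Polynomial.X)

theorem BurnsideRing.t_mul_t (p : ℕ) : t p * t p = p * t p := by
  have h := AdjoinRoot.eval₂_root (Polynomial.X ^ 2 - (p : ℤ[X]) * Polynomial.X)
  simp only [Polynomial.eval₂_sub, Polynomial.eval₂_mul, Polynomial.eval₂_pow,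
    Polynomial.eval₂_X, Polynomial.eval₂_natCast] at h
  linear_combination h

/-- The ring homomorphism `ℤ[t]/(t² - pt) → ℤ` with `t ↦ p`. -/
noncomputable def BurnsideRing.res (p : ℕ) : BurnsideRing p →+* ℤ :=
  AdjoinRoot.lift (RingHom.id ℤ) (p : ℤ) (by simp; ring)

theorem BurnsideRing.res_t (p : ℕ) : BurnsideRing.res p (t p) = p := by
  simp [BurnsideRing.res]

/-- Multiplication by `t` on `ℤ[t]/(t² - pt)` factors through `res`. -/
theorem BurnsideRing.mul_t (p : ℕ) (a : BurnsideRing p) : a * t p = (res p a : ℤ) * t p := by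
  induction a using AdjoinRoot.induction_on with
  | ih f =>
    induction f using Polynomial.induction_on' with
    | add f g hf hg => simp only [map_add, add_mul, hf, hg, Int.cast_add]
    | monomial n a =>
      have key : t p ^ n * t p = (p : BurnsideRing p) ^ n * t p := by
        induction n with
        | zero => simp
        | succ n ih => linear_combination (t p) ^ n * t_mul_t p + (p : BurnsideRing p) * ih
      rw [← Polynomial.C_mul_X_pow_eq_monomial]
      simp only [map_mul, map_pow, AdjoinRoot.mk_X, AdjoinRoot.mk_C]
      rw [mul_assoc, key, res_t]
      simp [BurnsideRing.res, mul_assoc]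

variable (p : ℕ) [Fact p.Prime]

/-- A function on the nonempty proper subsets of `C_p` that is invariant under translation has
sum `p` times its sum over orbits. -/
theorem sum_properPart (F : ProperPart p → ℤ) (hF : ∀ (g : Cp p) S, F (g • S) = F S) :
    ∑ S, F S = p * ∑ o : ProperOrbit p, F (Quotient.out o) := by
  classical
  have hstab : ∀ S : ProperPart p, Nat.card (MulAction.orbit (Cp p) S) = p := by
    intro S
    have hcard : Nat.card (Cp p) = p := by simp [Cp]
    have hmul := MulAction.index_stabilizer (Cp p) S
    rw [← Nat.card_coe_set_eq] at hmul
    have hdvd : (MulAction.stabilizer (Cp p) S).index ∣ p := by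
      conv_rhs => rw [← hcard]
      exact Subgroup.index_dvd_card _
    rcases (Nat.dvd_prime (Fact.out : p.Prime)).1 hdvd with h | h
    · exfalso
      rw [Subgroup.index_eq_one] at h
      obtain ⟨x, hx⟩ := Finset.nonempty_iff_ne_empty.2 S.2.1
      refine S.2.2 (Finset.eq_univ_iff_forall.2 fun y => ?_)
      have hy : y * x⁻¹ ∈ MulAction.stabilizer (Cp p) S := h ▸ Subgroup.mem_top _
      have hS : (y * x⁻¹) • S = S := hy
      have hv : (open scoped Pointwise in (y * x⁻¹) • S.1) = S.1 := congrArg Subtype.val hS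
      rw [← hv]
      exact Finset.mem_smul_finset.2 ⟨x, hx, by simp⟩
    · rw [← hmul, h]
  rw [← (MulAction.selfEquivSigmaOrbits (Cp p) (ProperPart p)).symm.sum_comp F,
    Fintype.sum_sigma, Finset.mul_sum]
  refine Finset.sum_congr rfl fun o _ => ?_
  have : ∀ y : MulAction.orbit (Cp p) (Quotient.out o),
      F ((MulAction.selfEquivSigmaOrbits (Cp p) (ProperPart p)).symm ⟨o, y⟩) =
        F (Quotient.out o) := by
    rintro ⟨_, g, rfl⟩
    exact hF g _
  rw [Finset.sum_congr rfl fun y _ => this y, Finset.sum_const, Finset.card_univ,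
    ← Nat.card_eq_fintype_card, hstab, nsmul_eq_mul]

/-- The trivial action of `C_p` on `ℤ`. -/
abbrev trivialIntAction : MulSemiringAction (Cp p) ℤ where
  smul := fun _ x => x
  one_smul := fun _ => rfl
  mul_smul := fun _ _ _ => rfl
  smul_zero := fun _ => rfl
  smul_add := fun _ _ _ => rfl
  smul_one := fun _ => rfl
  smul_mul := fun _ _ _ => rfl

/-- The integer `(a ^ p - a) / p`. -/
def fermatQuot (a : ℤ) : ℤ := (a ^ p - a) / p

theorem mul_fermatQuot (a : ℤ) : (p : ℤ) * fermatQuot p a = a ^ p - a := by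
  refine Int.mul_ediv_cancel' ?_
  rw [← ZMod.intCast_eq_intCast_iff_dvd_sub]
  simp

theorem fermatQuot_add (a b : ℤ) :
    letI := trivialIntAction p
    fermatQuot p (a + b) = fermatQuot p a + fermatQuot p b +
      ∑ o : ProperOrbit p, mixedProduct a b (Quotient.out o) := by
  classical
  letI := trivialIntAction p
  have hp : (p : ℤ) ≠ 0 := by exact_mod_cast (Fact.out : p.Prime).ne_zero
  have hF : ∀ S : ProperPart p,
      mixedProduct a b S = a ^ S.1.card * b ^ (p - S.1.card) := by
    intro S
    have h1 : ∀ (g : Cp p) (x : ℤ), g • x = x := fun _ _ => rfl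
    simp [mixedProduct, h1, Finset.card_sdiff, Finset.card_univ, Cp]
  have hsum := sum_properPart p (mixedProduct a b) (fun g S => by
    rw [hF, hF]
    have : (g • S).1.card = S.1.card := Finset.card_smul_finset g S.1
    rw [this])
  have hbin : (a + b) ^ p = a ^ p + b ^ p + ∑ S : ProperPart p, mixedProduct a b S := by
    have h := Finset.prod_add (fun _ : Cp p => a) (fun _ => b) Finset.univ
    have hne : (∅ : Finset (Cp p)) ≠ Finset.univ := Finset.univ_nonempty.ne_empty.symm
    rw [Finset.powerset_univ] at h
    have hs : ∑ t : Finset (Cp p), (∏ _i ∈ t, a) * ∏ _i ∈ Finset.univ \ t, b =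
        a ^ p + b ^ p + ∑ S : ProperPart p, mixedProduct a b S := by
      rw [← Finset.add_sum_erase _ _ (Finset.mem_univ (Finset.univ : Finset (Cp p))),
        ← Finset.add_sum_erase _ _ (Finset.mem_erase.2 ⟨hne, Finset.mem_univ _⟩), ← add_assoc]
      congr 1
      · simp [Cp]
      · exact Finset.sum_subtype (F := inferInstanceAs (Fintype (ProperPart p))) _
          (p := fun S : Finset (Cp p) => S ≠ ∅ ∧ S ≠ Finset.univ) (fun x => by simp) _
    rw [← hs, ← h]
    simp [Cp]
  apply mul_left_cancel₀ hp
  rw [mul_add, mul_add, ← hsum, mul_fermatQuot, mul_fermatQuot, mul_fermatQuot, hbin]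
  ring

/-- The Burnside Tambara functor `A`: it has `A(C_p/C_p) = ℤ[t]/(t² - pt)` and `A(C_p/e) = ℤ` with
trivial action, `res t = p`, `tr a = a t` and `nm a = a + ((a ^ p - a) / p) t`. -/
noncomputable def burnside : TambaraFunctor p where
  top := BurnsideRing p
  bot := ℤ
  act := trivialIntAction p
  res := BurnsideRing.res p
  tr :=
    { toFun := fun a => a * BurnsideRing.t p
      map_zero' := by simp
      map_add' := fun a b => by push_cast; ring }
  smul_res := fun _ _ => rfl
  tr_smul := fun _ _ => rfl
  res_tr := fun y => by
    have h : ∀ g : Cp p, (letI := trivialIntAction p; g • y) = y := fun _ => rfl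
    simp only [h]
    simp [BurnsideRing.res_t, Cp, mul_comm]
  tr_res_mul := fun x y => by
    have := BurnsideRing.mul_t p x
    simp only [AddMonoidHom.coe_mk, ZeroHom.coe_mk, Int.cast_mul]
    linear_combination (-(y : BurnsideRing p)) * this
  nm :=
    { toFun := fun a => a + fermatQuot p a * BurnsideRing.t p
      map_one' := by simp [fermatQuot]
      map_mul' := fun a b => by
        have hp : (p : ℤ) ≠ 0 := by exact_mod_cast (Fact.out : p.Prime).ne_zero
        have key : fermatQuot p (a * b) = a * fermatQuot p b + b * fermatQuot p a +
            p * (fermatQuot p a * fermatQuot p b) := by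
          apply mul_left_cancel₀ hp
          have h1 := mul_fermatQuot p a
          have h2 := mul_fermatQuot p b
          have h3 := mul_fermatQuot p (a * b)
          rw [mul_pow] at h3
          have h1' : a ^ p = a + p * fermatQuot p a := by linear_combination -h1
          have h2' : b ^ p = b + p * fermatQuot p b := by linear_combination -h2
          rw [h3, h1', h2']
          ring
        rw [key]
        push_cast
        linear_combination (-(fermatQuot p a * fermatQuot p b : BurnsideRing p)) *
          BurnsideRing.t_mul_t p }
  nm_smul := fun _ _ => rfl
  res_nm := fun y => by
    have h : ∀ g : Cp p, (letI := trivialIntAction p; g • y) = y := fun _ => rfl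
    simp only [h]
    have := mul_fermatQuot p y
    simp [BurnsideRing.res_t, Cp]
    linear_combination this
  nm_add := fun a b => by
    have h := fermatQuot_add p a b
    simp only [MonoidHom.coe_mk, OneHom.coe_mk, AddMonoidHom.coe_mk, ZeroHom.coe_mk]
    rw [h, ← Finset.sum_mul]
    push_cast
    ring

/-- The Mackey functor `L = A{x_G} / (res x_G)`: the quotient of the free Mackey functor
`A{x_G} = A` on a fixed generator by the subfunctor generated by the restriction of the
generator `x_G = 1`. -/
noncomputable def mackeyL : MackeyFunctor p :=
  let A := (burnside p).toMackey
  A.quot (A.span ∅ {(burnside p).res 1})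

end Burnside

/-! ## Modules over Green functors, the box product, and Tor -/

/-- A module over a Green functor `R`: a Mackey functor whose values are modules over the values
of `R`, compatibly with restriction, conjugation and transfer. -/
structure GreenModule {p : ℕ} [Fact p.Prime] (R : GreenFunctor p) extends MackeyFunctor p where
  [topModule : Module R.top top]
  [botModule : Module R.bot bot]
  res_smul : ∀ (a : R.top) (m : top), res (a • m) = R.res a • res m
  act_smul : ∀ (g : Cp p) (b : R.bot) (m : bot), g • (b • m) = (g • b) • (g • m)
  tr_res_smul : ∀ (a : R.top) (m : bot), tr (R.res a • m) = a • tr m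
  tr_smul_res : ∀ (b : R.bot) (m : top), tr (b • res m) = R.tr b • m

attribute [instance] GreenModule.topModule GreenModule.botModule

/-- The underlying `R`-module of a Green functor `S` over `R`. -/
noncomputable def GreenFunctor.Hom.toModule {p : ℕ} [Fact p.Prime] {R S : GreenFunctor p}
    (f : GreenFunctor.Hom R S) : GreenModule R where
  toMackeyFunctor := S.toMackey
  topModule := Module.compHom S.top f.top
  botModule := Module.compHom S.bot f.bot
  res_smul := fun a (m : S.top) => by
    change S.res (f.top a * m) = f.bot (R.res a) * S.res m
    rw [map_mul, f.map_res]
  act_smul := fun g b (m : S.bot) => by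
    change g • (f.bot b * m) = f.bot (g • b) * g • m
    rw [smul_mul', f.map_smul]
  tr_res_smul := fun a (m : S.bot) => by
    change S.tr (f.bot (R.res a) * m) = f.top a * S.tr m
    rw [f.map_res, S.tr_res_mul]
  tr_smul_res := fun b (m : S.top) => by
    change S.tr (f.bot b * S.res m) = f.top (R.tr b) * m
    rw [mul_comm, S.tr_res_mul, f.map_tr, mul_comm]

namespace GreenModule

variable {p : ℕ} [Fact p.Prime] {R : GreenFunctor p}

/-- Morphisms of `R`-modules. -/
@[ext]
structure Hom (M N : GreenModule R) where
  top : M.top →ₗ[R.top] N.top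
  bot : M.bot →ₗ[R.bot] N.bot
  map_res : ∀ x, bot (M.res x) = N.res (top x)
  map_tr : ∀ y, top (M.tr y) = N.tr (bot y)
  map_act : ∀ (g : Cp p) (y : M.bot), bot (g • y) = g • bot y

/-- Surjectivity of a morphism of `R`-modules, at both levels. -/
def Hom.Surjective {M N : GreenModule R} (f : Hom M N) : Prop :=
  Function.Surjective f.top ∧ Function.Surjective f.bot

/-- Exactness of `M ⟶ N ⟶ P` at `N`, at both levels. -/
def Hom.Exact {M N P : GreenModule R} (f : Hom M N) (g : Hom N P) : Prop :=
  Function.Exact f.top g.top ∧ Function.Exact f.bot g.bot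

/-- An `R`-module is projective if morphisms out of it lift along surjections of `R`-modules. -/
def IsProjective (P : GreenModule R) : Prop :=
  ∀ (M N : GreenModule R) (q : Hom M N) (f : Hom P N), q.Surjective →
    ∃ h : Hom P M, (∀ x, q.top (h.top x) = f.top x) ∧ ∀ y, q.bot (h.bot y) = f.bot y

/-- A projective resolution `⋯ ⟶ X 1 ⟶ X 0 ⟶ M ⟶ 0` of an `R`-module `M`. -/
structure ProjectiveResolution (M : GreenModule R) where
  X : ℕ → GreenModule R
  d : ∀ n, Hom (X (n + 1)) (X n)
  aug : Hom (X 0) M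
  projective : ∀ n, (X n).IsProjective
  aug_surjective : aug.Surjective
  exact_zero : (d 0).Exact aug
  exact_succ : ∀ n, (d (n + 1)).Exact (d n)

section Box

variable (M N : GreenModule R)

/-- The diagonal action of `g : C_p` on `M(C_p/e) ⊗ N(C_p/e)`. -/
noncomputable def boxAct (g : Cp p) : M.bot ⊗[R.bot] N.bot →+ M.bot ⊗[R.bot] N.bot :=
  TensorProduct.liftAddHom
    (AddMonoidHom.mk' (fun m => AddMonoidHom.mk' (fun n => (g • m) ⊗ₜ[R.bot] (g • n))
        fun n n' => by rw [smul_add, TensorProduct.tmul_add])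
      fun m m' => by ext n; simp [smul_add, TensorProduct.add_tmul])
    fun r m n => by simp [act_smul, TensorProduct.smul_tmul]

@[simp]
theorem boxAct_tmul (g : Cp p) (m : M.bot) (n : N.bot) :
    boxAct M N g (m ⊗ₜ n) = (g • m) ⊗ₜ (g • n) := rfl

/-- The diagonal action of `C_p` on `M(C_p/e) ⊗ N(C_p/e)`. -/
noncomputable instance boxAction : DistribMulAction (Cp p) (M.bot ⊗[R.bot] N.bot) where
  smul := fun g => boxAct M N g
  one_smul := fun z => by
    change boxAct M N 1 z = z
    induction z using TensorProduct.induction_on with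
    | zero => simp
    | tmul m n => simp
    | add x y hx hy => rw [map_add, hx, hy]
  mul_smul := fun g h z => by
    change boxAct M N (g * h) z = boxAct M N g (boxAct M N h z)
    induction z using TensorProduct.induction_on with
    | zero => simp
    | tmul m n => simp [mul_smul]
    | add x y hx hy => simp only [map_add, hx, hy]
  smul_zero := fun g => map_zero (boxAct M N g)
  smul_add := fun g => map_add (boxAct M N g)

theorem box_smul_tmul (g : Cp p) (m : M.bot) (n : N.bot) :
    g • (m ⊗ₜ[R.bot] n) = (g • m) ⊗ₜ[R.bot] (g • n) := rfl

/-- The group `(M(C_p/C_p) ⊗ N(C_p/C_p)) ⊕ (M(C_p/e) ⊗ N(C_p/e))`, with tensor products over the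
values of `R`, of which the fixed level of the box product over `R` is a quotient. -/
abbrev BoxPre : Type := (M.top ⊗[R.top] N.top) × (M.bot ⊗[R.bot] N.bot)

/-- The relations at the fixed level of the box product: the second summand (whose elements
represent transfers) is reduced to its `C_p`-coinvariants, and Frobenius reciprocity
`tr b ⊗ n = tr (b ⊗ res n)`, `m ⊗ tr c = tr (res m ⊗ c)` is imposed. -/
def boxRel : AddSubgroup (BoxPre M N) :=
  AddSubgroup.closure
    ({z | ∃ (g : Cp p) (w : M.bot ⊗[R.bot] N.bot), z = (0, g • w) - (0, w)} ∪
      {z | ∃ (b : M.bot) (n : N.top), z = (M.tr b ⊗ₜ n, 0) - (0, b ⊗ₜ N.res n)} ∪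
      {z | ∃ (m : M.top) (c : N.bot), z = (m ⊗ₜ N.tr c, 0) - (0, M.res m ⊗ₜ c)})

/-- The restriction `M(C_p/C_p) ⊗ N(C_p/C_p) → M(C_p/e) ⊗ N(C_p/e)`. -/
noncomputable def boxResTensor : M.top ⊗[R.top] N.top →+ M.bot ⊗[R.bot] N.bot :=
  TensorProduct.liftAddHom
    (AddMonoidHom.mk' (fun m => AddMonoidHom.mk' (fun n => M.res m ⊗ₜ[R.bot] N.res n)
        fun n n' => by rw [map_add, TensorProduct.tmul_add])
      fun m m' => by ext n; simp [TensorProduct.add_tmul])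
    fun r m n => by simp [res_smul, TensorProduct.smul_tmul]

@[simp]
theorem boxResTensor_tmul (m : M.top) (n : N.top) :
    boxResTensor M N (m ⊗ₜ n) = M.res m ⊗ₜ N.res n := rfl

/-- The norm element `z ↦ ∑ g, g • z`, as a homomorphism. -/
noncomputable def boxSum : M.bot ⊗[R.bot] N.bot →+ M.bot ⊗[R.bot] N.bot :=
  ∑ g : Cp p, DistribSMul.toAddMonoidHom (M.bot ⊗[R.bot] N.bot) g

theorem boxSum_apply (z : M.bot ⊗[R.bot] N.bot) : boxSum M N z = ∑ g : Cp p, g • z := by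
  simp [boxSum]

theorem boxSum_smul (g : Cp p) (z : M.bot ⊗[R.bot] N.bot) :
    boxSum M N (g • z) = boxSum M N z := by
  rw [boxSum_apply, boxSum_apply]
  simp only [← mul_smul]
  exact Equiv.sum_comp (Equiv.mulRight g) fun h => h • z

theorem smul_boxSum (g : Cp p) (z : M.bot ⊗[R.bot] N.bot) :
    g • boxSum M N z = boxSum M N z := by
  rw [boxSum_apply, Finset.smul_sum]
  simp only [← mul_smul]
  exact Equiv.sum_comp (Equiv.mulLeft g) fun h => h • z

/-- The restriction before passing to the quotient: `(w, z) ↦ res w + ∑ g, g • z`. -/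
noncomputable def boxResPre : BoxPre M N →+ M.bot ⊗[R.bot] N.bot :=
  (boxResTensor M N).coprod (boxSum M N)

theorem boxRel_le_ker : boxRel M N ≤ (boxResPre M N).ker := by
  refine (AddSubgroup.closure_le _).2 ?_
  rintro z ((⟨g, w, rfl⟩ | ⟨b, n, rfl⟩) | ⟨m, c, rfl⟩)
  · simp [boxResPre, boxSum_smul]
  · simp only [boxResPre, SetLike.mem_coe, AddMonoidHom.mem_ker, map_sub,
      AddMonoidHom.coprod_apply, map_zero, boxResTensor_tmul, boxSum_apply, M.res_tr,
      box_smul_tmul, N.smul_res, TensorProduct.sum_tmul, add_zero, zero_add, sub_self]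
  · simp only [boxResPre, SetLike.mem_coe, AddMonoidHom.mem_ker, map_sub,
      AddMonoidHom.coprod_apply, map_zero, boxResTensor_tmul, boxSum_apply, N.res_tr,
      box_smul_tmul, M.smul_res, TensorProduct.tmul_sum, add_zero, zero_add, sub_self]

/-- The box product `M ⊠_R N` over `R`, as a Mackey functor. -/
noncomputable def box : MackeyFunctor p where
  top := BoxPre M N ⧸ boxRel M N
  bot := M.bot ⊗[R.bot] N.bot
  res := QuotientAddGroup.lift (boxRel M N) (boxResPre M N) fun _ hz => boxRel_le_ker M N hz
  tr := (QuotientAddGroup.mk' (boxRel M N)).comp (AddMonoidHom.inr _ _)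
  smul_res := by
    rintro g ⟨w, z⟩
    change g • (boxResTensor M N w + boxSum M N z) = boxResTensor M N w + boxSum M N z
    rw [smul_add, smul_boxSum]
    congr 1
    induction w using TensorProduct.induction_on with
    | zero => simp
    | tmul m n => rw [boxResTensor_tmul, box_smul_tmul, M.smul_res, N.smul_res]
    | add x y hx hy => rw [map_add, smul_add, hx, hy]
  tr_smul := fun g y => by
    refine (QuotientAddGroup.eq_iff_sub_mem).2 ?_
    exact AddSubgroup.subset_closure (Or.inl (Or.inl ⟨g, y, rfl⟩))
  res_tr := fun y => by
    change boxResTensor M N 0 + boxSum M N y = _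
    rw [map_zero, zero_add, boxSum_apply]

end Box

theorem Hom.rTensor_smul {M M' : GreenModule R} (f : Hom M M') (N : GreenModule R) (g : Cp p)
    (w : M.bot ⊗[R.bot] N.bot) :
    f.bot.rTensor N.bot (g • w) = g • f.bot.rTensor N.bot w := by
  induction w using TensorProduct.induction_on with
  | zero => simp
  | tmul m n => simp [box_smul_tmul, f.map_act]
  | add x y hx hy => simp only [map_add, smul_add, hx, hy]

/-- The morphism `f ⊠_R N : M ⊠_R N ⟶ M' ⊠_R N` induced by `f : M ⟶ M'`. -/
noncomputable def Hom.box {M M' : GreenModule R} (f : Hom M M') (N : GreenModule R) :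
    MackeyFunctor.Hom (M.box N) (M'.box N) where
  top := QuotientAddGroup.map (boxRel M N) (boxRel M' N)
    ((f.top.rTensor N.top).toAddMonoidHom.prodMap (f.bot.rTensor N.bot).toAddMonoidHom) (by
      refine (AddSubgroup.closure_le _).2 ?_
      rintro z ((⟨g, w, rfl⟩ | ⟨b, n, rfl⟩) | ⟨m, c, rfl⟩)
      · refine AddSubgroup.subset_closure (Or.inl (Or.inl ⟨g, f.bot.rTensor N.bot w, ?_⟩))
        simp [f.rTensor_smul]
      · refine AddSubgroup.subset_closure (Or.inl (Or.inr ⟨f.bot b, n, ?_⟩))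
        simp [f.map_tr]
      · refine AddSubgroup.subset_closure (Or.inr ⟨f.top m, c, ?_⟩)
        simp [f.map_res])
  bot := (f.bot.rTensor N.bot).toAddMonoidHom
  map_res := by
    rintro ⟨w, z⟩
    change f.bot.rTensor N.bot (boxResTensor M N w + boxSum M N z) =
      boxResTensor M' N (f.top.rTensor N.top w) + boxSum M' N (f.bot.rTensor N.bot z)
    rw [map_add, boxSum_apply, boxSum_apply, map_sum]
    congr 1
    · induction w using TensorProduct.induction_on with
      | zero => simp
      | tmul m n => simp [f.map_res]
      | add x y hx hy => simp only [map_add, hx, hy]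
    · exact Finset.sum_congr rfl fun g _ => f.rTensor_smul N g z
  map_tr := fun y => by
    refine congrArg (QuotientAddGroup.mk (s := boxRel M' N)) (Prod.ext ?_ rfl)
    exact map_zero (f.top.rTensor N.top)
  map_smul := fun g y => f.rTensor_smul N g y

/-- `Tor_i^R(M, N)`, the homology in degree `i` of `P ⊠_R N` for a projective resolution `P`
of `M`. -/
noncomputable def ProjectiveResolution.tor {M : GreenModule R} (P : ProjectiveResolution M)
    (N : GreenModule R) : ℕ → MackeyFunctor p
  | 0 => MackeyFunctor.homology ((P.d 0).box N) (MackeyFunctor.toZero _)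
  | n + 1 => MackeyFunctor.homology ((P.d (n + 1)).box N) ((P.d n).box N)

end GreenModule

/-! ### Elementary abelian p-groups: isomorphism type and generators -/

section ElementaryAbelian

variable {p : ℕ} [hp : Fact p.Prime] {V W : Type} [AddCommGroup V] [AddCommGroup W]

/-! The free functor R has an explicit model, `TambaraFunctor.poly`. Its free level is ℤ[x] with
trivial action. Its fixed level embeds into ℤ[x] × ℤ[x, n], with n the norm of `res x`, by
restriction and by reduction modulo transfers; the image consists of the pairs (f, q) with f ≡ q(x,
x^p) mod p. Put t = tr 1 = (p, 0) and u = n - x^p, which is the pair (0, n - x^p). The homological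
argument only uses elementary algebra in this ring, collected in `IsPolynomialBurnside` and checked
in `isPolynomialBurnside_poly`: the annihilator of u is the image of the transfer, x is regular
modulo u, the kernel of restriction is generated by t - p and u, their relations modulo transfers
are generated by u(t - p) + pu = 0, and A = R/(x, u) at both levels.

Since A is cyclic with annihilator (x, u), boxing a resolution P with A yields P/(x, u)P
(`IsCyclicModulo.tor_isIsomorphic`). Its homology, written H_i(M) for the resolved module M, is
independent of P (`homologyModulo_isIsomorphic`), so a resolution assembled from short exact
sequences may be used.

Multiplication by x on R/u is injective with cokernel A and is zero modulo (x, u). Its cone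
therefore splits after reduction: T_0 = H_0(R/u) and T_{i+1} = H_i(R/u) ⊕ H_{i+1}(R/u). Let J be the
transfer ideal (`dualConst`). The sequence 0 → J → R → R → R/u → 0, with middle map u, gives
H_0(R/u) = A, H_1(R/u) = L, H_2(R/u) = 0 and H_{i+2}(R/u) = H_i(J) for i ≥ 1.

The ideal J is resolved in terms of itself. The free module on a free-level generator maps onto J,
the kernel is covered by γ - 1, the kernel of that is covered by R, and what remains is K = ker res,
which vanishes at the free level. There are exact sequences 0 → R/J → R/J ⊕ R/J → K → 0, with maps
(u, p) and (t - p, u), and 0 → J → R → R/J → 0. Modulo (x, u) the map u vanishes; where p kills the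
homology as well, H_m(K) is an extension of H_{m-1}(R/J) by two copies of H_m(R/J)
(`isElementary_pairCone`). Hence the ranks of H_1(J), H_2(J), ... begin 0, 0, 1, 0, 0 and then
satisfy b_{n+5} = 2b_{n+1} + b_n (`homologyModulo_dualConst`).

A functor that vanishes at the free level and is killed by p at the fixed level is determined by its
order there. So the extensions need not be split: it suffices that p kills the middle term, and p is
null-homotopic on the cone of p. The order of such a functor also bounds its rank from below, and
the recurrence at least doubles the exponent every four degrees. -/

theorem card_eq_pow_finrank_zmod [Module (ZMod p) V] [Finite V] :
    Nat.card V = p ^ Module.finrank (ZMod p) V := by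
  have h : Nat.card V = Nat.card (ZMod p) ^ Module.finrank (ZMod p) V :=
    Module.natCard_eq_pow_finrank
  rwa [Nat.card_zmod] at h

theorem exists_addEquiv_of_finrank_eq [Module (ZMod p) V] [Finite V] [Module (ZMod p) W]
    [Finite W] (h : Module.finrank (ZMod p) V = Module.finrank (ZMod p) W) :
    Nonempty (V ≃+ W) :=
  ⟨(LinearEquiv.ofFinrankEq (R := ZMod p) V W h).toAddEquiv⟩

/-- An additive generating set spans over the prime field, because subspaces are in particular
subgroups. A spanning set has at least as many elements as the dimension. -/
theorem finrank_le_encard_of_closure_eq_top [Module (ZMod p) V] [Finite V] {s : Set V}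
    (hs : AddSubgroup.closure s = ⊤) : (Module.finrank (ZMod p) V : ℕ∞) ≤ s.encard := by
  have hspan : Submodule.span (ZMod p) s = ⊤ := by
    refine Submodule.eq_top_iff'.2 fun x => ?_
    have hx : x ∈ AddSubgroup.closure s := hs ▸ AddSubgroup.mem_top x
    exact (AddSubgroup.closure_le (Submodule.span (ZMod p) s).toAddSubgroup).2
      Submodule.subset_span hx
  let _ := s.toFinite.fintype
  have hle := finrank_span_le_card (R := ZMod p) s
  rw [hspan, finrank_top] at hle
  rw [Set.encard_eq_coe_toFinset_card]
  exact_mod_cast hle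

/-- A group killed by p is a vector space over the prime field, so its order fixes its dimension.
Exponent and order are the data that can be followed through an extension without a splitting. -/
theorem exists_addEquiv_of_card_eq_pow (hV : ∀ x : V, p • x = 0) (hW : ∀ x : W, p • x = 0) {k : ℕ}
    (cV : Nat.card V = p ^ k) (cW : Nat.card W = p ^ k) : Nonempty (V ≃+ W) := by
  have hp' : 0 < p := hp.out.pos
  have : Finite V := Nat.finite_of_card_ne_zero (by rw [cV]; positivity)
  have : Finite W := Nat.finite_of_card_ne_zero (by rw [cW]; positivity)
  let _ : Module (ZMod p) V := AddCommGroup.zmodModule hV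
  let _ : Module (ZMod p) W := AddCommGroup.zmodModule hW
  refine exists_addEquiv_of_finrank_eq (p := p) (Nat.pow_right_injective hp.out.two_le ?_)
  exact (card_eq_pow_finrank_zmod.symm.trans (cV.trans cW.symm)).trans card_eq_pow_finrank_zmod

theorem le_encard_of_closure_eq_top (hV : ∀ x : V, p • x = 0) {k : ℕ}
    (cV : Nat.card V = p ^ k) {s : Set V} (hs : AddSubgroup.closure s = ⊤) :
    (k : ℕ∞) ≤ s.encard := by
  have hp' : 0 < p := hp.out.pos
  have : Finite V := Nat.finite_of_card_ne_zero (by rw [cV]; positivity)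
  let _ : Module (ZMod p) V := AddCommGroup.zmodModule hV
  have hk := Nat.pow_right_injective hp.out.two_le (cV.symm.trans card_eq_pow_finrank_zmod)
  rw [hk]
  exact finrank_le_encard_of_closure_eq_top hs

end ElementaryAbelian

/-! ### Isomorphisms and subquotients of Mackey functors -/

namespace MackeyFunctor

variable {p : ℕ} [Fact p.Prime]

/-- The composite of two morphisms of Mackey functors. -/
def Hom.comp {M N P : MackeyFunctor p} (g : Hom N P) (f : Hom M N) : Hom M P where
  top := g.top.comp f.top
  bot := g.bot.comp f.bot
  map_res := fun x => by simp [f.map_res, g.map_res]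
  map_tr := fun x => by simp [f.map_tr, g.map_tr]
  map_smul := fun a x => by simp [f.map_smul, g.map_smul]

theorem IsIsomorphic.trans {M N P : MackeyFunctor p} (h : M.IsIsomorphic N)
    (h' : N.IsIsomorphic P) : M.IsIsomorphic P := by
  obtain ⟨f, hf, hf'⟩ := h
  obtain ⟨g, hg, hg'⟩ := h'
  exact ⟨g.comp f, hg.comp hf, hg'.comp hf'⟩

theorem IsIsomorphic.symm {M N : MackeyFunctor p} (h : M.IsIsomorphic N) : N.IsIsomorphic M := by
  obtain ⟨f, hf, hf'⟩ := h
  let e := AddEquiv.ofBijective f.top hf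
  let e' := AddEquiv.ofBijective f.bot hf'
  have he : ∀ x, f.top (e.symm x) = x := e.apply_symm_apply
  have he' : ∀ x, f.bot (e'.symm x) = x := e'.apply_symm_apply
  refine ⟨⟨e.symm.toAddMonoidHom, e'.symm.toAddMonoidHom, fun x => hf'.1 ?_, fun x => hf.1 ?_,
    fun g x => hf'.1 ?_⟩, e.symm.bijective, e'.symm.bijective⟩
  · exact (he' _).trans (((congrArg N.res (he x)).symm).trans (f.map_res _).symm)
  · exact (he _).trans (((congrArg N.tr (he' x)).symm).trans (f.map_tr _).symm)
  · exact (he' _).trans ((congrArg (g • ·) (he' x).symm).trans (f.map_smul g _).symm)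

theorem IsIsomorphic.sum {M N M' N' : MackeyFunctor p} (h : M.IsIsomorphic M')
    (h' : N.IsIsomorphic N') : (M.sum N).IsIsomorphic (M'.sum N') := by
  obtain ⟨f, hf, hf'⟩ := h
  obtain ⟨g, hg, hg'⟩ := h'
  exact ⟨⟨f.top.prodMap g.top, f.bot.prodMap g.bot,
    fun x => Prod.ext (f.map_res _) (g.map_res _), fun x => Prod.ext (f.map_tr _) (g.map_tr _),
    fun a x => Prod.ext (f.map_smul _ _) (g.map_smul _ _)⟩, hf.prodMap hg, hf'.prodMap hg'⟩

/-- The whole Mackey functor as a subfunctor. -/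
def Sub.whole (M : MackeyFunctor p) : Sub M where
  top := ⊤
  bot := ⊤
  res_mem := fun _ _ => trivial
  tr_mem := fun _ _ => trivial
  smul_mem := fun _ _ _ => trivial

/-- The image of a morphism of Mackey functors. -/
def Hom.range {M N : MackeyFunctor p} (f : Hom M N) : Sub N where
  top := f.top.range
  bot := f.bot.range
  res_mem := by rintro _ ⟨x, rfl⟩; exact ⟨M.res x, f.map_res x⟩
  tr_mem := by rintro _ ⟨x, rfl⟩; exact ⟨M.tr x, f.map_tr x⟩
  smul_mem := by rintro g _ ⟨x, rfl⟩; exact ⟨g • x, f.map_smul g x⟩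

/-- The intersection of `B` with `Z`, as a subfunctor of `Z`. -/
def Sub.restrict {M : MackeyFunctor p} (B Z : Sub M) : Sub Z.toMackey where
  top := B.top.addSubgroupOf Z.top
  bot := B.bot.addSubgroupOf Z.bot
  res_mem := fun x hx => B.res_mem x.1 hx
  tr_mem := fun x hx => B.tr_mem x.1 hx
  smul_mem := fun g x hx => B.smul_mem g x.1 hx

/-- The subquotient `Z / (B ∩ Z)`. -/
def subquot {M : MackeyFunctor p} (Z B : Sub M) : MackeyFunctor p :=
  Z.toMackey.quot (B.restrict Z)

/-- The projection `Z ⟶ Z / (B ∩ Z)`. -/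
def subquotMk {M : MackeyFunctor p} (Z B : Sub M) : Hom Z.toMackey (subquot Z B) where
  top := QuotientAddGroup.mk' _
  bot := QuotientAddGroup.mk' _
  map_res := fun _ => rfl
  map_tr := fun _ => rfl
  map_smul := fun _ _ => rfl

theorem subquotMk_top_surjective {M : MackeyFunctor p} (Z B : Sub M) :
    Function.Surjective (subquotMk Z B).top := QuotientAddGroup.mk'_surjective _

theorem subquotMk_bot_surjective {M : MackeyFunctor p} (Z B : Sub M) :
    Function.Surjective (subquotMk Z B).bot := QuotientAddGroup.mk'_surjective _

theorem subquotMk_top_eq_zero {M : MackeyFunctor p} {Z B : Sub M} (z : Z.top) :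
    (subquotMk Z B).top z = 0 ↔ z.1 ∈ B.top :=
  (QuotientAddGroup.eq_zero_iff (N := B.top.addSubgroupOf Z.top) z).trans
    AddSubgroup.mem_addSubgroupOf

theorem subquotMk_bot_eq_zero {M : MackeyFunctor p} {Z B : Sub M} (z : Z.bot) :
    (subquotMk Z B).bot z = 0 ↔ z.1 ∈ B.bot :=
  (QuotientAddGroup.eq_zero_iff (N := B.bot.addSubgroupOf Z.bot) z).trans
    AddSubgroup.mem_addSubgroupOf

/-- A morphism out of `Z` that vanishes on `B ∩ Z` factors through the subquotient. -/
def subquotLift {M N : MackeyFunctor p} {Z B : Sub M} (π : Hom Z.toMackey N)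
    (ht : ∀ z : Z.top, z.1 ∈ B.top → π.top z = 0) (hb : ∀ z : Z.bot, z.1 ∈ B.bot → π.bot z = 0) :
    Hom (subquot Z B) N where
  top := QuotientAddGroup.lift (B.top.addSubgroupOf Z.top) π.top
    fun z hz => ht z (AddSubgroup.mem_addSubgroupOf.1 hz)
  bot := QuotientAddGroup.lift (B.bot.addSubgroupOf Z.bot) π.bot
    fun z hz => hb z (AddSubgroup.mem_addSubgroupOf.1 hz)
  map_res := by rintro ⟨x⟩; exact π.map_res x
  map_tr := by rintro ⟨x⟩; exact π.map_tr x
  map_smul := by rintro g ⟨x⟩; exact π.map_smul g x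

/-- First isomorphism theorem at each level. It identifies a homology functor with an explicit one
from a description of the cycles and boundaries. -/
theorem subquot_isIsomorphic {M N : MackeyFunctor p} {Z B : Sub M} (π : Hom Z.toMackey N)
    (hst : Function.Surjective π.top) (hsb : Function.Surjective π.bot)
    (ht : ∀ z : Z.top, π.top z = 0 ↔ z.1 ∈ B.top) (hb : ∀ z : Z.bot, π.bot z = 0 ↔ z.1 ∈ B.bot) :
    (subquot Z B).IsIsomorphic N := by
  refine ⟨subquotLift π (fun z hz => (ht z).2 hz) fun z hz => (hb z).2 hz, ⟨?_, ?_⟩, ⟨?_, ?_⟩⟩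
  · refine (injective_iff_map_eq_zero _).2 fun a => ?_
    obtain ⟨z, rfl⟩ := subquotMk_top_surjective Z B a
    intro h
    exact (subquotMk_top_eq_zero z).2 ((ht z).1 h)
  · intro n
    obtain ⟨z, rfl⟩ := hst n
    exact ⟨(subquotMk Z B).top z, rfl⟩
  · refine (injective_iff_map_eq_zero _).2 fun a => ?_
    obtain ⟨z, rfl⟩ := subquotMk_bot_surjective Z B a
    intro h
    exact (subquotMk_bot_eq_zero z).2 ((hb z).1 h)
  · intro n
    obtain ⟨z, rfl⟩ := hsb n
    exact ⟨(subquotMk Z B).bot z, rfl⟩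

/-- The restriction of a morphism to subfunctors. -/
def Hom.restrict {M N : MackeyFunctor p} (f : Hom M N) (Z : Sub M) (W : Sub N)
    (ht : ∀ z ∈ Z.top, f.top z ∈ W.top) (hb : ∀ z ∈ Z.bot, f.bot z ∈ W.bot) :
    Hom Z.toMackey W.toMackey where
  top := (f.top.comp Z.top.subtype).codRestrict W.top fun z => ht z.1 z.2
  bot := (f.bot.comp Z.bot.subtype).codRestrict W.bot fun z => hb z.1 z.2
  map_res := fun x => Subtype.ext (f.map_res x.1)
  map_tr := fun x => Subtype.ext (f.map_tr x.1)
  map_smul := fun g x => Subtype.ext (f.map_smul g x.1)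

/-- The morphism of subquotients induced by a morphism. -/
def Hom.subquotMap {M N : MackeyFunctor p} (f : Hom M N) {Z B : Sub M} {Z' B' : Sub N}
    (ht : ∀ z ∈ Z.top, f.top z ∈ Z'.top) (hb : ∀ z ∈ Z.bot, f.bot z ∈ Z'.bot)
    (ht' : ∀ z ∈ B.top, f.top z ∈ B'.top) (hb' : ∀ z ∈ B.bot, f.bot z ∈ B'.bot) :
    Hom (subquot Z B) (subquot Z' B') :=
  subquotLift ((subquotMk Z' B').comp (f.restrict Z Z' ht hb))
    (fun z hz => (subquotMk_top_eq_zero _).2 (ht' z.1 hz))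
    fun z hz => (subquotMk_bot_eq_zero _).2 (hb' z.1 hz)

/-- Surjectivity is only required on cycles up to boundaries, so the criterion covers chain homotopy
equivalences as well as the surjection `toBox`. -/
theorem Hom.subquot_isIsomorphic {M N : MackeyFunctor p} (f : Hom M N) {Z B : Sub M}
    {Z' B' : Sub N}
    (ht : ∀ z ∈ Z.top, f.top z ∈ Z'.top) (hb : ∀ z ∈ Z.bot, f.bot z ∈ Z'.bot)
    (hst : ∀ w ∈ Z'.top, ∃ z ∈ Z.top, f.top z - w ∈ B'.top)
    (hsb : ∀ w ∈ Z'.bot, ∃ z ∈ Z.bot, f.bot z - w ∈ B'.bot)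
    (ht' : ∀ z ∈ Z.top, f.top z ∈ B'.top ↔ z ∈ B.top)
    (hb' : ∀ z ∈ Z.bot, f.bot z ∈ B'.bot ↔ z ∈ B.bot) :
    (subquot Z B).IsIsomorphic (subquot Z' B') := by
  refine MackeyFunctor.subquot_isIsomorphic ((subquotMk Z' B').comp (f.restrict Z Z' ht hb))
    ?_ ?_ ?_ ?_
  · intro a
    obtain ⟨w, rfl⟩ := subquotMk_top_surjective Z' B' a
    obtain ⟨z, hz, h⟩ := hst w.1 w.2
    refine ⟨⟨z, hz⟩, sub_eq_zero.1 ?_⟩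
    exact (map_sub (subquotMk Z' B').top _ _).symm.trans ((subquotMk_top_eq_zero _).2 h)
  · intro a
    obtain ⟨w, rfl⟩ := subquotMk_bot_surjective Z' B' a
    obtain ⟨z, hz, h⟩ := hsb w.1 w.2
    refine ⟨⟨z, hz⟩, sub_eq_zero.1 ?_⟩
    exact (map_sub (subquotMk Z' B').bot _ _).symm.trans ((subquotMk_bot_eq_zero _).2 h)
  · exact fun z => (subquotMk_top_eq_zero _).trans (ht' z.1 z.2)
  · exact fun z => (subquotMk_bot_eq_zero _).trans (hb' z.1 z.2)

/-! ### Elementary abelian Mackey functors concentrated at the fixed level -/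

/-- `M` vanishes at the free level, and its fixed level is elementary abelian of order `p ^ k`. -/
structure IsElementary (M : MackeyFunctor p) (k : ℕ) : Prop where
  bot_eq_zero : ∀ y : M.bot, y = 0
  smul_eq_zero : ∀ x : M.top, p • x = 0
  card_top : Nat.card M.top = p ^ k

theorem IsElementary.of_isIsomorphic {M N : MackeyFunctor p} {k : ℕ} (h : M.IsElementary k)
    (e : M.IsIsomorphic N) : N.IsElementary k := by
  obtain ⟨f, hf, hf'⟩ := e
  refine ⟨fun y => ?_, fun x => ?_, ?_⟩
  · obtain ⟨y, rfl⟩ := hf'.2 y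
    rw [h.bot_eq_zero y, map_zero]
  · obtain ⟨x, rfl⟩ := hf.2 x
    rw [← map_nsmul, h.smul_eq_zero, map_zero]
  · rw [← h.card_top, Nat.card_eq_of_bijective _ hf]

theorem IsElementary.sum {M N : MackeyFunctor p} {k l : ℕ} (hM : M.IsElementary k)
    (hN : N.IsElementary l) : (M.sum N).IsElementary (k + l) where
  bot_eq_zero := fun y => Prod.ext (hM.bot_eq_zero _) (hN.bot_eq_zero _)
  smul_eq_zero := fun x => Prod.ext (hM.smul_eq_zero _) (hN.smul_eq_zero _)
  card_top := by
    rw [pow_add, ← hM.card_top, ← hN.card_top]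
    exact Nat.card_prod _ _

/-- With zero free level there is no restriction, transfer or action to respect, so any group
isomorphism of the fixed levels will do. -/
theorem IsElementary.isIsomorphic {M N : MackeyFunctor p} {k : ℕ} (hM : M.IsElementary k)
    (hN : N.IsElementary k) : M.IsIsomorphic N := by
  obtain ⟨e⟩ := exists_addEquiv_of_card_eq_pow hM.smul_eq_zero hN.smul_eq_zero hM.card_top
    hN.card_top
  refine ⟨⟨e.toAddMonoidHom, 0, fun x => ?_, fun y => ?_, fun g y => ?_⟩,
    e.bijective, ⟨fun a b _ => ?_, fun b => ⟨0, ?_⟩⟩⟩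
  · exact (hN.bot_eq_zero _).symm
  · rw [hM.bot_eq_zero y, map_zero, map_zero]; exact (map_zero N.tr).symm
  · simp
  · rw [hM.bot_eq_zero a, hM.bot_eq_zero b]
  · rw [hN.bot_eq_zero b, map_zero]

theorem isElementary_zero : (zero p).IsElementary 0 where
  bot_eq_zero := fun _ => rfl
  smul_eq_zero := fun _ => rfl
  card_top := by
    rw [pow_zero]
    exact Nat.card_unique (α := PUnit)

theorem isElementary_g : (g p).IsElementary 1 where
  bot_eq_zero := fun _ => rfl
  smul_eq_zero := fun x => by
    have h : ∀ a : ZMod p, p • a = 0 := fun a => by simp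
    exact h x
  card_top := by
    rw [pow_one]
    exact Nat.card_zmod p

/-! ### Finite generation and rank -/

theorem Generates.of_forall {M : MackeyFunctor p} {s : Set M.top} {t : Set M.bot}
    (h : ∀ S : Sub M, s ⊆ S.top → t ⊆ S.bot → S.top = ⊤ ∧ S.bot = ⊤) : M.Generates s t := by
  constructor
  · exact iInf_eq_top.2 fun S => (h S.1 S.2.1 S.2.2).1
  · exact iInf_eq_top.2 fun S => (h S.1 S.2.1 S.2.2).2

theorem Generates.eq_top {M : MackeyFunctor p} {s : Set M.top} {t : Set M.bot}
    (h : M.Generates s t) (S : Sub M) (hs : s ⊆ S.top) (ht : t ⊆ S.bot) :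
    S.top = ⊤ ∧ S.bot = ⊤ :=
  ⟨iInf_eq_top.1 h.1 ⟨S, hs, ht⟩, iInf_eq_top.1 h.2 ⟨S, hs, ht⟩⟩

/-- `M` is generated by finitely many elements. -/
def IsFinitelyGenerated (M : MackeyFunctor p) : Prop :=
  ∃ (s : Set M.top) (t : Set M.bot), s.Finite ∧ t.Finite ∧ M.Generates s t

theorem IsFinitelyGenerated.rank_ne_top {M : MackeyFunctor p} (h : M.IsFinitelyGenerated) :
    M.rank ≠ ⊤ := by
  obtain ⟨s, t, hs, ht, h⟩ := h
  refine ne_top_of_le_ne_top ?_ (sInf_le ⟨s, t, h, rfl⟩)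
  simp [hs, ht]

/-- The preimage of a subfunctor. -/
def Sub.comap {M N : MackeyFunctor p} (f : Hom M N) (S : Sub N) : Sub M where
  top := S.top.comap f.top
  bot := S.bot.comap f.bot
  res_mem := fun x hx => by
    rw [AddSubgroup.mem_comap, f.map_res]; exact S.res_mem _ hx
  tr_mem := fun x hx => by
    rw [AddSubgroup.mem_comap, f.map_tr]; exact S.tr_mem _ hx
  smul_mem := fun g x hx => by
    rw [AddSubgroup.mem_comap, f.map_smul]; exact S.smul_mem _ _ hx

theorem IsFinitelyGenerated.of_surjective {M N : MackeyFunctor p} (h : M.IsFinitelyGenerated)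
    (f : Hom M N) (ht : Function.Surjective f.top) (hb : Function.Surjective f.bot) :
    N.IsFinitelyGenerated := by
  obtain ⟨s, t, hs, ht', h⟩ := h
  refine ⟨f.top '' s, f.bot '' t, hs.image _, ht'.image _, Generates.of_forall fun S h1 h2 => ?_⟩
  obtain ⟨h3, h4⟩ := h.eq_top (Sub.comap f S) (fun x hx => h1 ⟨x, hx, rfl⟩)
    fun x hx => h2 ⟨x, hx, rfl⟩
  constructor
  · refine (AddSubgroup.eq_top_iff' _).2 fun n => ?_
    obtain ⟨m, rfl⟩ := ht n
    exact (AddSubgroup.eq_top_iff' _).1 h3 m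
  · refine (AddSubgroup.eq_top_iff' _).2 fun n => ?_
    obtain ⟨m, rfl⟩ := hb n
    exact (AddSubgroup.eq_top_iff' _).1 h4 m

theorem IsFinitelyGenerated.of_isIsomorphic {M N : MackeyFunctor p} (h : M.IsFinitelyGenerated)
    (e : M.IsIsomorphic N) : N.IsFinitelyGenerated := by
  obtain ⟨f, hf, hf'⟩ := e
  exact h.of_surjective f hf.2 hf'.2

/-- The inclusion of the first summand. -/
def inl (M N : MackeyFunctor p) : Hom M (M.sum N) where
  top := AddMonoidHom.inl _ _
  bot := AddMonoidHom.inl _ _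
  map_res := fun _ => Prod.ext rfl (map_zero N.res).symm
  map_tr := fun _ => Prod.ext rfl (map_zero N.tr).symm
  map_smul := fun g _ => Prod.ext rfl (smul_zero g).symm

/-- The inclusion of the second summand. -/
def inr (M N : MackeyFunctor p) : Hom N (M.sum N) where
  top := AddMonoidHom.inr _ _
  bot := AddMonoidHom.inr _ _
  map_res := fun _ => Prod.ext (map_zero M.res).symm rfl
  map_tr := fun _ => Prod.ext (map_zero M.tr).symm rfl
  map_smul := fun g _ => Prod.ext (smul_zero g).symm rfl

theorem IsFinitelyGenerated.sum {M N : MackeyFunctor p} (hM : M.IsFinitelyGenerated)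
    (hN : N.IsFinitelyGenerated) : (M.sum N).IsFinitelyGenerated := by
  obtain ⟨s, t, hs, ht, h⟩ := hM
  obtain ⟨s', t', hs', ht', h'⟩ := hN
  refine ⟨(inl M N).top '' s ∪ (inr M N).top '' s', (inl M N).bot '' t ∪ (inr M N).bot '' t',
    (hs.image _).union (hs'.image _), (ht.image _).union (ht'.image _),
    Generates.of_forall fun S h1 h2 => ?_⟩
  obtain ⟨h3, h4⟩ := h.eq_top (Sub.comap (inl M N) S) (fun x hx => h1 (Or.inl ⟨x, hx, rfl⟩))
    fun x hx => h2 (Or.inl ⟨x, hx, rfl⟩)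
  obtain ⟨h5, h6⟩ := h'.eq_top (Sub.comap (inr M N) S) (fun x hx => h1 (Or.inr ⟨x, hx, rfl⟩))
    fun x hx => h2 (Or.inr ⟨x, hx, rfl⟩)
  constructor
  · refine (AddSubgroup.eq_top_iff' _).2 fun n => ?_
    have := add_mem (show (inl M N).top n.1 ∈ S.top from (AddSubgroup.eq_top_iff' _).1 h3 n.1)
      (show (inr M N).top n.2 ∈ S.top from (AddSubgroup.eq_top_iff' _).1 h5 n.2)
    have e : (inl M N).top n.1 + (inr M N).top n.2 = n :=
      Prod.ext (add_zero n.1) (zero_add n.2)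
    rwa [e] at this
  · refine (AddSubgroup.eq_top_iff' _).2 fun n => ?_
    have := add_mem (show (inl M N).bot n.1 ∈ S.bot from (AddSubgroup.eq_top_iff' _).1 h4 n.1)
      (show (inr M N).bot n.2 ∈ S.bot from (AddSubgroup.eq_top_iff' _).1 h6 n.2)
    have e : (inl M N).bot n.1 + (inr M N).bot n.2 = n :=
      Prod.ext (add_zero n.1) (zero_add n.2)
    rwa [e] at this

theorem IsElementary.isFinitelyGenerated {M : MackeyFunctor p} {k : ℕ} (h : M.IsElementary k) :
    M.IsFinitelyGenerated := by
  have hp : 0 < p := (Fact.out : p.Prime).pos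
  have : Finite M.top := Nat.finite_of_card_ne_zero (by rw [h.card_top]; positivity)
  refine ⟨Set.univ, ∅, Set.finite_univ, Set.finite_empty, Generates.of_forall fun S h1 _ => ?_⟩
  refine ⟨(AddSubgroup.eq_top_iff' _).2 fun x => h1 trivial,
    (AddSubgroup.eq_top_iff' _).2 fun y => ?_⟩
  rw [h.bot_eq_zero y]
  exact zero_mem _

/-- Generators at the free level are zero and contribute nothing, so the ones at the fixed level
already generate an elementary abelian group of order p^k additively. -/
theorem IsElementary.le_rank {M : MackeyFunctor p} {k : ℕ} (h : M.IsElementary k) :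
    (k : ℕ∞) ≤ M.rank := by
  refine le_sInf ?_
  rintro _ ⟨s, t, hst, rfl⟩
  refine le_trans ?_ le_self_add
  -- The full free level makes this subfunctor contain `t`; it is closed under transfer because the
  -- free level is zero.
  let S : Sub M :=
    { top := AddSubgroup.closure s
      bot := ⊤
      res_mem := fun _ _ => trivial
      tr_mem := fun y _ => by rw [h.bot_eq_zero y, map_zero]; exact zero_mem _
      smul_mem := fun _ _ _ => trivial }
  have htop : AddSubgroup.closure s = ⊤ :=
    (hst.eq_top S AddSubgroup.subset_closure fun _ _ => trivial).1
  exact le_encard_of_closure_eq_top h.smul_eq_zero h.card_top htop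

end MackeyFunctor

/-! ### The category of modules over a Green functor -/

namespace GreenModule

variable {p : ℕ} [Fact p.Prime] {R : GreenFunctor p}

namespace Hom

variable {L M N P : GreenModule R}

/-- The underlying morphism of Mackey functors. -/
def toMackey (f : Hom M N) : MackeyFunctor.Hom M.toMackeyFunctor N.toMackeyFunctor where
  top := f.top.toAddMonoidHom
  bot := f.bot.toAddMonoidHom
  map_res := f.map_res
  map_tr := f.map_tr
  map_smul := f.map_act

/-- The identity morphism. -/
def id (M : GreenModule R) : Hom M M where
  top := LinearMap.id
  bot := LinearMap.id
  map_res := fun _ => rfl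
  map_tr := fun _ => rfl
  map_act := fun _ _ => rfl

/-- The composite of two morphisms. -/
def comp (g : Hom M N) (f : Hom L M) : Hom L N where
  top := g.top ∘ₗ f.top
  bot := g.bot ∘ₗ f.bot
  map_res := fun x => by simp [f.map_res, g.map_res]
  map_tr := fun x => by simp [f.map_tr, g.map_tr]
  map_act := fun a x => by simp [f.map_act, g.map_act]

/-- The zero morphism. -/
def zero (M N : GreenModule R) : Hom M N where
  top := 0
  bot := 0
  map_res := fun _ => by simp
  map_tr := fun _ => by simp
  map_act := fun _ _ => by simp

/-- The sum of two morphisms. -/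
def add (f g : Hom M N) : Hom M N where
  top := f.top + g.top
  bot := f.bot + g.bot
  map_res := fun _ => by simp [f.map_res, g.map_res]
  map_tr := fun _ => by simp [f.map_tr, g.map_tr]
  map_act := fun _ _ => by simp [f.map_act, g.map_act]

/-- The negative of a morphism. -/
def neg (f : Hom M N) : Hom M N where
  top := -f.top
  bot := -f.bot
  map_res := fun _ => by simp [f.map_res]
  map_tr := fun _ => by simp [f.map_tr]
  map_act := fun _ _ => by simp [f.map_act]

/-- The difference of two morphisms. -/
def sub (f g : Hom M N) : Hom M N where
  top := f.top - g.top
  bot := f.bot - g.bot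
  map_res := fun _ => by simp [f.map_res, g.map_res]
  map_tr := fun _ => by simp [f.map_tr, g.map_tr]
  map_act := fun _ _ => by simp [f.map_act, g.map_act, smul_sub]

end Hom

/-- Multiplication by an element of `R(C_p/C_p)`. -/
def homothety (M : GreenModule R) (a : R.top) : Hom M M where
  top := LinearMap.lsmul R.top M.top a
  bot := LinearMap.lsmul R.bot M.bot (R.res a)
  map_res := fun x => (M.res_smul a x).symm
  map_tr := fun y => (M.tr_res_smul a y).symm
  map_act := fun g y => by simp [M.act_smul, R.smul_res]

@[simp]
theorem homothety_top (M : GreenModule R) (a : R.top) (m : M.top) :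
    (M.homothety a).top m = a • m := rfl

@[simp]
theorem homothety_bot (M : GreenModule R) (a : R.top) (m : M.bot) :
    (M.homothety a).bot m = R.res a • m := rfl

/-- The direct sum of two modules. -/
def prod (M N : GreenModule R) : GreenModule R where
  toMackeyFunctor := M.toMackeyFunctor.sum N.toMackeyFunctor
  topModule := inferInstanceAs (Module R.top (M.top × N.top))
  botModule := inferInstanceAs (Module R.bot (M.bot × N.bot))
  res_smul := fun a m => Prod.ext (M.res_smul a m.1) (N.res_smul a m.2)
  act_smul := fun g b m => Prod.ext (M.act_smul g b m.1) (N.act_smul g b m.2)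
  tr_res_smul := fun a m => Prod.ext (M.tr_res_smul a m.1) (N.tr_res_smul a m.2)
  tr_smul_res := fun b m => Prod.ext (M.tr_smul_res b m.1) (N.tr_smul_res b m.2)

namespace Hom

variable {L M N P : GreenModule R}

/-- The first projection. -/
def fst (M N : GreenModule R) : Hom (M.prod N) M where
  top := LinearMap.fst R.top M.top N.top
  bot := LinearMap.fst R.bot M.bot N.bot
  map_res := fun _ => rfl
  map_tr := fun _ => rfl
  map_act := fun _ _ => rfl

/-- The second projection. -/
def snd (M N : GreenModule R) : Hom (M.prod N) N where
  top := LinearMap.snd R.top M.top N.top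
  bot := LinearMap.snd R.bot M.bot N.bot
  map_res := fun _ => rfl
  map_tr := fun _ => rfl
  map_act := fun _ _ => rfl

/-- The morphism to a direct sum with given components. -/
def prod (f : Hom L M) (g : Hom L N) : Hom L (M.prod N) where
  top := LinearMap.prod f.top g.top
  bot := LinearMap.prod f.bot g.bot
  map_res := fun x => Prod.ext (f.map_res x) (g.map_res x)
  map_tr := fun x => Prod.ext (f.map_tr x) (g.map_tr x)
  map_act := fun a x => Prod.ext (f.map_act a x) (g.map_act a x)

/-- The morphism out of a direct sum with given components. -/
def coprod (f : Hom M L) (g : Hom N L) : Hom (M.prod N) L :=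
  (f.comp (fst M N)).add (g.comp (snd M N))

end Hom

theorem IsProjective.prod {P Q : GreenModule R} (hP : P.IsProjective) (hQ : Q.IsProjective) :
    (P.prod Q).IsProjective := by
  intro M N q f hq
  let il : Hom P (P.prod Q) := (Hom.id P).prod (Hom.zero P Q)
  let ir : Hom Q (P.prod Q) := (Hom.zero Q P).prod (Hom.id Q)
  obtain ⟨h, hh, hh'⟩ := hP M N q (f.comp il) hq
  obtain ⟨k, hk, hk'⟩ := hQ M N q (f.comp ir) hq
  refine ⟨h.coprod k, fun x => ?_, fun x => ?_⟩
  · have e : il.top x.1 + ir.top x.2 = x := Prod.ext (add_zero x.1) (zero_add x.2)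
    exact (map_add q.top _ _).trans ((congrArg₂ (· + ·) (hh x.1) (hk x.2)).trans
      ((map_add f.top _ _).symm.trans (congrArg f.top e)))
  · have e : il.bot x.1 + ir.bot x.2 = x := Prod.ext (add_zero x.1) (zero_add x.2)
    exact (map_add q.bot _ _).trans ((congrArg₂ (· + ·) (hh' x.1) (hk' x.2)).trans
      ((map_add f.bot _ _).symm.trans (congrArg f.bot e)))

/-! ### Kernels and cokernels -/

/-- The kernel of a morphism of modules. -/
def ker {M N : GreenModule R} (f : Hom M N) : GreenModule R where
  top := LinearMap.ker f.top
  bot := LinearMap.ker f.bot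
  act :=
    { smul := fun g y => ⟨g • y.1, by
        rw [LinearMap.mem_ker, f.map_act, LinearMap.mem_ker.1 y.2, smul_zero]⟩
      one_smul := fun y => Subtype.ext (one_smul _ y.1)
      mul_smul := fun g h y => Subtype.ext (mul_smul g h y.1)
      smul_zero := fun g => Subtype.ext (smul_zero g)
      smul_add := fun g y z => Subtype.ext (smul_add g y.1 z.1) }
  res := AddMonoidHom.mk' (fun x => ⟨M.res x.1, by
    rw [LinearMap.mem_ker, f.map_res, LinearMap.mem_ker.1 x.2, map_zero]⟩)
    fun x y => Subtype.ext (map_add M.res x.1 y.1)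
  tr := AddMonoidHom.mk' (fun x => ⟨M.tr x.1, by
    rw [LinearMap.mem_ker, f.map_tr, LinearMap.mem_ker.1 x.2, map_zero]⟩)
    fun x y => Subtype.ext (map_add M.tr x.1 y.1)
  smul_res := fun g x => Subtype.ext (M.smul_res g x.1)
  tr_smul := fun g y => Subtype.ext (M.tr_smul g y.1)
  res_tr := fun y => Subtype.ext ((M.res_tr y.1).trans (by
    rw [AddSubmonoidClass.coe_finsetSum]; rfl))
  topModule := inferInstanceAs (Module R.top (LinearMap.ker f.top))
  botModule := inferInstanceAs (Module R.bot (LinearMap.ker f.bot))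
  res_smul := fun a m => Subtype.ext (M.res_smul a m.1)
  act_smul := fun g b m => Subtype.ext (M.act_smul g b m.1)
  tr_res_smul := fun a m => Subtype.ext (M.tr_res_smul a m.1)
  tr_smul_res := fun b m => Subtype.ext (M.tr_smul_res b m.1)

/-- The inclusion of the kernel. -/
def kerIncl {M N : GreenModule R} (f : Hom M N) : Hom (ker f) M where
  top := (LinearMap.ker f.top).subtype
  bot := (LinearMap.ker f.bot).subtype
  map_res := fun _ => rfl
  map_tr := fun _ => rfl
  map_act := fun _ _ => rfl

/-- The factorization through the kernel. -/
def kerLift {L M N : GreenModule R} (f : Hom M N) (k : Hom L M) (ht : ∀ x, f.top (k.top x) = 0)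
    (hb : ∀ x, f.bot (k.bot x) = 0) : Hom L (ker f) where
  top := k.top.codRestrict (LinearMap.ker f.top) ht
  bot := k.bot.codRestrict (LinearMap.ker f.bot) hb
  map_res := fun x => Subtype.ext (k.map_res x)
  map_tr := fun x => Subtype.ext (k.map_tr x)
  map_act := fun g x => Subtype.ext (k.map_act g x)

theorem kerIncl_exact {M N : GreenModule R} (f : Hom M N) : (kerIncl f).Exact f :=
  ⟨fun x => ⟨fun h => ⟨⟨x, h⟩, rfl⟩, by rintro ⟨y, rfl⟩; exact y.2⟩,
    fun x => ⟨fun h => ⟨⟨x, h⟩, rfl⟩, by rintro ⟨y, rfl⟩; exact y.2⟩⟩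

theorem kerLift_surjective {L M N : GreenModule R} {f : Hom M N} {k : Hom L M}
    (h : k.Exact f) : (kerLift f k (fun x => (h.1 _).2 ⟨x, rfl⟩)
      fun x => (h.2 _).2 ⟨x, rfl⟩).Surjective := by
  constructor
  · rintro ⟨y, hy⟩
    obtain ⟨x, rfl⟩ := (h.1 _).1 hy
    exact ⟨x, rfl⟩
  · rintro ⟨y, hy⟩
    obtain ⟨x, rfl⟩ := (h.2 _).1 hy
    exact ⟨x, rfl⟩

/-- A morphism from a projective module lifts along an exact sequence. -/
theorem IsProjective.exists_lift {P L M N : GreenModule R} (hP : P.IsProjective) {k : Hom L M}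
    {f : Hom M N} (h : k.Exact f) (a : Hom P M) (ht : ∀ x, f.top (a.top x) = 0)
    (hb : ∀ x, f.bot (a.bot x) = 0) :
    ∃ b : Hom P L, (∀ x, k.top (b.top x) = a.top x) ∧ ∀ x, k.bot (b.bot x) = a.bot x := by
  obtain ⟨b, h1, h2⟩ := hP _ _ _ (kerLift f a ht hb) (kerLift_surjective h)
  exact ⟨b, fun x => congrArg Subtype.val (h1 x), fun x => congrArg Subtype.val (h2 x)⟩

/-- The cokernel of a morphism of modules. -/
def coker {M N : GreenModule R} (f : Hom M N) : GreenModule R where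
  top := N.top ⧸ LinearMap.range f.top
  bot := N.bot ⧸ LinearMap.range f.bot
  act :=
    { smul := fun g => QuotientAddGroup.map (LinearMap.range f.bot).toAddSubgroup
        (LinearMap.range f.bot).toAddSubgroup (DistribSMul.toAddMonoidHom N.bot g) (by
          rintro _ ⟨y, rfl⟩; exact ⟨g • y, f.map_act g y⟩)
      one_smul := by
        rintro ⟨y⟩; exact congrArg (Submodule.Quotient.mk (p := LinearMap.range f.bot)) (one_smul _ y)
      mul_smul := by
        rintro g h ⟨y⟩
        exact congrArg (Submodule.Quotient.mk (p := LinearMap.range f.bot)) (mul_smul g h y)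
      smul_zero := fun g => congrArg (Submodule.Quotient.mk (p := LinearMap.range f.bot)) (smul_zero g)
      smul_add := by
        rintro g ⟨y⟩ ⟨z⟩
        exact congrArg (Submodule.Quotient.mk (p := LinearMap.range f.bot)) (smul_add g y z) }
  res := QuotientAddGroup.map (LinearMap.range f.top).toAddSubgroup
    (LinearMap.range f.bot).toAddSubgroup N.res (by
      rintro _ ⟨y, rfl⟩; exact ⟨M.res y, f.map_res y⟩)
  tr := QuotientAddGroup.map (LinearMap.range f.bot).toAddSubgroup
    (LinearMap.range f.top).toAddSubgroup N.tr (by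
      rintro _ ⟨y, rfl⟩; exact ⟨M.tr y, f.map_tr y⟩)
  smul_res := by
    rintro g ⟨x⟩
    exact congrArg (Submodule.Quotient.mk (p := LinearMap.range f.bot)) (N.smul_res g x)
  tr_smul := by
    rintro g ⟨x⟩
    exact congrArg (Submodule.Quotient.mk (p := LinearMap.range f.top)) (N.tr_smul g x)
  res_tr := by
    rintro ⟨y⟩
    refine (congrArg (LinearMap.range f.bot).mkQ (N.res_tr y)).trans ?_
    rw [map_sum]
    rfl
  topModule := inferInstanceAs (Module R.top (N.top ⧸ LinearMap.range f.top))
  botModule := inferInstanceAs (Module R.bot (N.bot ⧸ LinearMap.range f.bot))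
  res_smul := by
    rintro a ⟨m⟩
    exact congrArg (Submodule.Quotient.mk (p := LinearMap.range f.bot)) (N.res_smul a m)
  act_smul := by
    rintro g b ⟨m⟩
    exact congrArg (Submodule.Quotient.mk (p := LinearMap.range f.bot)) (N.act_smul g b m)
  tr_res_smul := by
    rintro a ⟨m⟩
    exact congrArg (Submodule.Quotient.mk (p := LinearMap.range f.top)) (N.tr_res_smul a m)
  tr_smul_res := by
    rintro b ⟨m⟩
    exact congrArg (Submodule.Quotient.mk (p := LinearMap.range f.top)) (N.tr_smul_res b m)

/-- The projection to the cokernel. -/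
def cokerMk {M N : GreenModule R} (f : Hom M N) : Hom N (coker f) where
  top := (LinearMap.range f.top).mkQ
  bot := (LinearMap.range f.bot).mkQ
  map_res := fun _ => rfl
  map_tr := fun _ => rfl
  map_act := fun _ _ => rfl

/-- The factorization through the cokernel. -/
def cokerDesc {M N P : GreenModule R} (f : Hom M N) (k : Hom N P)
    (ht : ∀ x, k.top (f.top x) = 0) (hb : ∀ x, k.bot (f.bot x) = 0) : Hom (coker f) P where
  top := (LinearMap.range f.top).liftQ k.top (by rintro _ ⟨x, rfl⟩; exact ht x)
  bot := (LinearMap.range f.bot).liftQ k.bot (by rintro _ ⟨x, rfl⟩; exact hb x)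
  map_res := by rintro ⟨x⟩; exact k.map_res x
  map_tr := by rintro ⟨x⟩; exact k.map_tr x
  map_act := by rintro g ⟨x⟩; exact k.map_act g x

theorem cokerMk_surjective {M N : GreenModule R} (f : Hom M N) : (cokerMk f).Surjective :=
  ⟨Submodule.mkQ_surjective _, Submodule.mkQ_surjective _⟩

theorem cokerMk_exact {M N : GreenModule R} (f : Hom M N) : f.Exact (cokerMk f) :=
  ⟨fun _ => Submodule.Quotient.mk_eq_zero (LinearMap.range f.top),
    fun _ => Submodule.Quotient.mk_eq_zero (LinearMap.range f.bot)⟩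

/-! ### Projective modules -/

variable (R) in
/-- A Green functor as a module over itself. -/
def self : GreenModule R where
  toMackeyFunctor := R.toMackey
  topModule := inferInstanceAs (Module R.top R.top)
  botModule := inferInstanceAs (Module R.bot R.bot)
  res_smul := fun a m => map_mul R.res a m
  act_smul := fun g b m => smul_mul' g b m
  tr_res_smul := R.tr_res_mul
  tr_smul_res := fun b (m : R.top) => by
    change R.tr (b * R.res m) = R.tr b * m
    rw [mul_comm, R.tr_res_mul, mul_comm]

/-- The morphism from the free module on a fixed generator with prescribed value. -/
def selfHom {M : GreenModule R} (m : M.top) : Hom (self R) M where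
  top := LinearMap.toSpanSingleton R.top M.top m
  bot := LinearMap.toSpanSingleton R.bot M.bot (M.res m)
  map_res := fun a => (M.res_smul a m).symm
  map_tr := fun b => (M.tr_smul_res b m).symm
  map_act := fun g (b : R.bot) => by
    change (g • b) • M.res m = g • (b • M.res m)
    rw [M.act_smul, M.smul_res]

/-- A morphism out of R is determined by the image of 1 at the fixed level, an arbitrary element of
the target, so lifting it amounts to lifting one element. -/
theorem self_isProjective : (self R).IsProjective := by
  intro M N q f hq
  obtain ⟨m, hm⟩ := hq.1 (f.top (1 : R.top))
  refine ⟨selfHom m, fun (a : R.top) => ?_, fun (b : R.bot) => ?_⟩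
  · change q.top (a • m) = _
    rw [map_smul, hm]
    exact (map_smul f.top a _).symm.trans (congrArg f.top (mul_one a))
  · change q.bot (b • M.res m) = _
    have h' : f.bot (R.res (1 : R.top)) = N.res (f.top (1 : R.top)) := f.map_res _
    rw [map_smul, q.map_res, hm, ← h', map_one]
    exact (map_smul f.bot b _).symm.trans (congrArg f.bot (mul_one b))

/-- The direct sum of copies of `M` indexed by `α`. -/
noncomputable def copower (M : GreenModule R) (α : Type) : GreenModule R where
  top := α →₀ M.top
  bot := α →₀ M.bot
  res := Finsupp.mapRange.addMonoidHom M.res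
  tr := Finsupp.mapRange.addMonoidHom M.tr
  smul_res := fun g x => Finsupp.ext fun a => M.smul_res g (x a)
  tr_smul := fun g x => Finsupp.ext fun a => M.tr_smul g (x a)
  res_tr := fun y => Finsupp.ext fun a => by
    rw [Finsupp.finsetSum_apply]
    exact M.res_tr (y a)
  res_smul := fun r m => Finsupp.ext fun a => M.res_smul r (m a)
  act_smul := fun g b m => Finsupp.ext fun a => M.act_smul g b (m a)
  tr_res_smul := fun r m => Finsupp.ext fun a => M.tr_res_smul r (m a)
  tr_smul_res := fun b m => Finsupp.ext fun a => M.tr_smul_res b (m a)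

/-- The morphism out of a direct sum of copies of `M` with given components. -/
noncomputable def copowerDesc {M N : GreenModule R} {α : Type} (f : α → Hom M N) :
    Hom (M.copower α) N where
  top := Finsupp.lsum ℕ fun a => (f a).top
  bot := Finsupp.lsum ℕ fun a => (f a).bot
  map_res := DFunLike.congr_fun (Finsupp.addHom_ext
    (f := (Finsupp.lsum ℕ fun a => (f a).bot).toAddMonoidHom.comp
      (Finsupp.mapRange.addMonoidHom M.res))
    (g := N.res.comp (Finsupp.lsum ℕ fun a => (f a).top).toAddMonoidHom)
    fun a m => by simp [(f a).map_res])
  map_tr := DFunLike.congr_fun (Finsupp.addHom_ext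
    (f := (Finsupp.lsum ℕ fun a => (f a).top).toAddMonoidHom.comp
      (Finsupp.mapRange.addMonoidHom M.tr))
    (g := N.tr.comp (Finsupp.lsum ℕ fun a => (f a).bot).toAddMonoidHom)
    fun a m => by simp [(f a).map_tr])
  map_act := fun g => DFunLike.congr_fun (Finsupp.addHom_ext
    (f := (Finsupp.lsum ℕ fun a => (f a).bot).toAddMonoidHom.comp
      (DistribSMul.toAddMonoidHom (α →₀ M.bot) g))
    (g := (DistribSMul.toAddMonoidHom N.bot g).comp
      (Finsupp.lsum ℕ fun a => (f a).bot).toAddMonoidHom)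
    fun a m => by simp [(f a).map_act])

theorem copowerDesc_top_single {M N : GreenModule R} {α : Type} (f : α → Hom M N) (a : α)
    (m : M.top) : (copowerDesc f).top (Finsupp.single a m : α →₀ M.top) = (f a).top m := by
  change (Finsupp.lsum ℕ fun a => (f a).top) (Finsupp.single a m) = _
  simp

theorem copowerDesc_bot_single {M N : GreenModule R} {α : Type} (f : α → Hom M N) (a : α)
    (m : M.bot) : (copowerDesc f).bot (Finsupp.single a m : α →₀ M.bot) = (f a).bot m := by
  change (Finsupp.lsum ℕ fun a => (f a).bot) (Finsupp.single a m) = _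
  simp

/-- The inclusion of a summand into a direct sum of copies of `M`. -/
noncomputable def copowerIncl (M : GreenModule R) {α : Type} (a : α) : Hom M (M.copower α) where
  top := Finsupp.lsingle a
  bot := Finsupp.lsingle a
  map_res := fun _ => (Finsupp.mapRange_single (hf := map_zero M.res)).symm
  map_tr := fun _ => (Finsupp.mapRange_single (hf := map_zero M.tr)).symm
  map_act := fun g x => (Finsupp.smul_single g a x).symm

theorem IsProjective.copower {P : GreenModule R} (hP : P.IsProjective) (α : Type) :
    (P.copower α).IsProjective := by
  intro M N q f hq
  choose h h1 h2 using fun a => hP M N q (f.comp (P.copowerIncl a)) hq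
  refine ⟨copowerDesc h, DFunLike.congr_fun (Finsupp.addHom_ext
    (f := (q.top ∘ₗ (Finsupp.lsum ℕ fun a => (h a).top)).toAddMonoidHom)
    (g := f.top.toAddMonoidHom) fun a m => ?_), DFunLike.congr_fun (Finsupp.addHom_ext
    (f := (q.bot ∘ₗ (Finsupp.lsum ℕ fun a => (h a).bot)).toAddMonoidHom)
    (g := f.bot.toAddMonoidHom) fun a m => ?_)⟩
  · exact (congrArg q.top (copowerDesc_top_single h a m)).trans (h1 a m)
  · exact (congrArg q.bot (copowerDesc_bot_single h a m)).trans (h2 a m)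

end GreenModule

/-- A Green functor whose free level carries the trivial action. -/
class GreenFunctor.IsTrivialAction {p : ℕ} [Fact p.Prime] (R : GreenFunctor p) : Prop where
  smul_eq : ∀ (g : Cp p) (b : R.bot), g • b = b

theorem GreenFunctor.res_tr_eq {p : ℕ} [Fact p.Prime] (R : GreenFunctor p) [R.IsTrivialAction]
    (b : R.bot) : R.res (R.tr b) = p * b := by
  rw [R.res_tr, Finset.sum_congr rfl fun g _ => IsTrivialAction.smul_eq g b]
  simp [Cp]

namespace GreenModule

variable {p : ℕ} [Fact p.Prime] (R : GreenFunctor p) [R.IsTrivialAction]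

open GreenFunctor.IsTrivialAction

/-- The free module on a generator at the free level. -/
def ind : GreenModule R where
  top := R.bot
  bot := Cp p → R.bot
  act :=
    { smul := fun g f k => f (g⁻¹ * k)
      one_smul := fun f => funext fun k => by
        change f (1⁻¹ * k) = f k
        simp
      mul_smul := fun g h f => funext fun k => by
        change f ((g * h)⁻¹ * k) = f (h⁻¹ * (g⁻¹ * k))
        simp [mul_assoc]
      smul_zero := fun g => rfl
      smul_add := fun g f f' => rfl }
  res := AddMonoidHom.mk' (fun b _ => b) fun _ _ => rfl
  tr := AddMonoidHom.mk' (fun f => ∑ k, f k) fun f f' => Finset.sum_add_distrib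
  smul_res := fun g x => rfl
  tr_smul := fun g f => Equiv.sum_comp (Equiv.mulLeft g⁻¹) f
  res_tr := fun f => funext fun k => by
    rw [Finset.sum_apply]
    exact ((Equiv.inv (Cp p)).trans (Equiv.mulRight k)).sum_comp f |>.symm
  topModule := Module.compHom R.bot R.res
  botModule := inferInstanceAs (Module R.bot (Cp p → R.bot))
  res_smul := fun a m => rfl
  act_smul := fun g b f => funext fun k => by
    rw [smul_eq g b]; rfl
  tr_res_smul := fun a f => (Finset.mul_sum Finset.univ f (R.res a)).symm
  tr_smul_res := fun b c => by
    change ∑ k : Cp p, b * c = R.res (R.tr b) * c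
    rw [R.res_tr_eq]
    simp [Cp, mul_assoc]

variable {R}

/-- The morphism from the free module on a generator at the free level with prescribed value. -/
def indHom {M : GreenModule R} (m : M.bot) : Hom (ind R) M where
  top :=
    { toFun := fun (b : R.bot) => M.tr (b • m)
      map_add' := fun (b c : R.bot) => by
        change M.tr ((b + c) • m) = _
        rw [add_smul, map_add]
      map_smul' := fun a (b : R.bot) => by
        change M.tr ((R.res a * b) • m) = a • M.tr (b • m)
        rw [mul_smul, M.tr_res_smul] }
  bot :=
    { toFun := fun (f : Cp p → R.bot) => ∑ g, f g • (g • m)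
      map_add' := fun (f f' : Cp p → R.bot) => by
        rw [← Finset.sum_add_distrib]
        exact Finset.sum_congr rfl fun g _ => add_smul _ _ _
      map_smul' := fun b (f : Cp p → R.bot) => by
        rw [RingHom.id_apply, Finset.smul_sum]
        exact Finset.sum_congr rfl fun g _ => mul_smul _ _ _ }
  map_res := fun (b : R.bot) => by
    change ∑ g : Cp p, b • (g • m) = M.res (M.tr (b • m))
    rw [M.res_tr]
    exact Finset.sum_congr rfl fun g _ => by rw [M.act_smul, smul_eq]
  map_tr := fun (f : Cp p → R.bot) => by
    change M.tr ((∑ g, f g) • m) = M.tr (∑ g, f g • (g • m))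
    rw [Finset.sum_smul, map_sum, map_sum]
    refine Finset.sum_congr rfl fun g _ => ?_
    rw [← M.tr_smul g (f g • m), M.act_smul, smul_eq]
  map_act := fun k (f : Cp p → R.bot) => by
    change ∑ g : Cp p, f (k⁻¹ * g) • (g • m) = k • ∑ g, f g • (g • m)
    rw [Finset.smul_sum, ← Equiv.sum_comp (Equiv.mulLeft k)]
    refine Finset.sum_congr rfl fun g _ => ?_
    rw [M.act_smul, smul_eq, ← mul_smul]
    simp

/-- The generator of the free module on a generator at the free level. -/
def indGen : (ind R).bot := (Pi.single 1 1 : Cp p → R.bot)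

theorem ind_bot_eq_sum (f : Cp p → R.bot) :
    (f : (ind R).bot) = ∑ g : Cp p, f g • (g • (indGen : (ind R).bot)) := by
  refine funext fun k => ?_
  refine Eq.trans ?_ (Finset.sum_apply k Finset.univ
    (fun g => (f g • (g • (indGen : (ind R).bot)) : Cp p → R.bot))).symm
  have h : ∀ g : Cp p, (f g • (g • (indGen : (ind R).bot)) : Cp p → R.bot) k =
      if k = g then f g else 0 := by
    intro g
    change f g * (Pi.single 1 1 : Cp p → R.bot) (g⁻¹ * k) = _
    simp [Pi.single_apply, inv_mul_eq_one, eq_comm]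
  refine Eq.trans ?_ (Finset.sum_congr rfl fun g _ => (h g).symm)
  simp

/-- The translates of the delta function span the free level, and the fixed level consists of
transfers, so a morphism is determined by one free-level value. -/
theorem indHom_indGen {M : GreenModule R} (f : Hom (ind R) M) :
    (∀ x, (indHom (f.bot indGen)).top x = f.top x) ∧
      ∀ y, (indHom (f.bot indGen)).bot y = f.bot y := by
  have hb : ∀ y, (indHom (f.bot indGen)).bot y = f.bot y := fun y => by
    conv_rhs => rw [ind_bot_eq_sum y, map_sum]
    exact Finset.sum_congr rfl fun g _ => by rw [map_smul, f.map_act]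
  refine ⟨fun (x : R.bot) => ?_, hb⟩
  -- The transfer is summation, so every fixed-level element is the transfer of a function supported
  -- at one point.
  have hx : (ind R).tr (show (ind R).bot from (Pi.single 1 x : Cp p → R.bot)) = x := by
    change ∑ k, (Pi.single 1 x : Cp p → R.bot) k = x
    simp
  have key : ∀ y : (ind R).bot,
      (indHom (f.bot indGen)).top ((ind R).tr y) = f.top ((ind R).tr y) := fun y => by
    rw [Hom.map_tr, Hom.map_tr, hb]
  exact (congrArg _ hx).symm.trans ((key _).trans (congrArg _ hx))

theorem ind_isProjective : (ind R).IsProjective := by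
  intro M N q f hq
  obtain ⟨m, hm⟩ := hq.2 (f.bot indGen)
  refine ⟨indHom m, fun (x : R.bot) => ?_, fun (y : Cp p → R.bot) => ?_⟩
  · rw [← (indHom_indGen f).1 x, ← hm]
    change q.top (M.tr (x • m)) = N.tr (x • q.bot m)
    rw [q.map_tr, map_smul]
  · rw [← (indHom_indGen f).2 y, ← hm]
    change q.bot (∑ g, y g • (g • m)) = ∑ g, y g • (g • q.bot m)
    rw [map_sum]
    exact Finset.sum_congr rfl fun g _ => by rw [map_smul, q.map_act]


/-! ### Enough projectives -/

/-- A projective module with a surjection onto `M`. -/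
noncomputable def cover (M : GreenModule R) : GreenModule R :=
  ((self R).copower M.top).prod ((ind R).copower M.bot)

theorem cover_isProjective (M : GreenModule R) : M.cover.IsProjective :=
  (self_isProjective.copower _).prod (ind_isProjective.copower _)

/-- The surjection from the projective cover. -/
noncomputable def coverMap (M : GreenModule R) : Hom M.cover M :=
  (copowerDesc fun m : M.top => selfHom m).coprod (copowerDesc fun m : M.bot => indHom m)

theorem coverMap_surjective (M : GreenModule R) : M.coverMap.Surjective := by
  constructor
  · intro m
    refine ⟨((Finsupp.single m (1 : R.top) : M.top →₀ R.top), (0 : ((ind R).copower M.bot).top)), ?_⟩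
    refine (congrArg₂ (· + ·) (copowerDesc_top_single (fun m : M.top => selfHom m) m (1 : R.top))
      (map_zero (copowerDesc fun m : M.bot => indHom m).top)).trans ?_
    exact (add_zero _).trans (one_smul R.top m)
  · intro m
    refine ⟨((0 : ((self R).copower M.top).bot), (Finsupp.single m indGen : M.bot →₀ (ind R).bot)), ?_⟩
    refine (congrArg₂ (· + ·) (map_zero (copowerDesc fun m : M.top => selfHom m).bot)
      (copowerDesc_bot_single (fun m : M.bot => indHom m) m indGen)).trans ?_
    refine (zero_add _).trans ?_
    change ∑ g : Cp p, (Pi.single 1 1 : Cp p → R.bot) g • (g • m) = m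
    rw [Finset.sum_eq_single 1]
    · simp
    · intro g _ hg
      simp [hg]
    · simp

/-- The iterated kernels of projective covers. -/
noncomputable def syzygy (M : GreenModule R) : ℕ → GreenModule R
  | 0 => M
  | n + 1 => ker (syzygy M n).coverMap

/-- Every module has a projective resolution. -/
noncomputable def ProjectiveResolution.standard (M : GreenModule R) : ProjectiveResolution M where
  X := fun n => (M.syzygy n).cover
  d := fun n => (kerIncl (M.syzygy n).coverMap).comp (M.syzygy (n + 1)).coverMap
  aug := M.coverMap
  projective := fun n => cover_isProjective _
  aug_surjective := M.coverMap_surjective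
  exact_zero := by
    obtain ⟨h1, h2⟩ := kerIncl_exact M.coverMap
    obtain ⟨h3, h4⟩ := coverMap_surjective (M.syzygy 1)
    refine ⟨fun x => (h1 x).trans ⟨?_, ?_⟩, fun x => (h2 x).trans ⟨?_, ?_⟩⟩
    · rintro ⟨y, rfl⟩; obtain ⟨z, rfl⟩ := h3 y; exact ⟨z, rfl⟩
    · rintro ⟨z, rfl⟩; exact ⟨_, rfl⟩
    · rintro ⟨y, rfl⟩; obtain ⟨z, rfl⟩ := h4 y; exact ⟨z, rfl⟩
    · rintro ⟨z, rfl⟩; exact ⟨_, rfl⟩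
  exact_succ := fun n => by
    obtain ⟨h1, h2⟩ := kerIncl_exact (M.syzygy (n + 1)).coverMap
    obtain ⟨h3, h4⟩ := coverMap_surjective (M.syzygy (n + 2))
    refine ⟨fun x => Iff.trans ?_ ((h1 x).trans ⟨?_, ?_⟩),
      fun x => Iff.trans ?_ ((h2 x).trans ⟨?_, ?_⟩)⟩
    · exact ⟨fun h => Subtype.ext h, fun h => congrArg Subtype.val h⟩
    · rintro ⟨y, rfl⟩; obtain ⟨z, rfl⟩ := h3 y; exact ⟨z, rfl⟩
    · rintro ⟨z, rfl⟩; exact ⟨_, rfl⟩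
    · exact ⟨fun h => Subtype.ext h, fun h => congrArg Subtype.val h⟩
    · rintro ⟨y, rfl⟩; obtain ⟨z, rfl⟩ := h4 y; exact ⟨z, rfl⟩
    · rintro ⟨z, rfl⟩; exact ⟨_, rfl⟩

end GreenModule

/-! ### Comparison of projective resolutions -/

namespace GreenModule

variable {p : ℕ} [Fact p.Prime] {R : GreenFunctor p}

namespace Hom

variable {K L M N : GreenModule R}

theorem sub_comp (f g : Hom M N) (k : Hom L M) : (f.sub g).comp k = (f.comp k).sub (g.comp k) :=
  rfl

theorem comp_sub (k : Hom M N) (f g : Hom L M) : k.comp (f.sub g) = (k.comp f).sub (k.comp g) :=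
  Hom.ext (LinearMap.comp_sub _ _ _) (LinearMap.comp_sub _ _ _)

theorem sub_self (f : Hom M N) : f.sub f = zero M N :=
  Hom.ext (_root_.sub_self _) (_root_.sub_self _)

theorem sub_zero (f : Hom M N) : f.sub (zero M N) = f :=
  Hom.ext (_root_.sub_zero _) (_root_.sub_zero _)

theorem comp_zero (f : Hom M N) : f.comp (zero L M) = zero L N :=
  Hom.ext (LinearMap.comp_zero _) (LinearMap.comp_zero _)

theorem Exact.comp_eq_zero {f : Hom L M} {g : Hom M N} (h : f.Exact g) : g.comp f = zero L N :=
  Hom.ext (LinearMap.ext fun x => (h.1 _).2 ⟨x, rfl⟩) (LinearMap.ext fun x => (h.2 _).2 ⟨x, rfl⟩)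

end Hom

theorem IsProjective.exists_comp_eq {P M N : GreenModule R} (hP : P.IsProjective) {q : Hom M N}
    (hq : q.Surjective) (f : Hom P N) : ∃ h : Hom P M, q.comp h = f := by
  obtain ⟨h, h1, h2⟩ := hP M N q f hq
  exact ⟨h, Hom.ext (LinearMap.ext h1) (LinearMap.ext h2)⟩

theorem IsProjective.exists_comp_eq_of_exact {P L M N : GreenModule R} (hP : P.IsProjective)
    {k : Hom L M} {f : Hom M N} (h : k.Exact f) (a : Hom P M) (ha : f.comp a = Hom.zero P N) :
    ∃ b : Hom P L, k.comp b = a := by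
  obtain ⟨b, h1, h2⟩ := hP.exists_lift h a (fun x => LinearMap.congr_fun (congrArg Hom.top ha) x)
    fun x => LinearMap.congr_fun (congrArg Hom.bot ha) x
  exact ⟨b, Hom.ext (LinearMap.ext h1) (LinearMap.ext h2)⟩

namespace ProjectiveResolution

variable {M : GreenModule R}

/-- The comparison theorem: each component is lifted through the exact sequence below it, over the
identity of M. -/
theorem exists_chainMap (P Q : ProjectiveResolution M) :
    ∃ f : ∀ n, Hom (P.X n) (Q.X n), Q.aug.comp (f 0) = P.aug ∧
      ∀ n, (Q.d n).comp (f (n + 1)) = (f n).comp (P.d n) := by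
  obtain ⟨f0, h0⟩ := (P.projective 0).exists_comp_eq Q.aug_surjective P.aug
  obtain ⟨f1, h1⟩ := (P.projective 1).exists_comp_eq_of_exact Q.exact_zero (f0.comp (P.d 0))
    ((congrArg (fun k => Hom.comp k (P.d 0)) h0).trans P.exact_zero.comp_eq_zero)
  -- The recursion carries two consecutive components with their commuting square, since this square
  -- shows that the next map to be lifted lands in the kernel.
  have step : ∀ n (q : {q : Hom (P.X n) (Q.X n) × Hom (P.X (n + 1)) (Q.X (n + 1)) //
      (Q.d n).comp q.2 = q.1.comp (P.d n)}),
      ∃ h, (Q.d (n + 1)).comp h = q.1.2.comp (P.d (n + 1)) := by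
    rintro n ⟨⟨f, g⟩, h⟩
    refine (P.projective (n + 2)).exists_comp_eq_of_exact (Q.exact_succ n) _ ?_
    exact (congrArg (fun k => Hom.comp k (P.d (n + 1))) h).trans
      ((congrArg f.comp (P.exact_succ n).comp_eq_zero).trans f.comp_zero)
  choose next hnext using step
  let F : ∀ n, {q : Hom (P.X n) (Q.X n) × Hom (P.X (n + 1)) (Q.X (n + 1)) //
      (Q.d n).comp q.2 = q.1.comp (P.d n)} :=
    Nat.rec ⟨(f0, f1), h1⟩ fun n q => ⟨(q.1.2, next n q), hnext n q⟩
  exact ⟨fun n => (F n).1.1, h0, fun n => (F n).2⟩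

/-- Only the null-homotopy of a chain map over zero is needed: it is applied to a round trip between
two resolutions minus the identity. -/
theorem exists_homotopy (P Q : ProjectiveResolution M) (f : ∀ n, Hom (P.X n) (Q.X n))
    (h0 : Q.aug.comp (f 0) = Hom.zero _ _)
    (hf : ∀ n, (Q.d n).comp (f (n + 1)) = (f n).comp (P.d n)) :
    ∃ h : ∀ n, Hom (P.X n) (Q.X (n + 1)), (Q.d 0).comp (h 0) = f 0 ∧
      ∀ n, (Q.d (n + 1)).comp (h (n + 1)) = (f (n + 1)).sub ((h n).comp (P.d n)) := by
  obtain ⟨k0, hk0⟩ := (P.projective 0).exists_comp_eq_of_exact Q.exact_zero (f 0) h0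
  -- The invariant d h d = f d is weaker than the homotopy identity but mentions a single component,
  -- and it is exactly what makes f - h d a cycle in the next degree.
  have step : ∀ n (h : {h : Hom (P.X n) (Q.X (n + 1)) //
      ((Q.d n).comp h).comp (P.d n) = (f n).comp (P.d n)}),
      ∃ h', (Q.d (n + 1)).comp h' = (f (n + 1)).sub (h.1.comp (P.d n)) := by
    rintro n ⟨h, hh⟩
    refine (P.projective (n + 1)).exists_comp_eq_of_exact (Q.exact_succ n) _ ?_
    rw [Hom.comp_sub, hf]
    exact (congrArg (Hom.sub _) hh).trans (Hom.sub_self _)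
  choose next hnext using step
  have hnext' : ∀ n h, ((Q.d (n + 1)).comp (next n h)).comp (P.d (n + 1)) =
      (f (n + 1)).comp (P.d (n + 1)) := fun n h => by
    rw [hnext, Hom.sub_comp]
    refine (congrArg (Hom.sub _) ?_).trans (Hom.sub_zero _)
    exact (congrArg h.1.comp (P.exact_succ n).comp_eq_zero).trans (Hom.comp_zero _)
  let F : ∀ n, {h : Hom (P.X n) (Q.X (n + 1)) //
      ((Q.d n).comp h).comp (P.d n) = (f n).comp (P.d n)} :=
    Nat.rec ⟨k0, by rw [hk0]⟩ fun n h => ⟨next n h, hnext' n h⟩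
  exact ⟨fun n => (F n).1, hk0, fun n => hnext n (F n)⟩

end ProjectiveResolution

/-! ### Homology modulo two elements -/

section Modulo

variable (x u : R.top)

/-- The subfunctor `(x, u) M` of a module `M`. -/
def idealSmul (M : GreenModule R) : MackeyFunctor.Sub M.toMackeyFunctor where
  top := ((M.homothety x).top.toAddMonoidHom.coprod (M.homothety u).top.toAddMonoidHom).range
  bot := ((M.homothety x).bot.toAddMonoidHom.coprod (M.homothety u).bot.toAddMonoidHom).range
  res_mem := by
    rintro _ ⟨⟨a, b⟩, rfl⟩
    refine ⟨(M.res a, M.res b), ?_⟩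
    simp [M.res_smul]
  tr_mem := by
    rintro _ ⟨⟨a, b⟩, rfl⟩
    refine ⟨(M.tr a, M.tr b), ?_⟩
    simp [M.tr_res_smul]
  smul_mem := by
    rintro g _ ⟨⟨a, b⟩, rfl⟩
    refine ⟨(g • a, g • b), ?_⟩
    simp [M.act_smul, R.smul_res]

variable {x u}

theorem mem_idealSmul_top {M : GreenModule R} {m : M.top} :
    m ∈ (idealSmul x u M).top ↔ ∃ a b : M.top, x • a + u • b = m :=
  ⟨fun ⟨z, h⟩ => ⟨z.1, z.2, h⟩, fun ⟨a, b, h⟩ => ⟨(a, b), h⟩⟩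

theorem mem_idealSmul_bot {M : GreenModule R} {m : M.bot} :
    m ∈ (idealSmul x u M).bot ↔ ∃ a b : M.bot, R.res x • a + R.res u • b = m :=
  ⟨fun ⟨z, h⟩ => ⟨z.1, z.2, h⟩, fun ⟨a, b, h⟩ => ⟨(a, b), h⟩⟩

theorem Hom.map_idealSmul_top {M N : GreenModule R} (f : Hom M N) {m : M.top}
    (hm : m ∈ (idealSmul x u M).top) : f.top m ∈ (idealSmul x u N).top := by
  obtain ⟨a, b, rfl⟩ := mem_idealSmul_top.1 hm
  exact mem_idealSmul_top.2 ⟨f.top a, f.top b, by simp⟩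

theorem Hom.map_idealSmul_bot {M N : GreenModule R} (f : Hom M N) {m : M.bot}
    (hm : m ∈ (idealSmul x u M).bot) : f.bot m ∈ (idealSmul x u N).bot := by
  obtain ⟨a, b, rfl⟩ := mem_idealSmul_bot.1 hm
  exact mem_idealSmul_bot.2 ⟨f.bot a, f.bot b, by simp⟩

variable (x u)

/-- The subfunctor `im f + (x, u) N`. -/
def rangeModulo {M N : GreenModule R} (f : Hom M N) : MackeyFunctor.Sub N.toMackeyFunctor where
  top := f.toMackey.range.top ⊔ (idealSmul x u N).top
  bot := f.toMackey.range.bot ⊔ (idealSmul x u N).bot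
  res_mem := fun n hn => by
    obtain ⟨a, ha, b, hb, rfl⟩ := AddSubgroup.mem_sup.1 hn
    rw [map_add]
    exact AddSubgroup.add_mem_sup (f.toMackey.range.res_mem a ha) ((idealSmul x u N).res_mem b hb)
  tr_mem := fun n hn => by
    obtain ⟨a, ha, b, hb, rfl⟩ := AddSubgroup.mem_sup.1 hn
    rw [map_add]
    exact AddSubgroup.add_mem_sup (f.toMackey.range.tr_mem a ha) ((idealSmul x u N).tr_mem b hb)
  smul_mem := fun g n hn => by
    obtain ⟨a, ha, b, hb, rfl⟩ := AddSubgroup.mem_sup.1 hn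
    rw [smul_add]
    exact AddSubgroup.add_mem_sup (f.toMackey.range.smul_mem g a ha)
      ((idealSmul x u N).smul_mem g b hb)

variable {x u}

theorem mem_rangeModulo_top {M N : GreenModule R} {f : Hom M N} {n : N.top} :
    n ∈ (rangeModulo x u f).top ↔ ∃ m, n - f.top m ∈ (idealSmul x u N).top := by
  refine AddSubgroup.mem_sup.trans ⟨?_, fun ⟨m, hm⟩ => ⟨_, ⟨m, rfl⟩, _, hm, ?_⟩⟩
  · rintro ⟨_, ⟨m, rfl⟩, b, hb, rfl⟩
    exact ⟨m, (add_sub_cancel_left (f.top m) b).symm ▸ hb⟩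
  · exact add_sub_cancel (f.top m) n

theorem mem_rangeModulo_bot {M N : GreenModule R} {f : Hom M N} {n : N.bot} :
    n ∈ (rangeModulo x u f).bot ↔ ∃ m, n - f.bot m ∈ (idealSmul x u N).bot := by
  refine AddSubgroup.mem_sup.trans ⟨?_, fun ⟨m, hm⟩ => ⟨_, ⟨m, rfl⟩, _, hm, ?_⟩⟩
  · rintro ⟨_, ⟨m, rfl⟩, b, hb, rfl⟩
    exact ⟨m, (add_sub_cancel_left (f.bot m) b).symm ▸ hb⟩
  · exact add_sub_cancel (f.bot m) n

theorem map_mem_rangeModulo_top {M N : GreenModule R} (f : Hom M N) (m : M.top) :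
    f.top m ∈ (rangeModulo x u f).top :=
  AddSubgroup.mem_sup_left ⟨m, rfl⟩

theorem map_mem_rangeModulo_bot {M N : GreenModule R} (f : Hom M N) (m : M.bot) :
    f.bot m ∈ (rangeModulo x u f).bot :=
  AddSubgroup.mem_sup_left ⟨m, rfl⟩

theorem idealSmul_le_rangeModulo_top {M N : GreenModule R} (f : Hom M N) {n : N.top}
    (hn : n ∈ (idealSmul x u N).top) : n ∈ (rangeModulo x u f).top :=
  AddSubgroup.mem_sup_right hn

theorem idealSmul_le_rangeModulo_bot {M N : GreenModule R} (f : Hom M N) {n : N.bot}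
    (hn : n ∈ (idealSmul x u N).bot) : n ∈ (rangeModulo x u f).bot :=
  AddSubgroup.mem_sup_right hn

variable (x u)

namespace ProjectiveResolution

variable {M : GreenModule R}

/-- The cycles of `P / (x, u) P`, as a subfunctor of `P`. -/
def cycles (P : ProjectiveResolution M) :
    ∀ n, MackeyFunctor.Sub (P.X n).toMackeyFunctor
  | 0 => MackeyFunctor.Sub.whole _
  | n + 1 => MackeyFunctor.Sub.comap (P.d n).toMackey (idealSmul x u (P.X n))

/-- The homology of `P / (x, u) P`. -/
def homologyModulo (P : ProjectiveResolution M) (n : ℕ) : MackeyFunctor p :=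
  MackeyFunctor.subquot (P.cycles x u n) (rangeModulo x u (P.d n))

variable {x u}

theorem map_mem_boundaries {P Q : ProjectiveResolution M} {f : ∀ n, Hom (P.X n) (Q.X n)}
    (hf : ∀ n, (Q.d n).comp (f (n + 1)) = (f n).comp (P.d n)) (n : ℕ) :
    (∀ z ∈ (rangeModulo x u (P.d n)).top, (f n).top z ∈ (rangeModulo x u (Q.d n)).top) ∧
      ∀ z ∈ (rangeModulo x u (P.d n)).bot, (f n).bot z ∈ (rangeModulo x u (Q.d n)).bot := by
  constructor
  · intro z hz
    obtain ⟨m, hm⟩ := mem_rangeModulo_top.1 hz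
    refine mem_rangeModulo_top.2 ⟨(f (n + 1)).top m, ?_⟩
    have h : (Q.d n).top ((f (n + 1)).top m) = (f n).top ((P.d n).top m) :=
      LinearMap.congr_fun (congrArg Hom.top (hf n)) m
    rw [h, ← map_sub]
    exact (f n).map_idealSmul_top hm
  · intro z hz
    obtain ⟨m, hm⟩ := mem_rangeModulo_bot.1 hz
    refine mem_rangeModulo_bot.2 ⟨(f (n + 1)).bot m, ?_⟩
    have h : (Q.d n).bot ((f (n + 1)).bot m) = (f n).bot ((P.d n).bot m) :=
      LinearMap.congr_fun (congrArg Hom.bot (hf n)) m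
    rw [h, ← map_sub]
    exact (f n).map_idealSmul_bot hm

theorem map_mem_cycles {P Q : ProjectiveResolution M} {f : ∀ n, Hom (P.X n) (Q.X n)}
    (hf : ∀ n, (Q.d n).comp (f (n + 1)) = (f n).comp (P.d n)) (n : ℕ) :
    (∀ z ∈ (P.cycles x u n).top, (f n).top z ∈ (Q.cycles x u n).top) ∧
      ∀ z ∈ (P.cycles x u n).bot, (f n).bot z ∈ (Q.cycles x u n).bot := by
  cases n with
  | zero => exact ⟨fun _ _ => trivial, fun _ _ => trivial⟩
  | succ n =>
    constructor
    · intro z hz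
      have h : (Q.d n).top ((f (n + 1)).top z) = (f n).top ((P.d n).top z) :=
        LinearMap.congr_fun (congrArg Hom.top (hf n)) z
      change (Q.d n).top ((f (n + 1)).top z) ∈ (idealSmul x u (Q.X n)).top
      rw [h]
      exact (f n).map_idealSmul_top hz
    · intro z hz
      have h : (Q.d n).bot ((f (n + 1)).bot z) = (f n).bot ((P.d n).bot z) :=
        LinearMap.congr_fun (congrArg Hom.bot (hf n)) z
      change (Q.d n).bot ((f (n + 1)).bot z) ∈ (idealSmul x u (Q.X n)).bot
      rw [h]
      exact (f n).map_idealSmul_bot hz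

/-- For a null-homotopy h one has f z = d(h z) + h(d z). On a cycle modulo (x, u) the last term
stays in the ideal multiple because h is linear. -/
theorem map_cycle_mem_boundaries {P Q : ProjectiveResolution M} {f : ∀ n, Hom (P.X n) (Q.X n)}
    (h0 : Q.aug.comp (f 0) = Hom.zero _ _)
    (hf : ∀ n, (Q.d n).comp (f (n + 1)) = (f n).comp (P.d n)) (n : ℕ) :
    (∀ z ∈ (P.cycles x u n).top, (f n).top z ∈ (rangeModulo x u (Q.d n)).top) ∧
      ∀ z ∈ (P.cycles x u n).bot, (f n).bot z ∈ (rangeModulo x u (Q.d n)).bot := by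
  obtain ⟨h, hh0, hh⟩ := exists_homotopy P Q f h0 hf
  cases n with
  | zero =>
    rw [← hh0]
    exact ⟨fun z _ => map_mem_rangeModulo_top (Q.d 0) ((h 0).top z),
      fun z _ => map_mem_rangeModulo_bot (Q.d 0) ((h 0).bot z)⟩
  | succ n =>
    constructor
    · intro z hz
      refine mem_rangeModulo_top.2 ⟨(h (n + 1)).top z, ?_⟩
      have e : (Q.d (n + 1)).top ((h (n + 1)).top z) =
          (f (n + 1)).top z - (h n).top ((P.d n).top z) :=
        LinearMap.congr_fun (congrArg Hom.top (hh n)) z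
      rw [e, sub_sub_cancel]
      exact (h n).map_idealSmul_top hz
    · intro z hz
      refine mem_rangeModulo_bot.2 ⟨(h (n + 1)).bot z, ?_⟩
      have e : (Q.d (n + 1)).bot ((h (n + 1)).bot z) =
          (f (n + 1)).bot z - (h n).bot ((P.d n).bot z) :=
        LinearMap.congr_fun (congrArg Hom.bot (hh n)) z
      rw [e, sub_sub_cancel]
      exact (h n).map_idealSmul_bot hz

theorem comp_sub_id_mem_boundaries {P Q : ProjectiveResolution M}
    {f : ∀ n, Hom (P.X n) (Q.X n)} {g : ∀ n, Hom (Q.X n) (P.X n)}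
    (hf0 : Q.aug.comp (f 0) = P.aug)
    (hf : ∀ n, (Q.d n).comp (f (n + 1)) = (f n).comp (P.d n))
    (hg0 : P.aug.comp (g 0) = Q.aug)
    (hg : ∀ n, (P.d n).comp (g (n + 1)) = (g n).comp (Q.d n)) (n : ℕ) :
    (∀ z ∈ (P.cycles x u n).top, (g n).top ((f n).top z) - z ∈ (rangeModulo x u (P.d n)).top) ∧
      ∀ z ∈ (P.cycles x u n).bot, (g n).bot ((f n).bot z) - z ∈ (rangeModulo x u (P.d n)).bot := by
  refine map_cycle_mem_boundaries (f := fun n => ((g n).comp (f n)).sub (Hom.id _)) ?_ ?_ n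
  · rw [Hom.comp_sub]
    refine (congrArg (fun k => Hom.sub k _) ?_).trans (Hom.sub_self _)
    exact (congrArg (fun k => Hom.comp k (f 0)) hg0).trans hf0
  · intro n
    rw [Hom.comp_sub, Hom.sub_comp]
    refine congrArg (fun k => Hom.sub k _) ?_
    exact (congrArg (fun k => Hom.comp k (f (n + 1))) (hg n)).trans (congrArg (g n).comp (hf n))

/-- The homology of `P / (x, u) P` does not depend on the projective resolution. -/
theorem homologyModulo_isIsomorphic (P Q : ProjectiveResolution M) (n : ℕ) :
    (P.homologyModulo x u n).IsIsomorphic (Q.homologyModulo x u n) := by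
  obtain ⟨f, hf0, hf⟩ := exists_chainMap P Q
  obtain ⟨g, hg0, hg⟩ := exists_chainMap Q P
  obtain ⟨fZ, fZ'⟩ := map_mem_cycles (x := x) (u := u) hf n
  obtain ⟨gZ, gZ'⟩ := map_mem_cycles (x := x) (u := u) hg n
  obtain ⟨fB, fB'⟩ := map_mem_boundaries (x := x) (u := u) hf n
  obtain ⟨gB, gB'⟩ := map_mem_boundaries (x := x) (u := u) hg n
  obtain ⟨c, c'⟩ := comp_sub_id_mem_boundaries (x := x) (u := u) hf0 hf hg0 hg n
  obtain ⟨e, e'⟩ := comp_sub_id_mem_boundaries (x := x) (u := u) hg0 hg hf0 hf n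
  refine (f n).toMackey.subquot_isIsomorphic fZ fZ' (fun w hw => ⟨_, gZ w hw, e w hw⟩)
    (fun w hw => ⟨_, gZ' w hw, e' w hw⟩) (fun z hz => ⟨fun h => ?_, fB z⟩)
    fun z hz => ⟨fun h => ?_, fB' z⟩
  -- Injectivity: z is gf z minus (gf z - z). The first term is a boundary if f z is, the second
  -- always.
  · exact sub_sub_cancel ((g n).top ((f n).top z)) z ▸ sub_mem (gB _ h) (c z hz)
  · exact sub_sub_cancel ((g n).bot ((f n).bot z)) z ▸ sub_mem (gB' _ h) (c' z hz)

end ProjectiveResolution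

end Modulo

/-! ### The box product with a cyclic module -/

/-- For a cyclic module N the tensor product is M modulo the annihilator of the generator n. Only
this map is needed, to detect when m ⊗ n vanishes; it sends m ⊗ an to the class of am, and the
hypothesis on `J` makes the choice of a immaterial. -/
theorem exists_tensor_quotient {A M N : Type} [CommRing A] [AddCommGroup M] [AddCommGroup N]
    [Module A M] [Module A N] (n : N) (hn : ∀ s : N, ∃ a : A, a • n = s) (J : AddSubgroup M)
    (hJ : ∀ a : A, a • n = 0 → ∀ m : M, a • m ∈ J) :
    ∃ κ : M ⊗[A] N →+ M ⧸ J, ∀ m, κ (m ⊗ₜ n) = QuotientAddGroup.mk m := by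
  choose σ hσ using hn
  have key : ∀ (a b : A) (m : M), a • n = b • n →
      (QuotientAddGroup.mk (a • m) : M ⧸ J) = QuotientAddGroup.mk (b • m) := fun a b m h => by
    refine QuotientAddGroup.eq_iff_sub_mem.2 ?_
    rw [← sub_smul]
    exact hJ _ (by rw [sub_smul, h, sub_self]) m
  let φ : M →+ N →+ M ⧸ J := AddMonoidHom.mk'
    (fun m => AddMonoidHom.mk' (fun s => QuotientAddGroup.mk (σ s • m)) fun s s' => by
      rw [key _ (σ s + σ s') m (by rw [hσ, add_smul, hσ, hσ]), add_smul]
      rfl)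
    fun m m' => by
      ext s
      simp only [AddMonoidHom.mk'_apply, smul_add]
      rfl
  refine ⟨TensorProduct.liftAddHom φ fun a m s => ?_, fun m => ?_⟩
  · simp only [φ, AddMonoidHom.mk'_apply]
    rw [← mul_smul]
    exact key _ _ m (by rw [hσ, mul_comm, mul_smul, hσ])
  · refine (key (σ n) 1 m (by rw [hσ, one_smul])).trans ?_
    rw [one_smul]

theorem exists_tmul_eq {A M N : Type} [CommRing A] [AddCommGroup M] [AddCommGroup N]
    [Module A M] [Module A N] (n : N) (hn : ∀ s : N, ∃ a : A, a • n = s) (z : M ⊗[A] N) :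
    ∃ m : M, m ⊗ₜ n = z := by
  induction z using TensorProduct.induction_on with
  | zero => exact ⟨0, TensorProduct.zero_tmul _ _⟩
  | add a b ha hb =>
    obtain ⟨a', rfl⟩ := ha
    obtain ⟨b', rfl⟩ := hb
    exact ⟨a' + b', TensorProduct.add_tmul _ _ _⟩
  | tmul m s =>
    obtain ⟨b, rfl⟩ := hn s
    exact ⟨b • m, TensorProduct.smul_tmul _ _ _⟩

section BoxCyclic

/-- The element `n` generates `N` levelwise, and its annihilator is the ideal `(x, u)`. -/
structure IsCyclicModulo (x u : R.top) {N : GreenModule R} (n : N.top) : Prop where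
  top_surjective : ∀ s : N.top, ∃ a : R.top, a • n = s
  bot_surjective : ∀ s : N.bot, ∃ b : R.bot, b • N.res n = s
  smul_fst : x • n = 0
  smul_snd : u • n = 0
  exists_top : ∀ a : R.top, a • n = 0 → ∃ c d, a = x * c + u * d
  exists_bot : ∀ b : R.bot, b • N.res n = 0 → ∃ c d, b = R.res x * c + R.res u * d

/-- The morphism `M ⟶ M ⊠_R N`, `m ↦ m ⊗ n`. -/
noncomputable def toBox (M : GreenModule R) {N : GreenModule R} (n : N.top) :
    MackeyFunctor.Hom M.toMackeyFunctor (M.box N) where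
  top := AddMonoidHom.mk' (fun m => QuotientAddGroup.mk (s := boxRel M N) (m ⊗ₜ n, 0))
    fun m m' => congrArg (QuotientAddGroup.mk (s := boxRel M N))
      (Prod.ext (TensorProduct.add_tmul _ _ _) (add_zero 0).symm)
  bot := AddMonoidHom.mk' (fun m => m ⊗ₜ N.res n) fun m m' => TensorProduct.add_tmul _ _ _
  map_res := fun m => by
    change M.res m ⊗ₜ[R.bot] N.res n = boxResTensor M N (m ⊗ₜ n) + boxSum M N 0
    rw [map_zero, add_zero, boxResTensor_tmul]
  map_tr := fun m => QuotientAddGroup.eq_iff_sub_mem.2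
    (AddSubgroup.subset_closure (Or.inl (Or.inr ⟨m, n, rfl⟩)))
  map_smul := fun g m => by
    change (g • m) ⊗ₜ[R.bot] N.res n = (g • m) ⊗ₜ[R.bot] (g • N.res n)
    rw [N.smul_res]

variable {x u : R.top} {N : GreenModule R} {n : N.top} (hn : IsCyclicModulo x u n)
  (M : GreenModule R)
include hn

theorem IsCyclicModulo.toBox_bot_surjective : Function.Surjective (toBox M n).bot :=
  exists_tmul_eq (N.res n) hn.bot_surjective

/-- The summand of formal transfers is reached because `toBox` commutes with transfers and is
surjective at the free level. -/
theorem IsCyclicModulo.toBox_top_surjective : Function.Surjective (toBox M n).top := by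
  rintro ⟨w, z⟩
  obtain ⟨z, rfl⟩ := hn.toBox_bot_surjective M z
  obtain ⟨m, rfl⟩ := exists_tmul_eq n hn.top_surjective w
  refine ⟨m + M.tr z, ?_⟩
  rw [map_add, (toBox M n).map_tr]
  exact congrArg (QuotientAddGroup.mk (s := boxRel M N)) (Prod.ext (add_zero _) (zero_add _))

theorem IsCyclicModulo.toBox_bot_eq_zero (m : M.bot) :
    (toBox M n).bot m = 0 ↔ m ∈ (idealSmul x u M).bot := by
  constructor
  · intro h
    obtain ⟨κ, hκ⟩ := exists_tensor_quotient (N.res n) hn.bot_surjective (idealSmul x u M).bot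
      fun b hb m => by
        obtain ⟨c, d, rfl⟩ := hn.exists_bot b hb
        exact mem_idealSmul_bot.2 ⟨c • m, d • m, by rw [add_smul, mul_smul, mul_smul]⟩
    refine (QuotientAddGroup.eq_zero_iff m).1 ((hκ m).symm.trans ?_)
    exact (congrArg κ h).trans (map_zero κ)
  · intro h
    obtain ⟨a, b, rfl⟩ := mem_idealSmul_bot.1 h
    change (R.res x • a + R.res u • b) ⊗ₜ[R.bot] N.res n = 0
    rw [TensorProduct.add_tmul, TensorProduct.smul_tmul, TensorProduct.smul_tmul, ← N.res_smul,
      ← N.res_smul, hn.smul_fst, hn.smul_snd, map_zero, TensorProduct.tmul_zero,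
      TensorProduct.tmul_zero, add_zero]

/-- For the forward direction, the fixed level of the box product is mapped back to M/(x, u)M:
tensors by the cyclic description, formal transfers by the transfer of M applied to the free-level
description. -/
theorem IsCyclicModulo.toBox_top_eq_zero (m : M.top) :
    (toBox M n).top m = 0 ↔ m ∈ (idealSmul x u M).top := by
  constructor
  · intro h
    obtain ⟨κb, hκb⟩ := exists_tensor_quotient (N.res n) hn.bot_surjective (idealSmul x u M).bot
      fun b hb m => by
        obtain ⟨c, d, rfl⟩ := hn.exists_bot b hb
        exact mem_idealSmul_bot.2 ⟨c • m, d • m, by rw [add_smul, mul_smul, mul_smul]⟩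
    obtain ⟨κt, hκt⟩ := exists_tensor_quotient n hn.top_surjective (idealSmul x u M).top
      fun b hb m => by
        obtain ⟨c, d, rfl⟩ := hn.exists_top b hb
        exact mem_idealSmul_top.2 ⟨c • m, d • m, by rw [add_smul, mul_smul, mul_smul]⟩
    let τ : M.bot ⧸ (idealSmul x u M).bot →+ M.top ⧸ (idealSmul x u M).top :=
      QuotientAddGroup.map _ _ M.tr (idealSmul x u M).tr_mem
    let κ : BoxPre M N →+ M.top ⧸ (idealSmul x u M).top := κt.coprod (τ.comp κb)
    have hτ : ∀ y : M.bot, τ (κb (y ⊗ₜ N.res n)) = QuotientAddGroup.mk (M.tr y) := fun y => by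
      rw [hκb]; rfl
    -- The three families of relations die by invariance of the transfer under C_p, by
    -- `tr_res_smul`, and by `tr_smul_res`, once every element of N is written as a multiple of the
    -- generator.
    have hle : boxRel M N ≤ κ.ker := by
      refine (AddSubgroup.closure_le _).2 ?_
      rintro z ((⟨g, w, rfl⟩ | ⟨b, s, rfl⟩) | ⟨m, c, rfl⟩)
      · obtain ⟨y, rfl⟩ := exists_tmul_eq (N.res n) hn.bot_surjective w
        rw [SetLike.mem_coe, AddMonoidHom.mem_ker, box_smul_tmul, N.smul_res, map_sub]
        simp only [κ, AddMonoidHom.coprod_apply, map_zero, AddMonoidHom.comp_apply, hτ, M.tr_smul,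
          sub_self]
      · obtain ⟨a, rfl⟩ := hn.top_surjective s
        rw [SetLike.mem_coe, AddMonoidHom.mem_ker, map_sub, N.res_smul, ← TensorProduct.smul_tmul,
          ← TensorProduct.smul_tmul]
        simp only [κ, AddMonoidHom.coprod_apply, map_zero, AddMonoidHom.comp_apply, hτ, hκt,
          M.tr_res_smul, zero_add, add_zero, sub_self]
      · obtain ⟨b, rfl⟩ := hn.bot_surjective c
        rw [SetLike.mem_coe, AddMonoidHom.mem_ker, map_sub, N.tr_smul_res,
          ← TensorProduct.smul_tmul, ← TensorProduct.smul_tmul]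
        simp only [κ, AddMonoidHom.coprod_apply, map_zero, AddMonoidHom.comp_apply, hτ, hκt,
          M.tr_smul_res, zero_add, add_zero, sub_self]
    have h0 : ((m ⊗ₜ n, 0) : BoxPre M N) ∈ κ.ker := hle ((QuotientAddGroup.eq_zero_iff _).1 h)
    rw [AddMonoidHom.mem_ker, AddMonoidHom.coprod_apply, map_zero, add_zero, hκt] at h0
    exact (QuotientAddGroup.eq_zero_iff m).1 h0
  · intro h
    obtain ⟨a, b, rfl⟩ := mem_idealSmul_top.1 h
    change QuotientAddGroup.mk (s := boxRel M N) ((x • a + u • b) ⊗ₜ[R.top] n, 0) = 0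
    rw [TensorProduct.add_tmul, TensorProduct.smul_tmul, TensorProduct.smul_tmul,
      hn.smul_fst, hn.smul_snd, TensorProduct.tmul_zero, TensorProduct.tmul_zero, add_zero]
    rfl

omit hn in
theorem box_top_toBox {M M' : GreenModule R} (f : Hom M M') (m : M.top) :
    (f.box N).top ((toBox M n).top m) = (toBox M' n).top (f.top m) := by
  refine congrArg (QuotientAddGroup.mk (s := boxRel M' N)) (Prod.ext ?_ ?_)
  · exact LinearMap.rTensor_tmul _ _ _ _
  · exact map_zero (f.bot.rTensor N.bot)

omit hn in
theorem box_bot_toBox {M M' : GreenModule R} (f : Hom M M') (m : M.bot) :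
    (f.box N).bot ((toBox M n).bot m) = (toBox M' n).bot (f.bot m) :=
  LinearMap.rTensor_tmul _ _ _ _

theorem IsCyclicModulo.toBox_mem_range_top {M M' : GreenModule R} (f : Hom M M') (z : M'.top) :
    (toBox M' n).top z ∈ (f.box N).range.top ↔ z ∈ (rangeModulo x u f).top := by
  rw [mem_rangeModulo_top]
  constructor
  · rintro ⟨w, hw⟩
    obtain ⟨m, rfl⟩ := hn.toBox_top_surjective M w
    refine ⟨m, (hn.toBox_top_eq_zero M' _).1 ?_⟩
    rw [map_sub, ← hw, ← box_top_toBox, sub_self]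
  · rintro ⟨m, hm⟩
    refine ⟨(toBox M n).top m, ?_⟩
    rw [box_top_toBox, eq_comm, ← sub_eq_zero, ← map_sub]
    exact (hn.toBox_top_eq_zero M' _).2 hm

theorem IsCyclicModulo.toBox_mem_range_bot {M M' : GreenModule R} (f : Hom M M') (z : M'.bot) :
    (toBox M' n).bot z ∈ (f.box N).range.bot ↔ z ∈ (rangeModulo x u f).bot := by
  rw [mem_rangeModulo_bot]
  constructor
  · rintro ⟨w, hw⟩
    obtain ⟨m, rfl⟩ := hn.toBox_bot_surjective M w
    refine ⟨m, (hn.toBox_bot_eq_zero M' _).1 ?_⟩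
    rw [map_sub, ← hw, ← box_bot_toBox, sub_self]
  · rintro ⟨m, hm⟩
    refine ⟨(toBox M n).bot m, ?_⟩
    rw [box_bot_toBox, eq_comm, ← sub_eq_zero, ← map_sub]
    exact (hn.toBox_bot_eq_zero M' _).2 hm

/-- The maps `toBox` form a surjective chain map with kernel (x, u)P, so the boxed complex is P/(x,
u)P. -/
theorem IsCyclicModulo.tor_isIsomorphic {M : GreenModule R} (P : ProjectiveResolution M) (i : ℕ) :
    (P.tor N i).IsIsomorphic (P.homologyModulo x u i) := by
  refine MackeyFunctor.IsIsomorphic.symm ?_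
  cases i with
  | zero =>
    refine (toBox (P.X 0) n).subquot_isIsomorphic (Z' := (MackeyFunctor.toZero _).ker)
      (B' := ((P.d 0).box N).range) (fun _ _ => rfl) (fun _ _ => rfl) ?_ ?_
      (fun z _ => hn.toBox_mem_range_top (P.d 0) z) fun z _ => hn.toBox_mem_range_bot (P.d 0) z
    · intro w _
      obtain ⟨z, rfl⟩ := hn.toBox_top_surjective _ w
      exact ⟨z, trivial, by rw [sub_self]; exact zero_mem _⟩
    · intro w _
      obtain ⟨z, rfl⟩ := hn.toBox_bot_surjective _ w
      exact ⟨z, trivial, by rw [sub_self]; exact zero_mem _⟩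
  | succ i =>
    have kt : ∀ z, (toBox (P.X (i + 1)) n).top z ∈ ((P.d i).box N).ker.top ↔
        z ∈ (P.cycles x u (i + 1)).top := fun z =>
      Iff.trans (by rw [← box_top_toBox]; rfl) (hn.toBox_top_eq_zero _ ((P.d i).top z))
    have kb : ∀ z, (toBox (P.X (i + 1)) n).bot z ∈ ((P.d i).box N).ker.bot ↔
        z ∈ (P.cycles x u (i + 1)).bot := fun z =>
      Iff.trans (by rw [← box_bot_toBox]; rfl) (hn.toBox_bot_eq_zero _ ((P.d i).bot z))
    refine (toBox (P.X (i + 1)) n).subquot_isIsomorphic (Z' := ((P.d i).box N).ker)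
      (B' := ((P.d (i + 1)).box N).range) (fun z => (kt z).2) (fun z => (kb z).2) ?_ ?_
      (fun z _ => hn.toBox_mem_range_top (P.d (i + 1)) z)
      fun z _ => hn.toBox_mem_range_bot (P.d (i + 1)) z
    · intro w hw
      obtain ⟨z, rfl⟩ := hn.toBox_top_surjective _ w
      exact ⟨z, (kt z).1 hw, by rw [sub_self]; exact zero_mem _⟩
    · intro w hw
      obtain ⟨z, rfl⟩ := hn.toBox_bot_surjective _ w
      exact ⟨z, (kb z).1 hw, by rw [sub_self]; exact zero_mem _⟩

end BoxCyclic

end GreenModule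

/-- The diagram chase for exactness of a cone, separated out since it serves both levels and every
positive degree. The sign belongs to the first component of the cone differential. -/
theorem exact_cone_aux {P₁ P₀ N Q₂ Q₁ Q₀ : Type} [AddCommGroup P₁] [AddCommGroup P₀]
    [AddCommGroup N] [AddCommGroup Q₂] [AddCommGroup Q₁] [AddCommGroup Q₀] {d : P₁ →+ P₀}
    {d' : P₀ →+ N} {e : Q₂ →+ Q₁} {e' : Q₁ →+ Q₀} {f₁ : P₁ →+ Q₁} {f₀ : P₀ →+ Q₀}
    (hd : ∀ c, d' c = 0 → ∃ b, d b = c) (he : ∀ c, e' c = 0 → ∃ b, e b = c)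
    (hf : ∀ c, e' (f₁ c) = f₀ (d c)) (c : P₀) (a : Q₁) (hc : d' c = 0) (ha : f₀ c + e' a = 0) :
    ∃ b b', -d b = c ∧ f₁ b + e b' = a := by
  obtain ⟨b, rfl⟩ := hd c hc
  obtain ⟨b', hb'⟩ := he (a + f₁ b) (by rw [map_add, hf, add_comm, ha])
  exact ⟨-b, b', by simp, by rw [hb']; simp⟩

namespace GreenModule

variable {p : ℕ} [Fact p.Prime] {R : GreenFunctor p}

namespace ProjectiveResolution

/-! ### Splicing -/

section Splice

variable {K P₀ M : GreenModule R} (Q : ProjectiveResolution K) (i : Hom K P₀)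

/-- The terms of the spliced resolution. -/
def spliceX (P₀ : GreenModule R) : ℕ → GreenModule R
  | 0 => P₀
  | n + 1 => Q.X n

/-- The differentials of the spliced resolution. -/
def spliceD : ∀ n, Hom (Q.spliceX P₀ (n + 1)) (Q.spliceX P₀ n)
  | 0 => i.comp Q.aug
  | n + 1 => Q.d n

/-- The resolution of `M` obtained from a resolution of `K` and a short exact sequence
`0 ⟶ K ⟶ P₀ ⟶ M ⟶ 0` with `P₀` projective. -/
def splice (hP : P₀.IsProjective) (hit : Function.Injective i.top)
    (hib : Function.Injective i.bot) (q : Hom P₀ M) (hq : q.Surjective) (h : i.Exact q) :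
    ProjectiveResolution M where
  X := Q.spliceX P₀
  d := Q.spliceD i
  aug := q
  projective := fun n => by
    cases n with
    | zero => exact hP
    | succ n => exact Q.projective n
  aug_surjective := hq
  exact_zero := by
    refine ⟨fun z => (h.1 z).trans ⟨?_, ?_⟩, fun z => (h.2 z).trans ⟨?_, ?_⟩⟩
    · rintro ⟨y, rfl⟩; obtain ⟨w, rfl⟩ := Q.aug_surjective.1 y; exact ⟨w, rfl⟩
    · rintro ⟨w, rfl⟩; exact ⟨_, rfl⟩
    · rintro ⟨y, rfl⟩; obtain ⟨w, rfl⟩ := Q.aug_surjective.2 y; exact ⟨w, rfl⟩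
    · rintro ⟨w, rfl⟩; exact ⟨_, rfl⟩
  exact_succ := fun n => by
    cases n with
    | zero =>
      exact ⟨fun z => (map_eq_zero_iff i.top hit).trans (Q.exact_zero.1 z),
        fun z => (map_eq_zero_iff i.bot hib).trans (Q.exact_zero.2 z)⟩
    | succ n => exact Q.exact_succ n

variable {i} {Q} {hP : P₀.IsProjective} {hit : Function.Injective i.top}
  {hib : Function.Injective i.bot} {q : Hom P₀ M} {hq : q.Surjective} {h : i.Exact q}
  {x u : R.top}

/-- The last differential is i after a surjective augmentation, so it has the same image as i. -/
theorem mem_rangeModulo_splice_top (z : P₀.top) :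
    z ∈ (rangeModulo x u ((Q.splice i hP hit hib q hq h).d 0)).top ↔
      z ∈ (rangeModulo x u i).top := by
  refine mem_rangeModulo_top.trans (Iff.trans ⟨?_, ?_⟩ mem_rangeModulo_top.symm)
  · rintro ⟨m, hm⟩; exact ⟨_, hm⟩
  · rintro ⟨m, hm⟩; obtain ⟨w, rfl⟩ := Q.aug_surjective.1 m; exact ⟨w, hm⟩

theorem mem_rangeModulo_splice_bot (z : P₀.bot) :
    z ∈ (rangeModulo x u ((Q.splice i hP hit hib q hq h).d 0)).bot ↔
      z ∈ (rangeModulo x u i).bot := by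
  refine mem_rangeModulo_bot.trans (Iff.trans ⟨?_, ?_⟩ mem_rangeModulo_bot.symm)
  · rintro ⟨m, hm⟩; exact ⟨_, hm⟩
  · rintro ⟨m, hm⟩; obtain ⟨w, rfl⟩ := Q.aug_surjective.2 m; exact ⟨w, hm⟩

end Splice

/-- Every cycle in degree `n` is a boundary. -/
structure Acyclic {M : GreenModule R} (P : ProjectiveResolution M) (x u : R.top) (n : ℕ) :
    Prop where
  top : ∀ z ∈ (P.cycles x u n).top, z ∈ (rangeModulo x u (P.d n)).top
  bot : ∀ z ∈ (P.cycles x u n).bot, z ∈ (rangeModulo x u (P.d n)).bot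

theorem acyclic_iff {M : GreenModule R} {P : ProjectiveResolution M} {x u : R.top} {n : ℕ} :
    P.Acyclic x u n ↔ (P.homologyModulo x u n).IsElementary 0 := by
  constructor
  · intro h
    have hb : ∀ y : (P.homologyModulo x u n).bot, y = 0 := fun y => by
      obtain ⟨z, rfl⟩ := MackeyFunctor.subquotMk_bot_surjective _ _ y
      exact (MackeyFunctor.subquotMk_bot_eq_zero z).2 (h.bot z.1 z.2)
    have ht : ∀ y : (P.homologyModulo x u n).top, y = 0 := fun y => by
      obtain ⟨z, rfl⟩ := MackeyFunctor.subquotMk_top_surjective _ _ y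
      exact (MackeyFunctor.subquotMk_top_eq_zero z).2 (h.top z.1 z.2)
    refine ⟨hb, fun y => by rw [ht y, smul_zero], ?_⟩
    have : Unique (P.homologyModulo x u n).top := ⟨⟨0⟩, ht⟩
    rw [pow_zero, Nat.card_unique]
  · intro h
    have : Subsingleton (P.homologyModulo x u n).top :=
      (Nat.card_eq_one_iff_unique.1 (h.card_top.trans (pow_zero p))).1
    exact ⟨fun z hz => (MackeyFunctor.subquotMk_top_eq_zero ⟨z, hz⟩).1 (this.elim _ _),
      fun z hz => (MackeyFunctor.subquotMk_bot_eq_zero ⟨z, hz⟩).1 (h.bot_eq_zero _)⟩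

/-- H_1(M) is the kernel of K/(x, u)K → P₀/(x, u)P₀, so it vanishes if i reflects membership in
ideal multiples. On chains: if the image of a cycle in K is a combination of x and u, lifting its
coefficients and subtracting leaves an element of the kernel of the augmentation. -/
theorem Acyclic.splice {K P₀ M : GreenModule R} {Q : ProjectiveResolution K} {i : Hom K P₀}
    {hP : P₀.IsProjective} {hit : Function.Injective i.top} {hib : Function.Injective i.bot}
    {q : Hom P₀ M} {hq : q.Surjective} {h : i.Exact q} {x u : R.top}
    (ht : ∀ k, i.top k ∈ (idealSmul x u P₀).top → k ∈ (idealSmul x u K).top)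
    (hb : ∀ k, i.bot k ∈ (idealSmul x u P₀).bot → k ∈ (idealSmul x u K).bot) :
    (Q.splice i hP hit hib q hq h).Acyclic x u 1 := by
  constructor
  · intro (z : (Q.X 0).top) hz
    obtain ⟨a, b, hab⟩ := mem_idealSmul_top.1 (ht (Q.aug.top z) hz)
    obtain ⟨a, rfl⟩ := Q.aug_surjective.1 a
    obtain ⟨b, rfl⟩ := Q.aug_surjective.1 b
    have h0 : Q.aug.top (z - (x • a + u • b)) = 0 := by
      rw [map_sub, ← hab, map_add, map_smul, map_smul, sub_self]
    obtain ⟨w, hw⟩ := (Q.exact_zero.1 _).1 h0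
    refine mem_rangeModulo_top.2 ⟨w, mem_idealSmul_top.2 ⟨a, b, ?_⟩⟩
    exact ((congrArg (z - ·) hw).trans (sub_sub_cancel _ _)).symm
  · intro (z : (Q.X 0).bot) hz
    obtain ⟨a, b, hab⟩ := mem_idealSmul_bot.1 (hb (Q.aug.bot z) hz)
    obtain ⟨a, rfl⟩ := Q.aug_surjective.2 a
    obtain ⟨b, rfl⟩ := Q.aug_surjective.2 b
    have h0 : Q.aug.bot (z - (R.res x • a + R.res u • b)) = 0 := by
      rw [map_sub, ← hab, map_add, map_smul, map_smul, sub_self]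
    obtain ⟨w, hw⟩ := (Q.exact_zero.2 _).1 h0
    refine mem_rangeModulo_bot.2 ⟨w, mem_idealSmul_bot.2 ⟨a, b, ?_⟩⟩
    exact ((congrArg (z - ·) hw).trans (sub_sub_cancel _ _)).symm

/-! ### Mapping cones -/

section Cone

variable {M M' M'' : GreenModule R} (P : ProjectiveResolution M) (Q : ProjectiveResolution M')
  (f : ∀ n, Hom (P.X n) (Q.X n))

/-- The terms of the mapping cone. -/
def coneX : ℕ → GreenModule R
  | 0 => Q.X 0
  | n + 1 => (P.X n).prod (Q.X (n + 1))

/-- The differentials of the mapping cone. -/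
def coneD : ∀ n, Hom (coneX P Q (n + 1)) (coneX P Q n)
  | 0 => (f 0).coprod (Q.d 0)
  | n + 1 => ((P.d n).comp (Hom.fst _ _)).neg.prod ((f (n + 1)).coprod (Q.d (n + 1)))

/-- The resolution of `M''` obtained from a chain map covering the first map of a short exact
sequence `0 ⟶ M ⟶ M' ⟶ M'' ⟶ 0`. -/
def cone (hf : ∀ n, (Q.d n).comp (f (n + 1)) = (f n).comp (P.d n)) (s : Hom M M')
    (hs : Q.aug.comp (f 0) = s.comp P.aug) (hst : Function.Injective s.top)
    (hsb : Function.Injective s.bot) (q : Hom M' M'') (hq : q.Surjective) (h : s.Exact q) :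
    ProjectiveResolution M'' where
  X := coneX P Q
  d := coneD P Q f
  aug := q.comp Q.aug
  projective := fun n => by
    cases n with
    | zero => exact Q.projective 0
    | succ n => exact (P.projective n).prod (Q.projective (n + 1))
  aug_surjective := ⟨hq.1.comp Q.aug_surjective.1, hq.2.comp Q.aug_surjective.2⟩
  exact_zero := by
    have hst' : ∀ c, Q.aug.top ((f 0).top c) = s.top (P.aug.top c) :=
      LinearMap.congr_fun (congrArg Hom.top hs)
    have hsb' : ∀ c, Q.aug.bot ((f 0).bot c) = s.bot (P.aug.bot c) :=
      LinearMap.congr_fun (congrArg Hom.bot hs)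
    constructor
    · intro (z : (Q.X 0).top)
      constructor
      · intro hz
        obtain ⟨m, hm⟩ := (h.1 _).1 hz
        obtain ⟨c, rfl⟩ := P.aug_surjective.1 m
        obtain ⟨b, hb⟩ := (Q.exact_zero.1 (z - (f 0).top c)).1
          ((map_sub _ _ _).trans (sub_eq_zero.2 (hm.symm.trans (hst' c).symm)))
        exact ⟨(c, b), (congrArg ((f 0).top c + ·) hb).trans (add_sub_cancel _ _)⟩
      · rintro ⟨⟨c, b⟩, rfl⟩
        refine (h.1 _).2 ⟨P.aug.top c, (hst' c).symm.trans ?_⟩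
        change Q.aug.top ((f 0).top c) = Q.aug.top ((f 0).top c + (Q.d 0).top b)
        rw [map_add, (Q.exact_zero.1 _).2 ⟨b, rfl⟩, add_zero]
    · intro (z : (Q.X 0).bot)
      constructor
      · intro hz
        obtain ⟨m, hm⟩ := (h.2 _).1 hz
        obtain ⟨c, rfl⟩ := P.aug_surjective.2 m
        obtain ⟨b, hb⟩ := (Q.exact_zero.2 (z - (f 0).bot c)).1
          ((map_sub _ _ _).trans (sub_eq_zero.2 (hm.symm.trans (hsb' c).symm)))
        exact ⟨(c, b), (congrArg ((f 0).bot c + ·) hb).trans (add_sub_cancel _ _)⟩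
      · rintro ⟨⟨c, b⟩, rfl⟩
        refine (h.2 _).2 ⟨P.aug.bot c, (hsb' c).symm.trans ?_⟩
        change Q.aug.bot ((f 0).bot c) = Q.aug.bot ((f 0).bot c + (Q.d 0).bot b)
        rw [map_add, (Q.exact_zero.2 _).2 ⟨b, rfl⟩, add_zero]
  exact_succ := fun n => by
    have hft : ∀ n c, (Q.d n).top ((f (n + 1)).top c) = (f n).top ((P.d n).top c) :=
      fun n => LinearMap.congr_fun (congrArg Hom.top (hf n))
    have hfb : ∀ n c, (Q.d n).bot ((f (n + 1)).bot c) = (f n).bot ((P.d n).bot c) :=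
      fun n => LinearMap.congr_fun (congrArg Hom.bot (hf n))
    have hst' : ∀ c, Q.aug.top ((f 0).top c) = s.top (P.aug.top c) :=
      LinearMap.congr_fun (congrArg Hom.top hs)
    have hsb' : ∀ c, Q.aug.bot ((f 0).bot c) = s.bot (P.aug.bot c) :=
      LinearMap.congr_fun (congrArg Hom.bot hs)
    cases n with
    | zero =>
      constructor
      · rintro ⟨c, a⟩
        constructor
        · intro (hz : (f 0).top c + (Q.d 0).top a = 0)
          -- Exactness in degree one is where injectivity of `s` enters: it forces the first
          -- component of a cycle into the kernel of the augmentation of P.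
          have hc : P.aug.top c = 0 := by
            refine (map_eq_zero_iff s.top hst).1 ?_
            rw [← hst', eq_neg_of_add_eq_zero_left hz, map_neg, (Q.exact_zero.1 _).2 ⟨a, rfl⟩,
              neg_zero]
          obtain ⟨b, b', h1, h2⟩ := exact_cone_aux (d := (P.d 0).top.toAddMonoidHom)
            (d' := P.aug.top.toAddMonoidHom) (e := (Q.d 1).top.toAddMonoidHom)
            (e' := (Q.d 0).top.toAddMonoidHom) (f₁ := (f 1).top.toAddMonoidHom)
            (f₀ := (f 0).top.toAddMonoidHom) (fun c => (P.exact_zero.1 c).1)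
            (fun c => ((Q.exact_succ 0).1 c).1) (hft 0) c a hc hz
          exact ⟨(b, b'), Prod.ext h1 h2⟩
        · rintro ⟨⟨b, b'⟩, h⟩
          obtain rfl : -(P.d 0).top b = c := congrArg Prod.fst h
          obtain rfl : (f 1).top b + (Q.d 1).top b' = a := congrArg Prod.snd h
          change (f 0).top (-(P.d 0).top b) + (Q.d 0).top ((f 1).top b + (Q.d 1).top b') = 0
          rw [map_neg, map_add, hft, ((Q.exact_succ 0).1 _).2 ⟨b', rfl⟩, add_zero,
            neg_add_cancel]
      · rintro ⟨c, a⟩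
        constructor
        · intro (hz : (f 0).bot c + (Q.d 0).bot a = 0)
          have hc : P.aug.bot c = 0 := by
            refine (map_eq_zero_iff s.bot hsb).1 ?_
            rw [← hsb', eq_neg_of_add_eq_zero_left hz, map_neg, (Q.exact_zero.2 _).2 ⟨a, rfl⟩,
              neg_zero]
          obtain ⟨b, b', h1, h2⟩ := exact_cone_aux (d := (P.d 0).bot.toAddMonoidHom)
            (d' := P.aug.bot.toAddMonoidHom) (e := (Q.d 1).bot.toAddMonoidHom)
            (e' := (Q.d 0).bot.toAddMonoidHom) (f₁ := (f 1).bot.toAddMonoidHom)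
            (f₀ := (f 0).bot.toAddMonoidHom) (fun c => (P.exact_zero.2 c).1)
            (fun c => ((Q.exact_succ 0).2 c).1) (hfb 0) c a hc hz
          exact ⟨(b, b'), Prod.ext h1 h2⟩
        · rintro ⟨⟨b, b'⟩, h⟩
          obtain rfl : -(P.d 0).bot b = c := congrArg Prod.fst h
          obtain rfl : (f 1).bot b + (Q.d 1).bot b' = a := congrArg Prod.snd h
          change (f 0).bot (-(P.d 0).bot b) + (Q.d 0).bot ((f 1).bot b + (Q.d 1).bot b') = 0
          rw [map_neg, map_add, hfb, ((Q.exact_succ 0).2 _).2 ⟨b', rfl⟩, add_zero,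
            neg_add_cancel]
    | succ n =>
      constructor
      · rintro ⟨c, a⟩
        constructor
        · intro hz
          have hc : -(P.d n).top c = 0 := congrArg Prod.fst hz
          have ha : (f (n + 1)).top c + (Q.d (n + 1)).top a = 0 := congrArg Prod.snd hz
          obtain ⟨b, b', h1, h2⟩ := exact_cone_aux (d := (P.d (n + 1)).top.toAddMonoidHom)
            (d' := (P.d n).top.toAddMonoidHom) (e := (Q.d (n + 2)).top.toAddMonoidHom)
            (e' := (Q.d (n + 1)).top.toAddMonoidHom) (f₁ := (f (n + 2)).top.toAddMonoidHom)
            (f₀ := (f (n + 1)).top.toAddMonoidHom) (fun c => ((P.exact_succ n).1 c).1)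
            (fun c => ((Q.exact_succ (n + 1)).1 c).1) (hft (n + 1)) c a (neg_eq_zero.1 hc) ha
          exact ⟨(b, b'), Prod.ext h1 h2⟩
        · rintro ⟨⟨b, b'⟩, h⟩
          obtain rfl : -(P.d (n + 1)).top b = c := congrArg Prod.fst h
          obtain rfl : (f (n + 2)).top b + (Q.d (n + 2)).top b' = a := congrArg Prod.snd h
          refine Prod.ext ?_ ?_
          · change -(P.d n).top (-(P.d (n + 1)).top b) = 0
            rw [map_neg, ((P.exact_succ n).1 _).2 ⟨b, rfl⟩, neg_zero, neg_zero]
          · change (f (n + 1)).top (-(P.d (n + 1)).top b) +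
              (Q.d (n + 1)).top ((f (n + 2)).top b + (Q.d (n + 2)).top b') = 0
            rw [map_neg, map_add, hft, ((Q.exact_succ (n + 1)).1 _).2 ⟨b', rfl⟩, add_zero,
              neg_add_cancel]
      · rintro ⟨c, a⟩
        constructor
        · intro hz
          have hc : -(P.d n).bot c = 0 := congrArg Prod.fst hz
          have ha : (f (n + 1)).bot c + (Q.d (n + 1)).bot a = 0 := congrArg Prod.snd hz
          obtain ⟨b, b', h1, h2⟩ := exact_cone_aux (d := (P.d (n + 1)).bot.toAddMonoidHom)
            (d' := (P.d n).bot.toAddMonoidHom) (e := (Q.d (n + 2)).bot.toAddMonoidHom)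
            (e' := (Q.d (n + 1)).bot.toAddMonoidHom) (f₁ := (f (n + 2)).bot.toAddMonoidHom)
            (f₀ := (f (n + 1)).bot.toAddMonoidHom) (fun c => ((P.exact_succ n).2 c).1)
            (fun c => ((Q.exact_succ (n + 1)).2 c).1) (hfb (n + 1)) c a (neg_eq_zero.1 hc) ha
          exact ⟨(b, b'), Prod.ext h1 h2⟩
        · rintro ⟨⟨b, b'⟩, h⟩
          obtain rfl : -(P.d (n + 1)).bot b = c := congrArg Prod.fst h
          obtain rfl : (f (n + 2)).bot b + (Q.d (n + 2)).bot b' = a := congrArg Prod.snd h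
          refine Prod.ext ?_ ?_
          · change -(P.d n).bot (-(P.d (n + 1)).bot b) = 0
            rw [map_neg, ((P.exact_succ n).2 _).2 ⟨b, rfl⟩, neg_zero, neg_zero]
          · change (f (n + 1)).bot (-(P.d (n + 1)).bot b) +
              (Q.d (n + 1)).bot ((f (n + 2)).bot b + (Q.d (n + 2)).bot b') = 0
            rw [map_neg, map_add, hfb, ((Q.exact_succ (n + 1)).2 _).2 ⟨b', rfl⟩, add_zero,
              neg_add_cancel]

end Cone

/-- The direct sum of two projective resolutions. -/
def prod {M N : GreenModule R} (P : ProjectiveResolution M) (Q : ProjectiveResolution N) :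
    ProjectiveResolution (M.prod N) where
  X := fun n => (P.X n).prod (Q.X n)
  d := fun n => ((P.d n).comp (Hom.fst _ _)).prod ((Q.d n).comp (Hom.snd _ _))
  aug := (P.aug.comp (Hom.fst _ _)).prod (Q.aug.comp (Hom.snd _ _))
  projective := fun n => (P.projective n).prod (Q.projective n)
  aug_surjective := by
    constructor
    · rintro ⟨a, b⟩
      obtain ⟨a, rfl⟩ := P.aug_surjective.1 a
      obtain ⟨b, rfl⟩ := Q.aug_surjective.1 b
      exact ⟨(a, b), rfl⟩
    · rintro ⟨a, b⟩
      obtain ⟨a, rfl⟩ := P.aug_surjective.2 a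
      obtain ⟨b, rfl⟩ := Q.aug_surjective.2 b
      exact ⟨(a, b), rfl⟩
  exact_zero := by
    constructor
    · rintro ⟨a, b⟩
      refine Prod.ext_iff.trans ((and_congr (P.exact_zero.1 a) (Q.exact_zero.1 b)).trans ⟨?_, ?_⟩)
      · rintro ⟨⟨a, rfl⟩, ⟨b, rfl⟩⟩; exact ⟨(a, b), rfl⟩
      · rintro ⟨⟨a', b'⟩, h⟩; exact ⟨⟨a', congrArg Prod.fst h⟩, ⟨b', congrArg Prod.snd h⟩⟩
    · rintro ⟨a, b⟩
      refine Prod.ext_iff.trans ((and_congr (P.exact_zero.2 a) (Q.exact_zero.2 b)).trans ⟨?_, ?_⟩)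
      · rintro ⟨⟨a, rfl⟩, ⟨b, rfl⟩⟩; exact ⟨(a, b), rfl⟩
      · rintro ⟨⟨a', b'⟩, h⟩; exact ⟨⟨a', congrArg Prod.fst h⟩, ⟨b', congrArg Prod.snd h⟩⟩
  exact_succ := fun n => by
    constructor
    · rintro ⟨a, b⟩
      refine Prod.ext_iff.trans
        ((and_congr ((P.exact_succ n).1 a) ((Q.exact_succ n).1 b)).trans ⟨?_, ?_⟩)
      · rintro ⟨⟨a, rfl⟩, ⟨b, rfl⟩⟩; exact ⟨(a, b), rfl⟩
      · rintro ⟨⟨a', b'⟩, h⟩; exact ⟨⟨a', congrArg Prod.fst h⟩, ⟨b', congrArg Prod.snd h⟩⟩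
    · rintro ⟨a, b⟩
      refine Prod.ext_iff.trans
        ((and_congr ((P.exact_succ n).2 a) ((Q.exact_succ n).2 b)).trans ⟨?_, ?_⟩)
      · rintro ⟨⟨a, rfl⟩, ⟨b, rfl⟩⟩; exact ⟨(a, b), rfl⟩
      · rintro ⟨⟨a', b'⟩, h⟩; exact ⟨⟨a', congrArg Prod.fst h⟩, ⟨b', congrArg Prod.snd h⟩⟩

end ProjectiveResolution

end GreenModule

/-! ### Homology of mapping cones modulo an ideal -/

/-- The morphism to a direct sum with given components. -/
def MackeyFunctor.Hom.prod {p : ℕ} [Fact p.Prime] {L M N : MackeyFunctor p} (f : Hom L M)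
    (g : Hom L N) : Hom L (M.sum N) where
  top := f.top.prod g.top
  bot := f.bot.prod g.bot
  map_res := fun x => Prod.ext (f.map_res x) (g.map_res x)
  map_tr := fun x => Prod.ext (f.map_tr x) (g.map_tr x)
  map_smul := fun a x => Prod.ext (f.map_smul a x) (g.map_smul a x)

theorem Nat.card_eq_mul_of_exact {A B C : Type} [AddCommGroup A] [AddCommGroup B]
    [AddCommGroup C] (i : A →+ B) (q : B →+ C) (hi : Function.Injective i)
    (hq : Function.Surjective q) (h : Function.Exact i q) :
    Nat.card B = Nat.card A * Nat.card C := by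
  have h1 : q.ker = i.range := AddSubgroup.ext fun b => h b
  have h2 := AddSubgroup.card_eq_card_quotient_mul_card_addSubgroup q.ker
  rw [h2, Nat.card_congr (QuotientAddGroup.quotientKerEquivOfSurjective q hq).toEquiv, h1,
    ← Nat.card_congr (AddMonoidHom.ofInjective hi).toEquiv, mul_comm]

theorem AddSubgroup.sub_add_mem_iff {G : Type} [AddCommGroup G] (J : AddSubgroup G) {a b c : G}
    (hb : b ∈ J) : a - (b + c) ∈ J ↔ a - c ∈ J := by
  rw [show a - (b + c) = a - c - b by abel]
  exact ⟨fun h => by simpa using J.add_mem h hb, fun h => J.sub_mem h hb⟩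

namespace GreenModule

variable {p : ℕ} [Fact p.Prime] {R : GreenFunctor p} {x u : R.top}

theorem mem_idealSmul_prod_top {M N : GreenModule R} {m : M.top} {n : N.top} :
    ((m, n) : M.top × N.top) ∈ (idealSmul x u (M.prod N)).top ↔
      m ∈ (idealSmul x u M).top ∧ n ∈ (idealSmul x u N).top := by
  constructor
  · intro h
    exact ⟨(Hom.fst M N).map_idealSmul_top h, (Hom.snd M N).map_idealSmul_top h⟩
  · rintro ⟨h, h'⟩
    obtain ⟨a, b, rfl⟩ := mem_idealSmul_top.1 h
    obtain ⟨a', b', rfl⟩ := mem_idealSmul_top.1 h'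
    exact mem_idealSmul_top.2 ⟨(a, a'), (b, b'), rfl⟩

theorem mem_idealSmul_prod_bot {M N : GreenModule R} {m : M.bot} {n : N.bot} :
    ((m, n) : M.bot × N.bot) ∈ (idealSmul x u (M.prod N)).bot ↔
      m ∈ (idealSmul x u M).bot ∧ n ∈ (idealSmul x u N).bot := by
  constructor
  · intro h
    exact ⟨(Hom.fst M N).map_idealSmul_bot h, (Hom.snd M N).map_idealSmul_bot h⟩
  · rintro ⟨h, h'⟩
    obtain ⟨a, b, rfl⟩ := mem_idealSmul_bot.1 h
    obtain ⟨a', b', rfl⟩ := mem_idealSmul_bot.1 h'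
    exact mem_idealSmul_bot.2 ⟨(a, a'), (b, b'), rfl⟩

theorem smul_mem_idealSmul_top {M : GreenModule R} (a : R.top) {m : M.top}
    (hm : m ∈ (idealSmul x u M).top) : a • m ∈ (idealSmul x u M).top :=
  (M.homothety a).map_idealSmul_top hm

theorem fst_smul_mem_top {M : GreenModule R} (m : M.top) : x • m ∈ (idealSmul x u M).top :=
  mem_idealSmul_top.2 ⟨m, 0, by simp⟩

theorem snd_smul_mem_top {M : GreenModule R} (m : M.top) : u • m ∈ (idealSmul x u M).top :=
  mem_idealSmul_top.2 ⟨0, m, by simp⟩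

theorem fst_smul_mem_bot {M : GreenModule R} (m : M.bot) :
    R.res x • m ∈ (idealSmul x u M).bot :=
  mem_idealSmul_bot.2 ⟨m, 0, by simp⟩

theorem snd_smul_mem_bot {M : GreenModule R} (m : M.bot) :
    R.res u • m ∈ (idealSmul x u M).bot :=
  mem_idealSmul_bot.2 ⟨0, m, by simp⟩

namespace ProjectiveResolution

section Cone

variable {M M' M'' : GreenModule R} {P : ProjectiveResolution M} {Q : ProjectiveResolution M'}
  {f : ∀ n, Hom (P.X n) (Q.X n)}
  {hf : ∀ n, (Q.d n).comp (f (n + 1)) = (f n).comp (P.d n)} {s : Hom M M'}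
  {hs : Q.aug.comp (f 0) = s.comp P.aug} {hst : Function.Injective s.top}
  {hsb : Function.Injective s.bot} {q : Hom M' M''} {hq : q.Surjective} {h : s.Exact q}

theorem mem_cycles_cone_top {n : ℕ} {c : (P.X n).top} {a : (Q.X (n + 1)).top} :
    ((c, a) : (P.X n).top × (Q.X (n + 1)).top) ∈
        ((P.cone Q f hf s hs hst hsb q hq h).cycles x u (n + 1)).top ↔
      c ∈ (P.cycles x u n).top ∧ (f n).top c + (Q.d n).top a ∈ (idealSmul x u (Q.X n)).top := by
  cases n with
  | zero => exact ⟨fun h => ⟨trivial, h⟩, fun h => h.2⟩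
  | succ n =>
    refine Iff.trans (mem_idealSmul_prod_top (m := -(P.d n).top c)
      (n := (f (n + 1)).top c + (Q.d (n + 1)).top a)) (and_congr ?_ Iff.rfl)
    exact neg_mem_iff

theorem mem_cycles_cone_bot {n : ℕ} {c : (P.X n).bot} {a : (Q.X (n + 1)).bot} :
    ((c, a) : (P.X n).bot × (Q.X (n + 1)).bot) ∈
        ((P.cone Q f hf s hs hst hsb q hq h).cycles x u (n + 1)).bot ↔
      c ∈ (P.cycles x u n).bot ∧ (f n).bot c + (Q.d n).bot a ∈ (idealSmul x u (Q.X n)).bot := by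
  cases n with
  | zero => exact ⟨fun h => ⟨trivial, h⟩, fun h => h.2⟩
  | succ n =>
    refine Iff.trans (mem_idealSmul_prod_bot (m := -(P.d n).bot c)
      (n := (f (n + 1)).bot c + (Q.d (n + 1)).bot a)) (and_congr ?_ Iff.rfl)
    exact neg_mem_iff

theorem mem_boundaries_cone_top {n : ℕ} {c : (P.X n).top} {a : (Q.X (n + 1)).top} :
    ((c, a) : (P.X n).top × (Q.X (n + 1)).top) ∈
        (rangeModulo x u ((P.cone Q f hf s hs hst hsb q hq h).d (n + 1))).top ↔
      ∃ c' a', c + (P.d n).top c' ∈ (idealSmul x u (P.X n)).top ∧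
        a - ((f (n + 1)).top c' + (Q.d (n + 1)).top a') ∈ (idealSmul x u (Q.X (n + 1))).top := by
  refine mem_rangeModulo_top.trans ⟨?_, ?_⟩
  · rintro ⟨⟨c', a'⟩, h⟩
    refine ⟨c', a', ?_⟩
    have := mem_idealSmul_prod_top.1 h
    rwa [← sub_neg_eq_add]
  · rintro ⟨c', a', h⟩
    rw [← sub_neg_eq_add] at h
    exact ⟨(c', a'), mem_idealSmul_prod_top.2 h⟩

theorem mem_boundaries_cone_bot {n : ℕ} {c : (P.X n).bot} {a : (Q.X (n + 1)).bot} :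
    ((c, a) : (P.X n).bot × (Q.X (n + 1)).bot) ∈
        (rangeModulo x u ((P.cone Q f hf s hs hst hsb q hq h).d (n + 1))).bot ↔
      ∃ c' a', c + (P.d n).bot c' ∈ (idealSmul x u (P.X n)).bot ∧
        a - ((f (n + 1)).bot c' + (Q.d (n + 1)).bot a') ∈ (idealSmul x u (Q.X (n + 1))).bot := by
  refine mem_rangeModulo_bot.trans ⟨?_, ?_⟩
  · rintro ⟨⟨c', a'⟩, h⟩
    refine ⟨c', a', ?_⟩
    have := mem_idealSmul_prod_bot.1 h
    rwa [← sub_neg_eq_add]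
  · rintro ⟨c', a', h⟩
    rw [← sub_neg_eq_add] at h
    exact ⟨(c', a'), mem_idealSmul_prod_bot.2 h⟩

theorem mem_boundaries_iff_add_top {n : ℕ} {c : (P.X n).top} :
    (∃ c', c + (P.d n).top c' ∈ (idealSmul x u (P.X n)).top) ↔
      c ∈ (rangeModulo x u (P.d n)).top := by
  rw [mem_rangeModulo_top]
  exact ⟨fun ⟨c', h⟩ => ⟨-c', by rwa [map_neg, sub_neg_eq_add]⟩,
    fun ⟨c', h⟩ => ⟨-c', by rwa [map_neg, ← sub_eq_add_neg]⟩⟩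

theorem mem_boundaries_iff_add_bot {n : ℕ} {c : (P.X n).bot} :
    (∃ c', c + (P.d n).bot c' ∈ (idealSmul x u (P.X n)).bot) ↔
      c ∈ (rangeModulo x u (P.d n)).bot := by
  rw [mem_rangeModulo_bot]
  exact ⟨fun ⟨c', h⟩ => ⟨-c', by rwa [map_neg, sub_neg_eq_add]⟩,
    fun ⟨c', h⟩ => ⟨-c', by rwa [map_neg, ← sub_eq_add_neg]⟩⟩

section Split

variable (hft : ∀ n c, (f n).top c ∈ (idealSmul x u (Q.X n)).top)
  (hfb : ∀ n c, (f n).bot c ∈ (idealSmul x u (Q.X n)).bot)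
include hft hfb

/-- The homology of the cone of a chain map that vanishes modulo `(x, u)`. -/
theorem homologyModulo_cone_succ (n : ℕ) :
    ((P.cone Q f hf s hs hst hsb q hq h).homologyModulo x u (n + 1)).IsIsomorphic
      ((P.homologyModulo x u n).sum (Q.homologyModulo x u (n + 1))) := by
  set C := P.cone Q f hf s hs hst hsb q hq h with hC
  -- The term f c already lies in the ideal multiple, so the cycle condition decouples into one
  -- condition for each component.
  have Zt : ∀ z : (P.X n).top × (Q.X (n + 1)).top, z ∈ (C.cycles x u (n + 1)).top ↔
      z.1 ∈ (P.cycles x u n).top ∧ z.2 ∈ (Q.cycles x u (n + 1)).top := fun z =>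
    mem_cycles_cone_top.trans (and_congr Iff.rfl (add_mem_cancel_left (hft n z.1)))
  have Zb : ∀ z : (P.X n).bot × (Q.X (n + 1)).bot, z ∈ (C.cycles x u (n + 1)).bot ↔
      z.1 ∈ (P.cycles x u n).bot ∧ z.2 ∈ (Q.cycles x u (n + 1)).bot := fun z =>
    mem_cycles_cone_bot.trans (and_congr Iff.rfl (add_mem_cancel_left (hfb n z.1)))
  let π₁ := (MackeyFunctor.subquotMk (P.cycles x u n) (rangeModulo x u (P.d n))).comp
    ((Hom.fst (P.X n) (Q.X (n + 1))).toMackey.restrict (C.cycles x u (n + 1)) (P.cycles x u n)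
      (fun z hz => ((Zt z).1 hz).1) fun z hz => ((Zb z).1 hz).1)
  let π₂ := (MackeyFunctor.subquotMk (Q.cycles x u (n + 1)) (rangeModulo x u (Q.d (n + 1)))).comp
    ((Hom.snd (P.X n) (Q.X (n + 1))).toMackey.restrict (C.cycles x u (n + 1))
      (Q.cycles x u (n + 1)) (fun z hz => ((Zt z).1 hz).2) fun z hz => ((Zb z).1 hz).2)
  refine MackeyFunctor.subquot_isIsomorphic (π₁.prod π₂) ?_ ?_ ?_ ?_
  · rintro ⟨a, b⟩
    obtain ⟨a, rfl⟩ := MackeyFunctor.subquotMk_top_surjective _ _ a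
    obtain ⟨b, rfl⟩ := MackeyFunctor.subquotMk_top_surjective _ _ b
    exact ⟨⟨(a.1, b.1), (Zt (a.1, b.1)).2 ⟨a.2, b.2⟩⟩, rfl⟩
  · rintro ⟨a, b⟩
    obtain ⟨a, rfl⟩ := MackeyFunctor.subquotMk_bot_surjective _ _ a
    obtain ⟨b, rfl⟩ := MackeyFunctor.subquotMk_bot_surjective _ _ b
    exact ⟨⟨(a.1, b.1), (Zb (a.1, b.1)).2 ⟨a.2, b.2⟩⟩, rfl⟩
  · rintro ⟨⟨c, a⟩, hz⟩
    refine Prod.ext_iff.trans ((and_congr (MackeyFunctor.subquotMk_top_eq_zero _)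
      (MackeyFunctor.subquotMk_top_eq_zero _)).trans (Iff.trans ?_ mem_boundaries_cone_top.symm))
    change c ∈ _ ∧ a ∈ _ ↔ _
    rw [← mem_boundaries_iff_add_top, mem_rangeModulo_top]
    constructor
    · rintro ⟨⟨c', hc⟩, ⟨a', ha⟩⟩
      exact ⟨c', a', hc, (AddSubgroup.sub_add_mem_iff _ (hft _ _)).2 ha⟩
    · rintro ⟨c', a', hc, ha⟩
      exact ⟨⟨c', hc⟩, ⟨a', (AddSubgroup.sub_add_mem_iff _ (hft _ _)).1 ha⟩⟩
  · rintro ⟨⟨c, a⟩, hz⟩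
    refine Prod.ext_iff.trans ((and_congr (MackeyFunctor.subquotMk_bot_eq_zero _)
      (MackeyFunctor.subquotMk_bot_eq_zero _)).trans (Iff.trans ?_ mem_boundaries_cone_bot.symm))
    change c ∈ _ ∧ a ∈ _ ↔ _
    rw [← mem_boundaries_iff_add_bot, mem_rangeModulo_bot]
    constructor
    · rintro ⟨⟨c', hc⟩, ⟨a', ha⟩⟩
      exact ⟨c', a', hc, (AddSubgroup.sub_add_mem_iff _ (hfb _ _)).2 ha⟩
    · rintro ⟨c', a', hc, ha⟩
      exact ⟨⟨c', hc⟩, ⟨a', (AddSubgroup.sub_add_mem_iff _ (hfb _ _)).1 ha⟩⟩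

theorem homologyModulo_cone_zero :
    ((P.cone Q f hf s hs hst hsb q hq h).homologyModulo x u 0).IsIsomorphic
      (Q.homologyModulo x u 0) := by
  refine (Hom.id (Q.X 0)).toMackey.subquot_isIsomorphic (fun _ _ => trivial) (fun _ _ => trivial)
    (fun w _ => ⟨w, trivial, ?_⟩) (fun w _ => ⟨w, trivial, ?_⟩) (fun z _ => ?_) fun z _ => ?_
  · exact (sub_self w).symm ▸ zero_mem _
  · exact (sub_self w).symm ▸ zero_mem _
  · refine mem_rangeModulo_top.trans (Iff.trans ?_ mem_rangeModulo_top.symm)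
    constructor
    · rintro ⟨a, ha⟩
      refine ⟨((0 : (P.X 0).top), a), ?_⟩
      change z - ((f 0).top 0 + (Q.d 0).top a) ∈ (idealSmul x u (Q.X 0)).top
      rw [map_zero, zero_add]
      exact ha
    · rintro ⟨⟨c, a⟩, ha⟩
      exact ⟨a, (AddSubgroup.sub_add_mem_iff _ (hft 0 c)).1 ha⟩
  · refine mem_rangeModulo_bot.trans (Iff.trans ?_ mem_rangeModulo_bot.symm)
    constructor
    · rintro ⟨a, ha⟩
      refine ⟨((0 : (P.X 0).bot), a), ?_⟩
      change z - ((f 0).bot 0 + (Q.d 0).bot a) ∈ (idealSmul x u (Q.X 0)).bot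
      rw [map_zero, zero_add]
      exact ha
    · rintro ⟨⟨c, a⟩, ha⟩
      exact ⟨a, (AddSubgroup.sub_add_mem_iff _ (hfb 0 c)).1 ha⟩

end Split

end Cone

/-! ### The cone of multiplication by `(u, p)` -/

section PrimeCone

variable {M M'' : GreenModule R} {P : ProjectiveResolution M}

/-- The morphism `m ↦ (u m, p m)`. -/
def pairHom (u : R.top) (M : GreenModule R) : Hom M (M.prod M) :=
  (M.homothety u).prod (M.homothety (p : R.top))

theorem pairHom_comm (u : R.top) (P : ProjectiveResolution M) (n : ℕ) :
    ((P.prod P).d n).comp (pairHom u (P.X (n + 1))) = (pairHom u (P.X n)).comp (P.d n) := by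
  refine Hom.ext (LinearMap.ext fun c => Prod.ext ?_ ?_)
    (LinearMap.ext fun c => Prod.ext ?_ ?_)
  · exact map_smul (P.d n).top u c
  · exact map_smul (P.d n).top (p : R.top) c
  · exact map_smul (P.d n).bot (R.res u) c
  · exact map_smul (P.d n).bot (R.res (p : R.top)) c

theorem pairHom_aug (u : R.top) (P : ProjectiveResolution M) :
    (P.prod P).aug.comp (pairHom u (P.X 0)) = (pairHom u M).comp P.aug := by
  refine Hom.ext (LinearMap.ext fun c => Prod.ext ?_ ?_)
    (LinearMap.ext fun c => Prod.ext ?_ ?_)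
  · exact map_smul P.aug.top u c
  · exact map_smul P.aug.top (p : R.top) c
  · exact map_smul P.aug.bot (R.res u) c
  · exact map_smul P.aug.bot (R.res (p : R.top)) c

variable {hst : Function.Injective (pairHom u M).top}
  {hsb : Function.Injective (pairHom u M).bot} {q : Hom (M.prod M) M''} {hq : q.Surjective}
  {h : (pairHom u M).Exact q}

variable (P hst hsb q hq h) in
/-- The resolution of `M''` given by a short exact sequence `0 ⟶ M ⟶ M ⊕ M ⟶ M'' ⟶ 0` with first
map `(u, p)`. -/
def pairCone : ProjectiveResolution M'' :=
  P.cone (P.prod P) (fun n => pairHom u (P.X n)) (pairHom_comm u P) (pairHom u M)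
    (pairHom_aug u P) hst hsb q hq h

/-- The component u c vanishes modulo the ideal. Thus the copy of P containing `a` splits off, and
`c`, `b` form the cone of multiplication by p. -/
theorem mem_cycles_pairCone_top {n : ℕ} {c : (P.X n).top} {a b : (P.X (n + 1)).top} :
    ((c, (a, b)) : (P.X n).top × ((P.X (n + 1)).top × (P.X (n + 1)).top)) ∈
        ((P.pairCone hst hsb q hq h).cycles x u (n + 1)).top ↔
      c ∈ (P.cycles x u n).top ∧ a ∈ (P.cycles x u (n + 1)).top ∧
        (p : R.top) • c + (P.d n).top b ∈ (idealSmul x u (P.X n)).top := by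
  refine mem_cycles_cone_top.trans (and_congr Iff.rfl ?_)
  refine Iff.trans (mem_idealSmul_prod_top (m := u • c + (P.d n).top a)
    (n := (p : R.top) • c + (P.d n).top b)) (and_congr ?_ Iff.rfl)
  exact add_mem_cancel_left (snd_smul_mem_top c)

theorem mem_cycles_pairCone_bot {n : ℕ} {c : (P.X n).bot} {a b : (P.X (n + 1)).bot} :
    ((c, (a, b)) : (P.X n).bot × ((P.X (n + 1)).bot × (P.X (n + 1)).bot)) ∈
        ((P.pairCone hst hsb q hq h).cycles x u (n + 1)).bot ↔
      c ∈ (P.cycles x u n).bot ∧ a ∈ (P.cycles x u (n + 1)).bot ∧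
        R.res (p : R.top) • c + (P.d n).bot b ∈ (idealSmul x u (P.X n)).bot := by
  refine mem_cycles_cone_bot.trans (and_congr Iff.rfl ?_)
  refine Iff.trans (mem_idealSmul_prod_bot (m := R.res u • c + (P.d n).bot a)
    (n := R.res (p : R.top) • c + (P.d n).bot b)) (and_congr ?_ Iff.rfl)
  exact add_mem_cancel_left (snd_smul_mem_bot c)

theorem mem_boundaries_pairCone_top {n : ℕ} {c : (P.X n).top} {a b : (P.X (n + 1)).top} :
    ((c, (a, b)) : (P.X n).top × ((P.X (n + 1)).top × (P.X (n + 1)).top)) ∈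
        (rangeModulo x u ((P.pairCone hst hsb q hq h).d (n + 1))).top ↔
      ∃ c' b', c + (P.d n).top c' ∈ (idealSmul x u (P.X n)).top ∧
        a ∈ (rangeModulo x u (P.d (n + 1))).top ∧
        b - ((p : R.top) • c' + (P.d (n + 1)).top b') ∈ (idealSmul x u (P.X (n + 1))).top := by
  refine mem_boundaries_cone_top.trans ⟨?_, ?_⟩
  · rintro ⟨c', ⟨a', b'⟩, hc, hab⟩
    obtain ⟨ha, hb⟩ := mem_idealSmul_prod_top.1 hab
    exact ⟨c', b', hc, mem_rangeModulo_top.2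
      ⟨a', (AddSubgroup.sub_add_mem_iff _ (snd_smul_mem_top c')).1 ha⟩, hb⟩
  · rintro ⟨c', b', hc, ha, hb⟩
    obtain ⟨a', ha⟩ := mem_rangeModulo_top.1 ha
    exact ⟨c', (a', b'), hc, mem_idealSmul_prod_top.2
      ⟨(AddSubgroup.sub_add_mem_iff _ (snd_smul_mem_top c')).2 ha, hb⟩⟩

theorem mem_boundaries_pairCone_bot {n : ℕ} {c : (P.X n).bot} {a b : (P.X (n + 1)).bot} :
    ((c, (a, b)) : (P.X n).bot × ((P.X (n + 1)).bot × (P.X (n + 1)).bot)) ∈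
        (rangeModulo x u ((P.pairCone hst hsb q hq h).d (n + 1))).bot ↔
      ∃ c' b', c + (P.d n).bot c' ∈ (idealSmul x u (P.X n)).bot ∧
        a ∈ (rangeModulo x u (P.d (n + 1))).bot ∧
        b - (R.res (p : R.top) • c' + (P.d (n + 1)).bot b') ∈
          (idealSmul x u (P.X (n + 1))).bot := by
  refine mem_boundaries_cone_bot.trans ⟨?_, ?_⟩
  · rintro ⟨c', ⟨a', b'⟩, hc, hab⟩
    obtain ⟨ha, hb⟩ := mem_idealSmul_prod_bot.1 hab
    exact ⟨c', b', hc, mem_rangeModulo_bot.2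
      ⟨a', (AddSubgroup.sub_add_mem_iff _ (snd_smul_mem_bot c')).1 ha⟩, hb⟩
  · rintro ⟨c', b', hc, ha, hb⟩
    obtain ⟨a', ha⟩ := mem_rangeModulo_bot.1 ha
    exact ⟨c', (a', b'), hc, mem_idealSmul_prod_bot.2
      ⟨(AddSubgroup.sub_add_mem_iff _ (snd_smul_mem_bot c')).2 ha, hb⟩⟩

/-- A cycle of the cone whose first component is a boundary is a boundary if the next homology
vanishes. -/
theorem pairCone_vanishing_top {n : ℕ}
    (h1 : ∀ z ∈ (P.cycles x u (n + 1)).top, z ∈ (rangeModulo x u (P.d (n + 1))).top)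
    (h0 : ∀ z ∈ (P.cycles x u n).top, (p : R.top) • z ∈ (rangeModulo x u (P.d n)).top →
      z ∈ (rangeModulo x u (P.d n)).top) :
    ∀ z ∈ ((P.pairCone hst hsb q hq h).cycles x u (n + 1)).top,
      z ∈ (rangeModulo x u ((P.pairCone hst hsb q hq h).d (n + 1))).top := by
  rintro ⟨c, ⟨a, b⟩⟩ hz
  obtain ⟨hc, ha, hb⟩ := mem_cycles_pairCone_top.1 hz
  obtain ⟨c', hc'⟩ := mem_boundaries_iff_add_top.2 (h0 c hc (mem_boundaries_iff_add_top.1 ⟨b, hb⟩))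
  -- Once c is, up to sign, the boundary of c', subtracting p c' from b removes the contribution of
  -- c and leaves a cycle of P.
  have hb' : b - (p : R.top) • c' ∈ (P.cycles x u (n + 1)).top := by
    change (P.d n).top (b - (p : R.top) • c') ∈ (idealSmul x u (P.X n)).top
    have := sub_mem hb (smul_mem_idealSmul_top (p : R.top) hc')
    rw [map_sub, map_smul]
    rwa [smul_add, add_sub_add_left_eq_sub] at this
  obtain ⟨b', hb'⟩ := mem_rangeModulo_top.1 (h1 _ hb')
  exact mem_boundaries_pairCone_top.2 ⟨c', b', hc', h1 _ ha, by rwa [← sub_sub]⟩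

/-- The injectivity of p assumed at the fixed level is replaced by outright vanishing, which is what
holds at the free level in the applications. -/
theorem pairCone_vanishing_bot {n : ℕ}
    (h1 : ∀ z ∈ (P.cycles x u (n + 1)).bot, z ∈ (rangeModulo x u (P.d (n + 1))).bot)
    (h0 : ∀ z ∈ (P.cycles x u n).bot, z ∈ (rangeModulo x u (P.d n)).bot) :
    ∀ z ∈ ((P.pairCone hst hsb q hq h).cycles x u (n + 1)).bot,
      z ∈ (rangeModulo x u ((P.pairCone hst hsb q hq h).d (n + 1))).bot := by
  rintro ⟨c, ⟨a, b⟩⟩ hz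
  obtain ⟨hc, ha, hb⟩ := mem_cycles_pairCone_bot.1 hz
  obtain ⟨c', hc'⟩ := mem_boundaries_iff_add_bot.2 (h0 c hc)
  have hb' : b - R.res (p : R.top) • c' ∈ (P.cycles x u (n + 1)).bot := by
    change (P.d n).bot (b - R.res (p : R.top) • c') ∈ (idealSmul x u (P.X n)).bot
    have := sub_mem hb (((P.X n).homothety (p : R.top)).map_idealSmul_bot hc')
    rw [homothety_bot] at this
    rw [map_sub, map_smul]
    rwa [smul_add, add_sub_add_left_eq_sub] at this
  obtain ⟨b', hb'⟩ := mem_rangeModulo_bot.1 (h1 _ hb')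
  exact mem_boundaries_pairCone_bot.2 ⟨c', b', hc', h1 _ ha, by rwa [← sub_sub]⟩

end PrimeCone

end ProjectiveResolution

end GreenModule

/-! ### The cone of (u, p) on elementary abelian homology -/

namespace GreenModule.ProjectiveResolution

open MackeyFunctor

variable {p : ℕ} [Fact p.Prime] {R : GreenFunctor p} {x u : R.top} {M M'' : GreenModule R}
  {P : ProjectiveResolution M}

theorem isElementary_smul_mem {k n : ℕ} (h : (P.homologyModulo x u n).IsElementary k)
    {z : (P.X n).top} (hz : z ∈ (P.cycles x u n).top) :
    (p : R.top) • z ∈ (rangeModulo x u (P.d n)).top := by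
  have h1 := h.smul_eq_zero ((subquotMk _ _).top ⟨z, hz⟩)
  have h2 := (subquotMk_top_eq_zero _).1 ((map_nsmul (subquotMk _ _).top p _).trans h1)
  rw [Nat.cast_smul_eq_nsmul]
  exact h2

theorem isElementary_bot_mem {k n : ℕ} (h : (P.homologyModulo x u n).IsElementary k)
    {z : (P.X n).bot} (hz : z ∈ (P.cycles x u n).bot) : z ∈ (rangeModulo x u (P.d n)).bot :=
  (subquotMk_bot_eq_zero ⟨z, hz⟩).1 (h.bot_eq_zero _)

variable {hst : Function.Injective (pairHom u M).top}
  {hsb : Function.Injective (pairHom u M).bot} {q : Hom (M.prod M) M''} {hq : q.Surjective}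
  {h : (pairHom u M).Exact q}

/-- Multiplication by p on the cone of p is null-homotopic, the homotopy being the component `b`.
The split component `a` is handled by the hypothesis that p kills the homology of P in degree n + 1.
-/
theorem smul_mem_boundaries_pairCone {n l : ℕ}
    (h1 : (P.homologyModulo x u (n + 1)).IsElementary l) :
    ∀ z ∈ ((P.pairCone hst hsb q hq h).cycles x u (n + 1)).top,
      (p : R.top) • z ∈ (rangeModulo x u ((P.pairCone hst hsb q hq h).d (n + 1))).top := by
  rintro ⟨c, ⟨a, b⟩⟩ hz
  obtain ⟨hc, ha, hb⟩ := mem_cycles_pairCone_top.1 hz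
  refine (mem_boundaries_pairCone_top (c := (p : R.top) • c) (a := (p : R.top) • a)
    (b := (p : R.top) • b)).2 ⟨b, 0, hb, isElementary_smul_mem h1 ha, ?_⟩
  rw [map_zero, add_zero, sub_self]
  exact zero_mem _

/-- The homology of the cone of `(u, p)` if multiplication by `p` vanishes on homology. -/
theorem isElementary_pairCone {n k l : ℕ} (h0 : (P.homologyModulo x u n).IsElementary k)
    (h1 : (P.homologyModulo x u (n + 1)).IsElementary l) :
    ((P.pairCone hst hsb q hq h).homologyModulo x u (n + 1)).IsElementary (2 * l + k) := by
  set C := P.pairCone hst hsb q hq h with hC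
  -- The long exact sequence of the cone: the maps u and p induce zero on homology in degrees n and
  -- n + 1, leaving H_n(P) as the quotient by two copies of H_{n+1}(P).
  have hcard : Nat.card (C.homologyModulo x u (n + 1)).top =
      Nat.card ((P.homologyModulo x u (n + 1)).top × (P.homologyModulo x u (n + 1)).top) *
        Nat.card (P.homologyModulo x u n).top := by
    let ι₁ : Hom (P.X (n + 1)) (C.X (n + 1)) := (Hom.zero (P.X (n + 1)) (P.X n)).prod
      ((Hom.id (P.X (n + 1))).prod (Hom.zero (P.X (n + 1)) (P.X (n + 1))))
    let ι₂ : Hom (P.X (n + 1)) (C.X (n + 1)) := (Hom.zero (P.X (n + 1)) (P.X n)).prod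
      ((Hom.zero (P.X (n + 1)) (P.X (n + 1))).prod (Hom.id (P.X (n + 1))))
    let ρ : Hom (C.X (n + 1)) (P.X n) := Hom.fst (P.X n) ((P.X (n + 1)).prod (P.X (n + 1)))
    have zd : ∀ i, (p : R.top) • (0 : (P.X n).top) + (P.d n).top i = (P.d n).top i := fun i => by
      rw [smul_zero, zero_add]
    have zd' : ∀ i, R.res (p : R.top) • (0 : (P.X n).bot) + (P.d n).bot i = (P.d n).bot i :=
      fun i => by rw [smul_zero, zero_add]
    have Zt : ∀ a b : (P.X (n + 1)).top, a ∈ (P.cycles x u (n + 1)).top →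
        b ∈ (P.cycles x u (n + 1)).top → ((0, (a, b)) :
          (P.X n).top × ((P.X (n + 1)).top × (P.X (n + 1)).top)) ∈ (C.cycles x u (n + 1)).top :=
      fun a b ha hb => mem_cycles_pairCone_top.2 ⟨zero_mem _, ha, (zd b).symm ▸ hb⟩
    have Zb : ∀ a b : (P.X (n + 1)).bot, a ∈ (P.cycles x u (n + 1)).bot →
        b ∈ (P.cycles x u (n + 1)).bot → ((0, (a, b)) :
          (P.X n).bot × ((P.X (n + 1)).bot × (P.X (n + 1)).bot)) ∈ (C.cycles x u (n + 1)).bot :=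
      fun a b ha hb => mem_cycles_pairCone_bot.2 ⟨zero_mem _, ha, (zd' b).symm ▸ hb⟩
    have Bt : ∀ a b : (P.X (n + 1)).top, a ∈ (rangeModulo x u (P.d (n + 1))).top →
        b ∈ (rangeModulo x u (P.d (n + 1))).top → ((0, (a, b)) :
          (P.X n).top × ((P.X (n + 1)).top × (P.X (n + 1)).top)) ∈
            (rangeModulo x u (C.d (n + 1))).top := fun a b ha hb => by
      obtain ⟨b', hb'⟩ := mem_rangeModulo_top.1 hb
      refine mem_boundaries_pairCone_top.2 ⟨0, b', ?_, ha, ?_⟩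
      · rw [map_zero, add_zero]; exact zero_mem _
      · rwa [smul_zero, zero_add]
    have Bb : ∀ a b : (P.X (n + 1)).bot, a ∈ (rangeModulo x u (P.d (n + 1))).bot →
        b ∈ (rangeModulo x u (P.d (n + 1))).bot → ((0, (a, b)) :
          (P.X n).bot × ((P.X (n + 1)).bot × (P.X (n + 1)).bot)) ∈
            (rangeModulo x u (C.d (n + 1))).bot := fun a b ha hb => by
      obtain ⟨b', hb'⟩ := mem_rangeModulo_bot.1 hb
      refine mem_boundaries_pairCone_bot.2 ⟨0, b', ?_, ha, ?_⟩
      · rw [map_zero, add_zero]; exact zero_mem _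
      · rwa [smul_zero, zero_add]
    let j₁ : MackeyFunctor.Hom (P.homologyModulo x u (n + 1)) (C.homologyModulo x u (n + 1)) :=
      ι₁.toMackey.subquotMap (fun z hz => Zt z 0 hz (zero_mem _))
        (fun z hz => Zb z 0 hz (zero_mem _)) (fun z hz => Bt z 0 hz (zero_mem _))
        fun z hz => Bb z 0 hz (zero_mem _)
    let j₂ : MackeyFunctor.Hom (P.homologyModulo x u (n + 1)) (C.homologyModulo x u (n + 1)) :=
      ι₂.toMackey.subquotMap (fun z hz => Zt 0 z (zero_mem _) hz)
        (fun z hz => Zb 0 z (zero_mem _) hz) (fun z hz => Bt 0 z (zero_mem _) hz)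
        fun z hz => Bb 0 z (zero_mem _) hz
    let r : MackeyFunctor.Hom (C.homologyModulo x u (n + 1)) (P.homologyModulo x u n) :=
      ρ.toMackey.subquotMap (fun z hz => (mem_cycles_pairCone_top.1 hz).1)
        (fun z hz => (mem_cycles_pairCone_bot.1 hz).1)
        (fun z hz => by
          obtain ⟨c', _, hc, _⟩ := mem_boundaries_pairCone_top.1 hz
          exact mem_boundaries_iff_add_top.1 ⟨c', hc⟩)
        fun z hz => by
          obtain ⟨c', _, hc, _⟩ := mem_boundaries_pairCone_bot.1 hz
          exact mem_boundaries_iff_add_bot.1 ⟨c', hc⟩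
    have hj : ∀ a b : (P.cycles x u (n + 1)).top,
        (j₁.top.coprod j₂.top) ((subquotMk _ _).top a, (subquotMk _ _).top b) =
          (subquotMk _ _).top ⟨(0, (a.1, b.1)), Zt a.1 b.1 a.2 b.2⟩ := fun a b => by
      refine (map_add (subquotMk (C.cycles x u (n + 1)) (rangeModulo x u (C.d (n + 1)))).top
        ⟨(0, (a.1, 0)), Zt a.1 0 a.2 (zero_mem _)⟩
        ⟨(0, (0, b.1)), Zt 0 b.1 (zero_mem _) b.2⟩).symm.trans ?_
      refine congrArg _ (Subtype.ext (Prod.ext (add_zero 0) (Prod.ext (add_zero a.1)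
        (zero_add b.1))))
    refine Nat.card_eq_mul_of_exact (j₁.top.coprod j₂.top) r.top ?_ ?_ ?_
    · refine (injective_iff_map_eq_zero _).2 ?_
      rintro ⟨a, b⟩ hab
      obtain ⟨a, rfl⟩ := subquotMk_top_surjective _ _ a
      obtain ⟨b, rfl⟩ := subquotMk_top_surjective _ _ b
      have hab := (hj a b).symm.trans hab
      obtain ⟨c', b', hc', ha', hb'⟩ :=
        mem_boundaries_pairCone_top.1 ((subquotMk_top_eq_zero _).1 hab)
      rw [zero_add] at hc'
      -- Injectivity: a bounding chain with zero first component in the boundary has c' a cycle, so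
      -- p c' is itself a boundary and can be absorbed.
      obtain ⟨e, he⟩ := mem_rangeModulo_top.1 (isElementary_smul_mem h1 (z := c') hc')
      refine Prod.ext ((subquotMk_top_eq_zero _).2 ha')
        ((subquotMk_top_eq_zero _).2 (mem_rangeModulo_top.2 ⟨e + b', ?_⟩))
      have := add_mem hb' he
      rw [map_add]
      convert this using 1
      abel
    · intro c
      obtain ⟨c, rfl⟩ := subquotMk_top_surjective _ _ c
      -- Surjectivity: since p kills the class of c, a chain b bounds p c up to sign and completes c
      -- to a cycle of the cone.
      obtain ⟨b, hb⟩ := mem_boundaries_iff_add_top.2 (isElementary_smul_mem h0 c.2)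
      exact ⟨(subquotMk _ _).top ⟨(c.1, (0, b)), mem_cycles_pairCone_top.2
        ⟨c.2, zero_mem _, hb⟩⟩, rfl⟩
    · intro z
      obtain ⟨⟨⟨c, ⟨a, b⟩⟩, hz⟩, rfl⟩ := subquotMk_top_surjective _ _ z
      obtain ⟨hc, ha, hb⟩ := mem_cycles_pairCone_top.1 hz
      constructor
      · intro hr
        obtain ⟨c', hc'⟩ := mem_boundaries_iff_add_top.2 ((subquotMk_top_eq_zero ⟨c, hc⟩).1 hr)
        have hb' : b - (p : R.top) • c' ∈ (P.cycles x u (n + 1)).top := by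
          change (P.d n).top (b - (p : R.top) • c') ∈ (idealSmul x u (P.X n)).top
          have := sub_mem hb (smul_mem_idealSmul_top (p : R.top) hc')
          rw [map_sub, map_smul]
          rwa [smul_add, add_sub_add_left_eq_sub] at this
        refine ⟨((subquotMk _ _).top ⟨a, ha⟩, (subquotMk _ _).top ⟨_, hb'⟩), (hj _ _).trans ?_⟩
        refine sub_eq_zero.1 ((map_sub _ _ _).symm.trans ((subquotMk_top_eq_zero _).2 ?_))
        refine (mem_boundaries_pairCone_top (c := 0 - c) (a := a - a)
          (b := b - (p : R.top) • c' - b)).2 ⟨-c', 0, ?_, ?_, ?_⟩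
        · rw [map_neg, zero_sub, ← neg_add]
          exact neg_mem hc'
        · rw [sub_self]; exact zero_mem _
        · rw [map_zero, add_zero, smul_neg, sub_neg_eq_add, sub_sub_cancel_left, neg_add_cancel]
          exact zero_mem _
      · rintro ⟨⟨a', b'⟩, hab⟩
        obtain ⟨a', rfl⟩ := subquotMk_top_surjective _ _ a'
        obtain ⟨b', rfl⟩ := subquotMk_top_surjective _ _ b'
        refine (congrArg r.top (hab.symm.trans (hj a' b'))).trans ?_
        exact map_zero (subquotMk (P.cycles x u n) (rangeModulo x u (P.d n))).top
  refine ⟨fun y => ?_, fun y => ?_, ?_⟩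
  · obtain ⟨z, rfl⟩ := subquotMk_bot_surjective _ _ y
    exact (subquotMk_bot_eq_zero z).2 (pairCone_vanishing_bot
      (fun _ => isElementary_bot_mem h1) (fun _ => isElementary_bot_mem h0) z.1 z.2)
  · obtain ⟨z, rfl⟩ := subquotMk_top_surjective _ _ y
    refine (map_nsmul (subquotMk _ _).top p _).symm.trans ((subquotMk_top_eq_zero _).2 ?_)
    have := smul_mem_boundaries_pairCone (hst := hst) (hsb := hsb) (hq := hq) (h := h) h1 z.1 z.2
    rw [Nat.cast_smul_eq_nsmul] at this
    exact this
  · rw [hcard, Nat.card_prod, h0.card_top, h1.card_top]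
    ring

end GreenModule.ProjectiveResolution

/-! ### Functions on a cyclic group -/

section CyclicFunctions

variable (p : ℕ) [Fact p.Prime]

/-- The standard generator of `C_p`. -/
def Cp.gen : Cp p := Multiplicative.ofAdd 1

theorem Cp.eq_gen_pow (k : Cp p) : k = Cp.gen p ^ (Multiplicative.toAdd k).val := by
  apply Multiplicative.toAdd.injective
  simp [Cp.gen, toAdd_pow]

variable {p}

theorem Cp.sub_mem_of_shift {B : Type} [AddCommGroup B] (I : AddSubgroup B) (f : Cp p → B)
    (h : ∀ k, f (k * Cp.gen p) - f k ∈ I) (k : Cp p) : f k - f 1 ∈ I := by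
  have key : ∀ n : ℕ, f (Cp.gen p ^ n) - f 1 ∈ I := by
    intro n
    induction n with
    | zero => simp
    | succ n ih => simpa [pow_succ] using I.add_mem (h (Cp.gen p ^ n)) ih
  rw [Cp.eq_gen_pow p k]
  exact key _

/-- Partial sums along the powers of the generator form a discrete antiderivative, and vanishing of
the total sum is what lets it close up around the cycle. -/
theorem Cp.exists_shift_sub {B : Type} [AddCommGroup B] (f : Cp p → B) (hf : ∑ k, f k = 0) :
    ∃ h : Cp p → B, ∀ k, h (k * Cp.gen p) - h k = f k := by
  have hp : p ≠ 0 := (Fact.out : p.Prime).ne_zero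
  have h1p : 1 < p := (Fact.out : p.Prime).one_lt
  have hsum : ∑ j ∈ Finset.range p, f (Cp.gen p ^ j) = 0 := by
    rw [← hf]
    refine Finset.sum_nbij (fun j => Cp.gen p ^ j) (fun _ _ => Finset.mem_univ _) ?_ ?_
      fun _ _ => rfl
    · intro a ha b hb hab
      have h := congrArg (fun z => (Multiplicative.toAdd z).val) hab
      simpa [Cp.gen, toAdd_pow, ZMod.val_natCast_of_lt (Finset.mem_range.1 ha),
        ZMod.val_natCast_of_lt (Finset.mem_range.1 hb)] using h
    · intro k _
      exact ⟨_, Finset.mem_coe.2 (Finset.mem_range.2 (ZMod.val_lt _)), (Cp.eq_gen_pow p k).symm⟩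
  refine ⟨fun k => ∑ j ∈ Finset.range (Multiplicative.toAdd k).val, f (Cp.gen p ^ j), fun k => ?_⟩
  have hk := Cp.eq_gen_pow p k
  set n := (Multiplicative.toAdd k).val with hn
  have hnp : n < p := ZMod.val_lt _
  rcases Nat.lt_or_ge (n + 1) p with h | h
  · have : (Multiplicative.toAdd (k * Cp.gen p)).val = n + 1 := by
      rw [hk, ← pow_succ]
      simp only [Cp.gen, toAdd_pow, toAdd_ofAdd, nsmul_eq_mul, mul_one]
      exact ZMod.val_natCast_of_lt h
    beta_reduce
    rw [this, Finset.sum_range_succ, add_sub_cancel_left, ← hk]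
  -- The wrap-around: at the last exponent the next partial sum is empty, and the complete sum
  -- supplies the required identity.
  · have hnp' : n + 1 = p := by omega
    have : (Multiplicative.toAdd (k * Cp.gen p)).val = 0 := by
      rw [hk, ← pow_succ, hnp']
      simp [Cp.gen, toAdd_pow]
    beta_reduce
    rw [this, Finset.sum_range_zero, zero_sub, neg_eq_iff_add_eq_zero]
    rw [show Finset.range p = Finset.range (n + 1) by rw [hnp'], Finset.sum_range_succ,
      ← hk] at hsum
    exact hsum

end CyclicFunctions

/-! ### The Burnside ring -/

namespace BurnsideRing

variable (p : ℕ)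

/-- The ring homomorphism `ℤ[t]/(t² - pt) → ℤ` with `t ↦ 0`. -/
noncomputable def constPart : BurnsideRing p →+* ℤ :=
  AdjoinRoot.lift (RingHom.id ℤ) 0 (by simp)

theorem constPart_t : constPart p (t p) = 0 := by
  simp [constPart]

theorem exists_eq (a : BurnsideRing p) : ∃ m l : ℤ, a = m + l * t p := by
  induction a using AdjoinRoot.induction_on with
  | ih f =>
    induction f using Polynomial.induction_on' with
    | add f g hf hg =>
      obtain ⟨m, l, h⟩ := hf
      obtain ⟨m', l', h'⟩ := hg
      exact ⟨m + m', l + l', by rw [map_add, h, h']; push_cast; ring⟩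
    | monomial n a =>
      rw [← Polynomial.C_mul_X_pow_eq_monomial]
      simp only [map_mul, map_pow, AdjoinRoot.mk_X, AdjoinRoot.mk_C]
      cases n with
      | zero => exact ⟨a, 0, by simp⟩
      | succ n =>
        refine ⟨0, a * res p (t p ^ n), ?_⟩
        have h := mul_t p ((a : BurnsideRing p) * t p ^ n)
        rw [mul_assoc, ← pow_succ, map_mul, map_intCast] at h
        simpa using h

theorem eq_mul_t {a : BurnsideRing p} (h : constPart p a = 0) : ∃ l : ℤ, a = l * t p := by
  obtain ⟨m, l, rfl⟩ := exists_eq p a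
  rw [map_add, map_mul, constPart_t, mul_zero, add_zero, map_intCast] at h
  exact ⟨l, by rw [show m = 0 from h]; simp⟩

/-- Under t ↦ 0 the factor t - p becomes -p, which is nonzero in ℤ. -/
theorem constPart_eq_zero_of_mul [Fact p.Prime] {a : BurnsideRing p}
    (h : (t p - p) * a = 0) : constPart p a = 0 := by
  have h' := congrArg (constPart p) h
  rw [map_mul, map_sub, constPart_t, map_natCast, map_zero, zero_sub] at h'
  have hp : p ≠ 0 := (Fact.out : p.Prime).ne_zero
  simpa [hp] using h'

theorem intCast_mul_t_eq_zero [Fact p.Prime] {l : ℤ} (h : (l : BurnsideRing p) * t p = 0) :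
    l = 0 := by
  have h' := congrArg (res p) h
  rw [map_mul, res_t, map_intCast, map_zero] at h'
  have hp : p ≠ 0 := (Fact.out : p.Prime).ne_zero
  simpa [hp] using h'

end BurnsideRing

/-! ### Finiteness of `A` and `L`, and the transfer ideal -/

section MackeyA

variable (p : ℕ) [Fact p.Prime]

theorem burnside_sub_eq_top (S : MackeyFunctor.Sub (burnside p).toMackey)
    (h : (1 : BurnsideRing p) ∈ S.top) : S.top = ⊤ ∧ S.bot = ⊤ := by
  have h1 : (1 : ℤ) ∈ S.bot := by
    have h1 : BurnsideRing.res p 1 ∈ S.bot := S.res_mem _ h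
    rwa [map_one] at h1
  have hb : ∀ m : ℤ, m ∈ S.bot := fun m => by
    have := S.bot.zsmul_mem h1 m
    have e : m • (1 : ℤ) = m := by simp
    exact e ▸ this
  refine ⟨(AddSubgroup.eq_top_iff' _).2 fun (a : BurnsideRing p) => ?_,
    (AddSubgroup.eq_top_iff' _).2 hb⟩
  obtain ⟨m, l, rfl⟩ := BurnsideRing.exists_eq p a
  refine S.top.add_mem ?_ (S.tr_mem l (hb l))
  have := S.top.zsmul_mem h m
  have e : m • (1 : BurnsideRing p) = m := by simp
  exact e ▸ this

theorem burnside_isFinitelyGenerated : (burnside p).toMackey.IsFinitelyGenerated :=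
  ⟨{(1 : BurnsideRing p)}, ∅, Set.finite_singleton _, Set.finite_empty,
    MackeyFunctor.Generates.of_forall fun S h _ => burnside_sub_eq_top p S (h rfl)⟩

theorem mem_span_res_one_bot (y : ℤ) :
    y ∈ ((burnside p).toMackey.span ∅ {(burnside p).res 1}).bot := by
  refine AddSubgroup.mem_iInf.2 fun ⟨S, hS⟩ => ?_
  have h1 : BurnsideRing.res p 1 ∈ S.bot := hS.2 rfl
  rw [map_one] at h1
  have := S.bot.zsmul_mem h1 y
  have e : y • (1 : ℤ) = y := by simp
  exact e ▸ this

/-- The generated subfunctor is ℤ at the free level and ℤt above it. Hence L is ℤ at the fixed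
level, detected by the constant coefficient, and zero at the free level. -/
theorem mem_span_res_one_top (a : BurnsideRing p) :
    a ∈ ((burnside p).toMackey.span ∅ {(burnside p).res 1}).top ↔
      BurnsideRing.constPart p a = 0 := by
  constructor
  · intro h
    let S : MackeyFunctor.Sub (burnside p).toMackey :=
      { top := (BurnsideRing.constPart p).toAddMonoidHom.ker
        bot := ⊤
        res_mem := fun _ _ => trivial
        tr_mem := fun (y : ℤ) _ => by
          change BurnsideRing.constPart p (y * BurnsideRing.t p) = 0
          rw [map_mul, BurnsideRing.constPart_t, mul_zero]
        smul_mem := fun _ _ _ => trivial }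
    have h' : a ∈ S.top := AddSubgroup.mem_iInf.1 h ⟨S, Set.empty_subset _, fun _ _ => trivial⟩
    exact h'
  · intro h
    obtain ⟨l, rfl⟩ := BurnsideRing.eq_mul_t p h
    exact ((burnside p).toMackey.span ∅ {(burnside p).res 1}).tr_mem (l : ℤ)
      (mem_span_res_one_bot p l)

/-- The projection `A ⟶ L`. -/
noncomputable def toMackeyL : MackeyFunctor.Hom (burnside p).toMackey (mackeyL p) where
  top := QuotientAddGroup.mk' _
  bot := QuotientAddGroup.mk' _
  map_res := fun _ => rfl
  map_tr := fun _ => rfl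
  map_smul := fun _ _ => rfl

theorem toMackeyL_top_surjective : Function.Surjective (toMackeyL p).top :=
  QuotientAddGroup.mk'_surjective _

theorem toMackeyL_bot_surjective : Function.Surjective (toMackeyL p).bot :=
  QuotientAddGroup.mk'_surjective _

theorem toMackeyL_top_eq_zero (a : BurnsideRing p) :
    (toMackeyL p).top a = 0 ↔ BurnsideRing.constPart p a = 0 :=
  (QuotientAddGroup.eq_zero_iff (N := ((burnside p).toMackey.span ∅ {(burnside p).res 1}).top)
    a).trans (mem_span_res_one_top p a)

theorem toMackeyL_bot_eq_zero (a : ℤ) : (toMackeyL p).bot a = 0 :=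
  (QuotientAddGroup.eq_zero_iff (N := ((burnside p).toMackey.span ∅ {(burnside p).res 1}).bot)
    a).2 (mem_span_res_one_bot p a)

theorem mackeyL_isFinitelyGenerated : (mackeyL p).IsFinitelyGenerated :=
  (burnside_isFinitelyGenerated p).of_surjective (toMackeyL p) (toMackeyL_top_surjective p)
    (toMackeyL_bot_surjective p)

end MackeyA

/-! ### The modules in the resolution -/

/-- The properties of the free Tambara functor on a fixed generator `x` that enter the
computation; `u` is the difference of the norm of `res x` and `x ^ p`. -/
structure IsPolynomialBurnside {p : ℕ} [Fact p.Prime] {R : GreenFunctor p} (x u : R.top)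
    (ε : GreenFunctor.Hom R (burnside p).toGreenFunctor) : Prop where
  smul_eq : ∀ (g : Cp p) (b : R.bot), g • b = b
  res_snd : R.res u = 0
  natCast_regular : ∀ b : R.bot, (p : R.bot) * b = 0 → b = 0
  res_surjective : Function.Surjective R.res
  annihilator_snd : ∀ a, u * a = 0 → ∃ b, R.tr b = a
  ker_res : ∀ a, R.res a = 0 → ∃ c d, (R.tr 1 - p) * c + u * d = a
  syzygy : ∀ a b, (R.tr 1 - p) * a + u * b = 0 →
    ∃ c b₁ b₂, u * c + R.tr b₁ = a ∧ p * c + R.tr b₂ = b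
  fst_regular : ∀ a b, x * a = u * b → ∃ c, u * c = a
  res_fst_regular : ∀ b, R.res x * b = 0 → b = 0
  map_fst : ε.top x = 0
  map_snd : ε.top u = 0
  ker_top : ∀ a, ε.top a = 0 → ∃ c d, a = x * c + u * d
  ker_bot : ∀ b, ε.bot b = 0 → ∃ c, b = R.res x * c

namespace GreenModule

variable {p : ℕ} [Fact p.Prime] (R : GreenFunctor p) [R.IsTrivialAction]

open GreenFunctor.IsTrivialAction

/-- The module with both levels `R(C_p/e)`, in which the transfer is the identity. -/
def dualConst : GreenModule R where
  top := R.bot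
  bot := R.bot
  res := AddMonoidHom.mulLeft (p : R.bot)
  tr := AddMonoidHom.id R.bot
  smul_res := fun g x => smul_eq g _
  tr_smul := fun g x => smul_eq g x
  res_tr := fun y => by
    rw [Finset.sum_congr rfl fun g _ => smul_eq g y]
    simp [Cp]
  topModule := Module.compHom R.bot R.res
  botModule := inferInstanceAs (Module R.bot R.bot)
  res_smul := fun a (m : R.bot) => mul_left_comm (p : R.bot) (R.res a) m
  act_smul := fun g b m => smul_mul' g b m
  tr_res_smul := fun a m => rfl
  tr_smul_res := fun b (m : R.bot) => by
    change b * (p * m) = R.res (R.tr b) * m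
    rw [R.res_tr_eq]
    ring

/-- The inclusion of the subfunctor of `R` generated by `1` at the free level. -/
def trIncl : Hom (dualConst R) (self R) where
  top :=
    { toFun := R.tr
      map_add' := R.tr.map_add
      map_smul' := fun a (b : R.bot) => R.tr_res_mul a b }
  bot := LinearMap.id
  map_res := fun (b : R.bot) => (R.res_tr_eq b).symm
  map_tr := fun _ => rfl
  map_act := fun _ _ => rfl

/-- The surjection from the free module on a generator at the free level. -/
def indAug : Hom (ind R) (dualConst R) where
  top := LinearMap.id
  bot :=
    { toFun := fun (f : Cp p → R.bot) => ∑ k, f k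
      map_add' := fun (f g : Cp p → R.bot) => Finset.sum_add_distrib
      map_smul' := fun b (f : Cp p → R.bot) => (Finset.mul_sum Finset.univ f b).symm }
  map_res := fun (b : R.bot) => by
    change ∑ k : Cp p, b = p * b
    simp [Cp]
  map_tr := fun _ => rfl
  map_act := fun g (f : Cp p → R.bot) =>
    (Equiv.sum_comp (Equiv.mulLeft g⁻¹) f).trans (smul_eq g _).symm

/-- The endomorphism `γ - 1` of the free module on a generator at the free level. -/
def indShift : Hom (ind R) (ind R) where
  top := 0
  bot :=
    { toFun := fun (f : Cp p → R.bot) => (fun k => f (k * Cp.gen p) - f k : Cp p → R.bot)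
      map_add' := fun (f g : Cp p → R.bot) => funext fun k =>
        add_sub_add_comm (f (k * Cp.gen p)) (g (k * Cp.gen p)) (f k) (g k)
      map_smul' := fun b (f : Cp p → R.bot) => funext fun k =>
        (mul_sub b (f (k * Cp.gen p)) (f k)).symm }
  map_res := fun (b : R.bot) => funext fun k => sub_self b
  map_tr := fun (f : Cp p → R.bot) => by
    change (0 : R.bot) = ∑ k, (f (k * Cp.gen p) - f k)
    rw [Finset.sum_sub_distrib, eq_comm, sub_eq_zero]
    exact Equiv.sum_comp (Equiv.mulRight (Cp.gen p)) f
  map_act := fun g (f : Cp p → R.bot) => funext fun k => by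
    change f (g⁻¹ * (k * Cp.gen p)) - f (g⁻¹ * k) = f (g⁻¹ * k * Cp.gen p) - f (g⁻¹ * k)
    rw [mul_assoc]

/-- The morphism from `R` to the free module on a generator at the free level which is the
restriction at the fixed level. -/
def indConst : Hom (self R) (ind R) where
  top :=
    { toFun := R.res
      map_add' := R.res.map_add
      map_smul' := fun a (b : R.top) => map_mul R.res a b }
  bot :=
    { toFun := fun (b : R.bot) => (fun _ => b : Cp p → R.bot)
      map_add' := fun _ _ => rfl
      map_smul' := fun _ _ => rfl }
  map_res := fun _ => rfl
  map_tr := fun (b : R.bot) => by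
    change R.res (R.tr b) = ∑ k : Cp p, b
    rw [R.res_tr_eq]
    simp [Cp]
  map_act := fun g (b : R.bot) => funext fun k => smul_eq g b

variable {R}

theorem indAug_surjective : (indAug R).Surjective := by
  refine ⟨fun x => ⟨x, rfl⟩, fun (y : R.bot) => ⟨(Pi.single 1 y : Cp p → R.bot), ?_⟩⟩
  change ∑ k, (Pi.single 1 y : Cp p → R.bot) k = y
  simp

/-- At the free level this is the start of the periodic resolution for a cyclic group: functions
with sum zero are differences of shifts. At the fixed level the two maps are zero and the identity.
-/
theorem indShift_exact : (indShift R).Exact (indAug R) := by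
  constructor
  · intro (x : R.bot)
    exact ⟨fun h => ⟨0, h.symm⟩, by rintro ⟨_, h⟩; exact h.symm⟩
  · intro (f : Cp p → R.bot)
    constructor
    · intro hf
      obtain ⟨h, hh⟩ := Cp.exists_shift_sub f hf
      exact ⟨h, funext hh⟩
    · rintro ⟨h, hh⟩
      have := (indShift R).map_tr h
      exact (congrArg (indAug R).bot hh.symm).trans this.symm

/-- Shift-invariant functions are constant. At the fixed level the shift is zero, so exactness there
is precisely surjectivity of restriction. -/
theorem indConst_exact (h : Function.Surjective R.res) : (indConst R).Exact (indShift R) := by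
  constructor
  · intro (x : R.bot)
    exact ⟨fun _ => h x, fun _ => rfl⟩
  · intro (f : Cp p → R.bot)
    constructor
    · intro hf
      refine ⟨f 1, funext fun k => ?_⟩
      have h0 : ∀ k, f (k * Cp.gen p) - f k ∈ (⊥ : AddSubgroup R.bot) := fun k =>
        AddSubgroup.mem_bot.2 (congrFun hf k)
      exact (sub_eq_zero.1 (AddSubgroup.mem_bot.1 (Cp.sub_mem_of_shift ⊥ f h0 k))).symm
    · rintro ⟨b, rfl⟩
      exact funext fun k => sub_self _

end GreenModule

namespace GreenModule

theorem Hom.Exact.kerLift {p : ℕ} [Fact p.Prime] {R : GreenFunctor p} {L M N P : GreenModule R}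
    {i : Hom L M} {k : Hom M N} {f : Hom N P} (h : i.Exact k) (ht : ∀ x, f.top (k.top x) = 0)
    (hb : ∀ x, f.bot (k.bot x) = 0) : i.Exact (GreenModule.kerLift f k ht hb) :=
  ⟨fun x => Iff.trans ⟨fun h => congrArg Subtype.val h, fun h => Subtype.ext h⟩ (h.1 x),
    fun x => Iff.trans ⟨fun h => congrArg Subtype.val h, fun h => Subtype.ext h⟩ (h.2 x)⟩

end GreenModule

/-! ### The augmentation and reduction modulo (x, u) -/

namespace IsPolynomialBurnside

open GreenModule GreenModule.ProjectiveResolution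

variable {p : ℕ} [Fact p.Prime] {R : GreenFunctor p} {x u : R.top}
  {ε : GreenFunctor.Hom R (burnside p).toGreenFunctor}

/-- The map `R(C_p/C_p) → ℤ[t]/(t² - pt)`. -/
noncomputable def augTop (ε : GreenFunctor.Hom R (burnside p).toGreenFunctor) :
    R.top →+* BurnsideRing p := ε.top

/-- The map `R(C_p/e) → ℤ`. -/
noncomputable def augBot (ε : GreenFunctor.Hom R (burnside p).toGreenFunctor) : R.bot →+* ℤ :=
  ε.bot

/-- The coefficient of `1` in `ε a`. -/
noncomputable def constCoeff (ε : GreenFunctor.Hom R (burnside p).toGreenFunctor) : R.top →+* ℤ :=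
  (BurnsideRing.constPart p).comp (augTop ε)

theorem augTop_tr (b : R.bot) : augTop ε (R.tr b) = (augBot ε b : ℤ) * BurnsideRing.t p :=
  GreenFunctor.Hom.map_tr ε b

theorem augBot_res (a : R.top) : augBot ε (R.res a) = BurnsideRing.res p (augTop ε a) :=
  GreenFunctor.Hom.map_res ε a

theorem constCoeff_of_augTop {a : R.top} (h : augTop ε a = 0) : constCoeff ε a = 0 :=
  (congrArg (BurnsideRing.constPart p) h).trans (map_zero _)

theorem constCoeff_tr (b : R.bot) : constCoeff ε (R.tr b) = 0 := by
  change BurnsideRing.constPart p (augTop ε (R.tr b)) = 0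
  rw [augTop_tr, map_mul, BurnsideRing.constPart_t, mul_zero]

/-- A Burnside element without constant term is an integral multiple of t, and that integer, viewed
in R(C_p/e), has the right transfer. -/
theorem exists_tr (a : R.top) (h : constCoeff ε a = 0) : ∃ b, augTop ε (a - R.tr b) = 0 := by
  obtain ⟨l, hl⟩ := BurnsideRing.eq_mul_t p h
  refine ⟨(l : R.bot), ?_⟩
  rw [map_sub, hl, augTop_tr, map_intCast, Int.cast_id, sub_self]

section Ideal

variable (hR : IsPolynomialBurnside x u ε)
include hR

theorem augTop_fst : augTop ε x = 0 := hR.map_fst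

theorem augTop_snd : augTop ε u = 0 := hR.map_snd

theorem augBot_res_fst : augBot ε (R.res x) = 0 := by
  rw [augBot_res, hR.augTop_fst, map_zero]

theorem mem_idealSmul_self_top (a : R.top) :
    a ∈ (idealSmul x u (self R)).top ↔ augTop ε a = 0 := by
  refine mem_idealSmul_top.trans ⟨?_, ?_⟩
  · rintro ⟨(c : R.top), (d : R.top), rfl⟩
    change augTop ε (x * c + u * d) = 0
    rw [map_add, map_mul, map_mul, hR.augTop_fst, hR.augTop_snd, zero_mul, zero_mul, add_zero]
  · intro h
    obtain ⟨c, d, h⟩ := hR.ker_top a h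
    exact ⟨c, d, h.symm⟩

/-- Because u restricts to zero, the ideal at the free level is generated by the restriction of x
alone. This underlies the descriptions for all the modules whose levels are copies of R(C_p/e). -/
theorem exists_res_snd_iff (b : R.bot) :
    (∃ c d, R.res x * c + R.res u * d = b) ↔ augBot ε b = 0 := by
  constructor
  · rintro ⟨c, d, rfl⟩
    rw [hR.res_snd, zero_mul, add_zero, map_mul, hR.augBot_res_fst, zero_mul]
  · intro h
    obtain ⟨c, h⟩ := hR.ker_bot b h
    exact ⟨c, 0, by rw [h, mul_zero, add_zero]⟩

theorem mem_idealSmul_self_bot (b : R.bot) :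
    b ∈ (idealSmul x u (self R)).bot ↔ augBot ε b = 0 :=
  mem_idealSmul_bot.trans (hR.exists_res_snd_iff b)

variable [R.IsTrivialAction]

theorem mem_idealSmul_dualConst_top (b : R.bot) :
    b ∈ (idealSmul x u (dualConst R)).top ↔ augBot ε b = 0 :=
  mem_idealSmul_top.trans (hR.exists_res_snd_iff b)

theorem mem_idealSmul_dualConst_bot (b : R.bot) :
    b ∈ (idealSmul x u (dualConst R)).bot ↔ augBot ε b = 0 :=
  mem_idealSmul_bot.trans (hR.exists_res_snd_iff b)

theorem mem_idealSmul_ind_top (b : R.bot) :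
    b ∈ (idealSmul x u (ind R)).top ↔ augBot ε b = 0 :=
  mem_idealSmul_top.trans (hR.exists_res_snd_iff b)

theorem exists_of_mem_idealSmul_ind_bot (f : (ind R).bot)
    (hf : f ∈ (idealSmul x u (ind R)).bot) :
    ∃ c : Cp p → R.bot, (f : Cp p → R.bot) = fun k => R.res x * c k := by
  obtain ⟨c, d, rfl⟩ := mem_idealSmul_bot.1 hf
  refine ⟨c, funext fun k => ?_⟩
  change R.res x * (c : Cp p → R.bot) k + R.res u * (d : Cp p → R.bot) k = _
  rw [hR.res_snd, zero_mul, add_zero]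

end Ideal

/-! ### The cokernel of the transfer -/

section TransferCokernel

variable [R.IsTrivialAction] (hR : IsPolynomialBurnside x u ε)
include hR

/-- Restriction after transfer is multiplication by p, which is regular on the free level. -/
theorem tr_injective : Function.Injective R.tr := by
  refine (injective_iff_map_eq_zero _).2 fun b h => hR.natCast_regular b ?_
  rw [← R.res_tr_eq, h, map_zero]

theorem trIncl_top_injective : Function.Injective (trIncl R).top := hR.tr_injective

omit hR in
theorem trIncl_bot_injective : Function.Injective (trIncl R).bot := Function.injective_id

/-- The transfer of A is injective too, so a transfer that dies in A comes from a free-level element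
that dies there. This feeds `Acyclic.splice`, for R modulo transfers and for the ideal of u. -/
theorem trIncl_reflects_top (b : R.bot)
    (h : (trIncl R).top b ∈ (idealSmul x u (self R)).top) :
    b ∈ (idealSmul x u (dualConst R)).top := by
  refine (hR.mem_idealSmul_dualConst_top b).2 (BurnsideRing.intCast_mul_t_eq_zero p ?_)
  rw [← augTop_tr]
  exact (hR.mem_idealSmul_self_top _).1 h

theorem trIncl_reflects_bot (b : R.bot)
    (h : (trIncl R).bot b ∈ (idealSmul x u (self R)).bot) :
    b ∈ (idealSmul x u (dualConst R)).bot :=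
  (hR.mem_idealSmul_dualConst_bot b).2 ((hR.mem_idealSmul_self_bot _).1 h)

/-- This shows that H_0 of R modulo transfers is ℤ at the fixed level, detected by the constant
coefficient. It is torsion-free, unlike the higher homology. -/
theorem mem_rangeModulo_trIncl_top (a : R.top) :
    a ∈ (rangeModulo x u (trIncl R)).top ↔ constCoeff ε a = 0 := by
  refine mem_rangeModulo_top.trans ⟨?_, ?_⟩
  · rintro ⟨(b : R.bot), hb⟩
    have h1 : constCoeff ε (a - R.tr b) = 0 :=
      constCoeff_of_augTop ((hR.mem_idealSmul_self_top _).1 hb)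
    rwa [map_sub, constCoeff_tr, sub_zero] at h1
  · intro h
    obtain ⟨b, hb⟩ := exists_tr a h
    exact ⟨b, (hR.mem_idealSmul_self_top _).2 hb⟩

omit hR in
theorem mem_rangeModulo_trIncl_bot (b : R.bot) :
    b ∈ (rangeModulo x u (trIncl R)).bot :=
  map_mem_rangeModulo_bot (trIncl R) b

/-- The resolution of `R / tr` obtained from a resolution of the image of the transfer. -/
noncomputable def transferCokernelResolution (Q : ProjectiveResolution (dualConst R)) :
    ProjectiveResolution (coker (trIncl R)) :=
  Q.splice (trIncl R) self_isProjective hR.trIncl_top_injective trIncl_bot_injective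
    (cokerMk (trIncl R)) (cokerMk_surjective _) (cokerMk_exact _)

theorem transferCokernelResolution_acyclic (Q : ProjectiveResolution (dualConst R)) :
    (hR.transferCokernelResolution Q).Acyclic x u 1 :=
  ProjectiveResolution.Acyclic.splice hR.trIncl_reflects_top hR.trIncl_reflects_bot

theorem mem_boundaries_transferCokernel_top (Q : ProjectiveResolution (dualConst R))
    (a : R.top) :
    a ∈ (rangeModulo x u ((hR.transferCokernelResolution Q).d 0)).top ↔ constCoeff ε a = 0 :=
  (mem_rangeModulo_splice_top (Q := Q) (hP := self_isProjective) (hit := hR.trIncl_top_injective)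
    (hib := trIncl_bot_injective) (hq := cokerMk_surjective _) (h := cokerMk_exact _) a).trans (hR.mem_rangeModulo_trIncl_top a)

theorem mem_boundaries_transferCokernel_bot (Q : ProjectiveResolution (dualConst R))
    (b : R.bot) :
    b ∈ (rangeModulo x u ((hR.transferCokernelResolution Q).d 0)).bot :=
  (mem_rangeModulo_splice_bot (Q := Q) (hP := self_isProjective) (hit := hR.trIncl_top_injective)
    (hib := trIncl_bot_injective) (hq := cokerMk_surjective _) (h := cokerMk_exact _) b).2 (mem_rangeModulo_trIncl_bot b)

omit hR in
theorem transferCokernel_bot_eq_zero (m : (coker (trIncl R)).bot) : m = 0 := by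
  obtain ⟨b, rfl⟩ := (cokerMk_surjective (trIncl R)).2 m
  exact ((cokerMk_exact (trIncl R)).2 b).2 ⟨b, rfl⟩

/-- The component u alone is injective. If u c is a transfer, then since u restricts to zero and p
is regular, it is the transfer of zero; so u annihilates c, which is then a transfer. -/
theorem pairHom_transferCokernel_top_injective :
    Function.Injective (pairHom u (coker (trIncl R))).top := by
  refine (injective_iff_map_eq_zero _).2 fun m h => ?_
  obtain ⟨(c : R.top), rfl⟩ := (cokerMk_surjective (trIncl R)).1 m
  have h1 : u • (cokerMk (trIncl R)).top c = 0 := congrArg Prod.fst h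
  replace h1 := (map_smul (cokerMk (trIncl R)).top u c).trans h1
  obtain ⟨(b : R.bot), hb⟩ := ((cokerMk_exact (trIncl R)).1 _).1 h1
  have hb' : R.tr b = u * c := hb
  have h2 : b = 0 := hR.natCast_regular b (by
    rw [← R.res_tr_eq, hb', map_mul, hR.res_snd, zero_mul])
  rw [h2, map_zero] at hb'
  obtain ⟨b', hb'⟩ := hR.annihilator_snd c hb'.symm
  exact ((cokerMk_exact (trIncl R)).1 _).2 ⟨b', hb'⟩

omit hR in
theorem pairHom_transferCokernel_bot_injective :
    Function.Injective (pairHom u (coker (trIncl R))).bot := fun a b _ =>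
  (transferCokernel_bot_eq_zero a).trans (transferCokernel_bot_eq_zero b).symm

omit [R.IsTrivialAction] hR in
theorem mul_tr_eq_zero {w : R.top} (hw : R.res w = 0) (b : R.bot) : w * R.tr b = 0 := by
  rw [← R.tr_res_mul, hw, zero_mul, map_zero]

omit hR in
theorem res_tr_one_sub : R.res (R.tr 1 - (p : R.top)) = 0 := by
  rw [map_sub, R.res_tr_eq, map_natCast, mul_one, sub_self]

omit hR in
/-- Multiplication by an element with trivial restriction, as a morphism from `R / tr` to the
kernel of restriction. -/
def mulKer (w : R.top) (hw : R.res w = 0) : Hom (coker (trIncl R)) (ker (indConst R)) :=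
  cokerDesc (trIncl R) (kerLift (indConst R) ((self R).homothety w)
      (fun (a : R.top) => by
        change R.res (w * a) = 0
        rw [map_mul, hw, zero_mul])
      fun (b : R.bot) => by
        change (fun _ => R.res w * b : Cp p → R.bot) = fun _ => 0
        rw [hw, zero_mul])
    (fun b => Subtype.ext (mul_tr_eq_zero hw b))
    fun (b : R.bot) => Subtype.ext (by
      change R.res w * b = 0
      rw [hw, zero_mul])

/-- The presentation of the kernel of restriction. -/
def resKernelHom : Hom ((coker (trIncl R)).prod (coker (trIncl R))) (ker (indConst R)) :=
  (mulKer (R.tr 1 - (p : R.top)) res_tr_one_sub).coprod (mulKer u hR.res_snd)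

omit hR in
theorem ker_indConst_bot_eq_zero (b : (ker (indConst R)).bot) : b = 0 :=
  Subtype.ext (congrFun b.2 1)

theorem resKernelHom_surjective : hR.resKernelHom.Surjective := by
  constructor
  · rintro ⟨a, ha⟩
    obtain ⟨c, d, h⟩ := hR.ker_res a ha
    exact ⟨((cokerMk (trIncl R)).top c, (cokerMk (trIncl R)).top d), Subtype.ext h⟩
  · exact fun b => ⟨0, (ker_indConst_bot_eq_zero _).trans (ker_indConst_bot_eq_zero _).symm⟩

/-- The relation u(t - p) + pu = 0 holds because u annihilates transfers, and the field `syzygy`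
says that modulo transfers every relation is a multiple of it. At the free level all modules
involved are zero. -/
theorem pairHom_exact_resKernelHom : (pairHom u (coker (trIncl R))).Exact hR.resKernelHom := by
  constructor
  · rintro ⟨a, b⟩
    obtain ⟨a, rfl⟩ := (cokerMk_surjective (trIncl R)).1 a
    obtain ⟨b, rfl⟩ := (cokerMk_surjective (trIncl R)).1 b
    constructor
    · intro h
      obtain ⟨c, b₁, b₂, h1, h2⟩ := hR.syzygy a b (congrArg Subtype.val h)
      refine ⟨(cokerMk (trIncl R)).top c, Prod.ext ?_ ?_⟩
      · change u • (cokerMk (trIncl R)).top c = (cokerMk (trIncl R)).top a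
        refine (map_smul (cokerMk (trIncl R)).top u c).symm.trans (sub_eq_zero.1 ?_).symm
        refine (map_sub (cokerMk (trIncl R)).top _ _).symm.trans ?_
        exact ((cokerMk_exact (trIncl R)).1 _).2 ⟨b₁, eq_sub_of_add_eq' h1⟩
      · change (p : R.top) • (cokerMk (trIncl R)).top c = (cokerMk (trIncl R)).top b
        refine (map_smul (cokerMk (trIncl R)).top (p : R.top) c).symm.trans (sub_eq_zero.1 ?_).symm
        refine (map_sub (cokerMk (trIncl R)).top _ _).symm.trans ?_
        exact ((cokerMk_exact (trIncl R)).1 _).2 ⟨b₂, eq_sub_of_add_eq' h2⟩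
    · rintro ⟨m, hm⟩
      obtain ⟨(c : R.top), rfl⟩ := (cokerMk_surjective (trIncl R)).1 m
      rw [← hm]
      refine Subtype.ext ?_
      change (R.tr 1 - p) * (u * c) + u * (p * c) = 0
      have h0 : u * R.tr 1 = 0 := mul_tr_eq_zero hR.res_snd 1
      linear_combination c * h0
  · exact fun b => ⟨fun _ => ⟨0, Prod.ext ((transferCokernel_bot_eq_zero _).trans
      (transferCokernel_bot_eq_zero _).symm) ((transferCokernel_bot_eq_zero _).trans
      (transferCokernel_bot_eq_zero _).symm)⟩, fun _ => ker_indConst_bot_eq_zero _⟩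

/-- The resolution of the kernel of restriction. -/
noncomputable def resKernelResolution (Q : ProjectiveResolution (dualConst R)) :
    ProjectiveResolution (ker (indConst R)) :=
  (hR.transferCokernelResolution Q).pairCone hR.pairHom_transferCokernel_top_injective
    pairHom_transferCokernel_bot_injective hR.resKernelHom hR.resKernelHom_surjective
    hR.pairHom_exact_resKernelHom

end TransferCokernel

end IsPolynomialBurnside

/-- The ranks of the homology in positive degrees of the image of the transfer. -/
def transferBetti : ℕ → ℕ
  | 0 => 0
  | 1 => 0
  | 2 => 1
  | 3 => 0
  | 4 => 0
  | n + 5 => 2 * transferBetti (n + 1) + transferBetti n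

/-! ### The recursive computation for the transfer ideal -/

namespace IsPolynomialBurnside

open GreenModule GreenModule.ProjectiveResolution MackeyFunctor

variable {p : ℕ} [Fact p.Prime] {R : GreenFunctor p} {x u : R.top}
  {ε : GreenFunctor.Hom R (burnside p).toGreenFunctor}

variable [R.IsTrivialAction] (hR : IsPolynomialBurnside x u ε)

/-- The resolution of the kernel of the shift. -/
noncomputable def shiftKernelResolution (Q : ProjectiveResolution (dualConst R)) :
    ProjectiveResolution (ker (indShift R)) :=
  (hR.resKernelResolution Q).splice (kerIncl (indConst R)) self_isProjective
    Subtype.val_injective Subtype.val_injective _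
    (kerLift_surjective (indConst_exact hR.res_surjective)) ((kerIncl_exact _).kerLift _ _)

/-- The resolution of the kernel of the augmentation. -/
noncomputable def augKernelResolution (Q : ProjectiveResolution (dualConst R)) :
    ProjectiveResolution (ker (indAug R)) :=
  (hR.shiftKernelResolution Q).splice (kerIncl (indShift R)) ind_isProjective
    Subtype.val_injective Subtype.val_injective _
    (kerLift_surjective indShift_exact) ((kerIncl_exact _).kerLift _ _)

/-- The resolution of the image of the transfer obtained from itself. -/
noncomputable def transferResolution (Q : ProjectiveResolution (dualConst R)) :
    ProjectiveResolution (dualConst R) :=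
  (hR.augKernelResolution Q).splice (kerIncl (indAug R)) ind_isProjective
    Subtype.val_injective Subtype.val_injective _ indAug_surjective (kerIncl_exact _)

include hR

/-- The fixed level of the augmentation kernel is zero. At the free level, if a multiple x c of a
function has sum zero then so does c, as the restriction of x is regular; thus the inclusion of the
kernel reflects the ideal. -/
theorem transferResolution_one (Q : ProjectiveResolution (dualConst R)) :
    ((hR.transferResolution Q).homologyModulo x u 1).IsElementary 0 := by
  refine acyclic_iff.1 (Acyclic.splice (fun k _ => ?_) fun ⟨f, hf⟩ h => ?_)
  · have hk : k = 0 := Subtype.ext k.2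
    rw [hk]
    exact zero_mem _
  · obtain ⟨c, rfl⟩ := hR.exists_of_mem_idealSmul_ind_bot f h
    have hc : ∑ k, c k = 0 := hR.res_fst_regular _ ((Finset.mul_sum _ _ _).trans hf)
    exact mem_idealSmul_bot.2 ⟨⟨c, hc⟩, 0, by rw [smul_zero, add_zero]; rfl⟩

/-- At the fixed level the kernel of the shift is everything, and at the free level x can be
cancelled from the condition of invariance. -/
theorem augKernelResolution_one (Q : ProjectiveResolution (dualConst R)) :
    ((hR.augKernelResolution Q).homologyModulo x u 1).IsElementary 0 := by
  refine acyclic_iff.1 (Acyclic.splice (fun ⟨b, hb⟩ h => ?_) fun ⟨f, hf⟩ h => ?_)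
  · obtain ⟨c, hc⟩ := hR.ker_bot b ((hR.mem_idealSmul_ind_top b).1 h)
    exact mem_idealSmul_top.2 ⟨⟨c, rfl⟩, 0, by rw [smul_zero, add_zero]; exact Subtype.ext hc.symm⟩
  · obtain ⟨c, rfl⟩ := hR.exists_of_mem_idealSmul_ind_bot f h
    have hc : (fun k => c (k * Cp.gen p) - c k) = fun _ => 0 := funext fun k =>
      hR.res_fst_regular _ ((mul_sub _ _ _).trans (congrFun hf k))
    exact mem_idealSmul_bot.2 ⟨⟨c, hc⟩, 0, by rw [smul_zero, add_zero]; rfl⟩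

/-- The differential is (a, b) ↦ (t - p)a + ub. In A the second term disappears, and (t - p)
annihilates exactly the multiples of t, since t² = pt. -/
theorem mem_cycles_shiftKernel_top (Q : ProjectiveResolution (dualConst R)) (a b : R.top) :
    ((a, b) : R.top × R.top) ∈ ((hR.shiftKernelResolution Q).cycles x u 1).top ↔
      constCoeff ε a = 0 := by
  refine (hR.mem_idealSmul_self_top ((R.tr 1 - p) * a + u * b)).trans ?_
  have h1 : augTop ε ((R.tr 1 - p) * a + u * b) =
      (BurnsideRing.t p - p) * augTop ε a := by
    rw [map_add, map_mul, map_mul, hR.augTop_snd, zero_mul, add_zero, map_sub, augTop_tr,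
      map_one, Int.cast_one, one_mul, map_natCast]
  rw [h1]
  constructor
  · exact BurnsideRing.constPart_eq_zero_of_mul p
  · intro h
    obtain ⟨l, hl⟩ := BurnsideRing.eq_mul_t p h
    rw [hl]
    linear_combination (l : BurnsideRing p) * BurnsideRing.t_mul_t p

/-- Up to the ideal, boundaries are the pairs (uc + tr a', pc + tr b'): c comes from the relation
(u, p), the transfers from the two resolutions of R modulo transfers. Constant coefficients see only
that of pc in the second entry. -/
theorem mem_boundaries_shiftKernel_top (Q : ProjectiveResolution (dualConst R)) (a b : R.top) :
    ((a, b) : R.top × R.top) ∈ (rangeModulo x u ((hR.shiftKernelResolution Q).d 1)).top ↔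
      constCoeff ε a = 0 ∧ (p : ℤ) ∣ constCoeff ε b := by
  have key : ((a, b) : R.top × R.top) ∈ (rangeModulo x u ((hR.shiftKernelResolution Q).d 1)).top ↔
      ∃ (c : R.top) (a' b' : R.bot), augTop ε (a - (u * c + R.tr a')) = 0 ∧
        augTop ε (b - (p * c + R.tr b')) = 0 := by
    refine mem_rangeModulo_top.trans ⟨?_, ?_⟩
    · rintro ⟨⟨c, ⟨a', b'⟩⟩, h⟩
      obtain ⟨h1, h2⟩ := mem_idealSmul_prod_top.1 h
      exact ⟨c, Q.aug.top a', Q.aug.top b', (hR.mem_idealSmul_self_top _).1 h1,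
        (hR.mem_idealSmul_self_top _).1 h2⟩
    · rintro ⟨c, a', b', h1, h2⟩
      obtain ⟨a', rfl⟩ := Q.aug_surjective.1 a'
      obtain ⟨b', rfl⟩ := Q.aug_surjective.1 b'
      exact ⟨(c, (a', b')), mem_idealSmul_prod_top.2
        ⟨(hR.mem_idealSmul_self_top _).2 h1, (hR.mem_idealSmul_self_top _).2 h2⟩⟩
  rw [key]
  constructor
  · rintro ⟨c, a', b', h1, h2⟩
    replace h1 := constCoeff_of_augTop h1
    replace h2 := constCoeff_of_augTop h2
    have hu : constCoeff ε u = 0 := constCoeff_of_augTop hR.augTop_snd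
    rw [map_sub, map_add, map_mul, hu, constCoeff_tr, zero_mul, add_zero, sub_zero] at h1
    rw [map_sub, map_add, map_mul, constCoeff_tr, map_natCast, add_zero, sub_eq_zero] at h2
    exact ⟨h1, ⟨_, h2⟩⟩
  · rintro ⟨h1, ⟨m, hm⟩⟩
    obtain ⟨a', ha'⟩ := exists_tr a h1
    obtain ⟨b', hb'⟩ := exists_tr (ε := ε) (b - p * (m : R.top)) (by
      rw [map_sub, map_mul, map_natCast, map_intCast, hm, Int.cast_id]
      exact sub_self _)
    refine ⟨m, a', b', ?_, ?_⟩
    · rw [← sub_sub, sub_right_comm, map_sub, ha', map_mul, hR.augTop_snd, zero_mul, sub_zero]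
    · rw [← sub_sub]
      exact hb'

theorem mem_boundaries_shiftKernel_bot (Q : ProjectiveResolution (dualConst R)) (a b : R.bot) :
    ((a, b) : R.bot × R.bot) ∈ (rangeModulo x u ((hR.shiftKernelResolution Q).d 1)).bot := by
  obtain ⟨a', ha⟩ := Q.aug_surjective.2 a
  obtain ⟨b', hb⟩ := Q.aug_surjective.2 b
  have aux : ∀ r c c' : R.bot, c' = c → r * 0 + c' = c := fun r c c' h => by
    rw [mul_zero, zero_add, h]
  have e : ((hR.shiftKernelResolution Q).d 1).bot ((0 : R.bot), (a', b')) = (a, b) :=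
    Prod.ext (aux _ _ _ ha) (aux _ _ _ hb)
  rw [← e]
  exact map_mem_rangeModulo_bot _ _

/-- Here the torsion arises: b is unconstrained as a cycle, while boundaries only reach constant
coefficients divisible by p. The isomorphism with g reduces this coefficient modulo p. -/
theorem shiftKernelResolution_one (Q : ProjectiveResolution (dualConst R)) :
    ((hR.shiftKernelResolution Q).homologyModulo x u 1).IsElementary 1 := by
  let π : MackeyFunctor.Hom ((hR.shiftKernelResolution Q).cycles x u 1).toMackey (g p) :=
    { top := ((Int.castAddHom (ZMod p)).comp ((constCoeff ε).toAddMonoidHom.comp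
        (AddMonoidHom.snd R.top R.top))).comp
          ((hR.shiftKernelResolution Q).cycles x u 1).top.subtype
      bot := 0
      map_res := fun _ => rfl
      map_tr := by
        rintro ⟨⟨(a : R.bot), (b : R.bot)⟩, h⟩
        change ((constCoeff ε (R.tr b) : ℤ) : ZMod p) = 0
        rw [constCoeff_tr, Int.cast_zero]
      map_smul := fun _ _ => rfl }
  refine isElementary_g.of_isIsomorphic (IsIsomorphic.symm (subquot_isIsomorphic π ?_ ?_ ?_ ?_))
  · intro (m : ZMod p)
    obtain ⟨m, rfl⟩ := ZMod.intCast_surjective m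
    refine ⟨⟨((0 : R.top), (m : R.top)),
      (hR.mem_cycles_shiftKernel_top Q 0 m).2 (map_zero _)⟩, ?_⟩
    change ((constCoeff ε (m : R.top) : ℤ) : ZMod p) = m
    rw [map_intCast, Int.cast_id]
  · exact fun _ => ⟨0, rfl⟩
  · rintro ⟨⟨a, b⟩, h⟩
    refine Iff.trans ?_ (hR.mem_boundaries_shiftKernel_top Q a b).symm
    rw [and_iff_right ((hR.mem_cycles_shiftKernel_top Q a b).1 h)]
    exact ZMod.intCast_zmod_eq_zero_iff_dvd _ _
  · rintro ⟨⟨a, b⟩, h⟩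
    exact ⟨fun _ => hR.mem_boundaries_shiftKernel_bot Q a b, fun _ => rfl⟩

/-- In this degree `isElementary_pairCone` does not apply, since H_0 of R modulo transfers is ℤ.
Instead p is injective there and H_1 vanishes, so the cone has no homology. -/
theorem resKernelResolution_one (Q : ProjectiveResolution (dualConst R)) :
    ((hR.resKernelResolution Q).homologyModulo x u 1).IsElementary 0 := by
  have h1 := hR.transferCokernelResolution_acyclic Q
  refine acyclic_iff.1 ⟨pairCone_vanishing_top h1.top fun (z : R.top) _ h => ?_,
    pairCone_vanishing_bot h1.bot fun (z : R.bot) _ =>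
      hR.mem_boundaries_transferCokernel_bot Q z⟩
  refine (hR.mem_boundaries_transferCokernel_top Q z).2 ?_
  have h2 : constCoeff ε ((p : R.top) * z) = 0 :=
    (hR.mem_boundaries_transferCokernel_top Q _).1 h
  rw [map_mul, map_natCast] at h2
  exact (mul_eq_zero.1 h2).resolve_left
    (Int.natCast_ne_zero.2 (Fact.out : p.Prime).ne_zero)

theorem resKernelResolution_isElementary (Q : ProjectiveResolution (dualConst R)) {n k l : ℕ}
    (h0 : ((hR.transferCokernelResolution Q).homologyModulo x u n).IsElementary k)
    (h1 : ((hR.transferCokernelResolution Q).homologyModulo x u (n + 1)).IsElementary l) :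
    ((hR.resKernelResolution Q).homologyModulo x u (n + 1)).IsElementary (2 * l + k) :=
  isElementary_pairCone h0 h1

/-- For any Q, the resolution `transferResolution Q` contains Q in higher degrees, so its homology
is controlled by lower homology of Q. Independence of the resolution then carries the result back to
Q itself, which closes the strong induction. -/
theorem homologyModulo_dualConst (n : ℕ) : ∀ Q : ProjectiveResolution (dualConst R),
    (Q.homologyModulo x u (n + 1)).IsElementary (transferBetti n) := by
  induction n using Nat.strong_induction_on with
  | _ n ih =>
    intro Q
    have e := homologyModulo_isIsomorphic (x := x) (u := u) (hR.transferResolution Q) Q (n + 1)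
    refine IsElementary.of_isIsomorphic ?_ e
    match n with
    | 0 => exact hR.transferResolution_one Q
    | 1 => exact hR.augKernelResolution_one Q
    | 2 => exact hR.shiftKernelResolution_one Q
    | 3 => exact hR.resKernelResolution_one Q
    | 4 =>
      -- The contribution `k` comes from degree one of R modulo transfers, which vanishes by
      -- acyclicity and is not homology of Q; hence this case stands apart from the general
      -- recursion.
      exact hR.resKernelResolution_isElementary Q (k := 0) (l := transferBetti 0)
        (acyclic_iff.1 (hR.transferCokernelResolution_acyclic Q)) (ih 0 (by omega) Q)
    | n + 5 =>
      -- Degrees n + 2 and n + 3 for R modulo transfers are degrees n + 1 and n + 2 for Q, because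
      -- the splice shifts by one.
      exact hR.resKernelResolution_isElementary Q (n := n + 2)
        (ih n (by omega) Q) (ih (n + 1) (by omega) Q)

end IsPolynomialBurnside

/-! ### Growth of the Betti numbers -/

theorem MackeyFunctor.IsElementary.sum_isIsomorphic {p : ℕ} [Fact p.Prime] {M N : MackeyFunctor p}
    (h : N.IsElementary 0) : (M.sum N).IsIsomorphic M := by
  have ht : Subsingleton N.top := (Nat.card_eq_one_iff_unique.1 (h.card_top.trans (pow_zero p))).1
  refine ⟨⟨AddMonoidHom.fst _ _, AddMonoidHom.fst _ _, fun _ => rfl, fun _ => rfl,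
    fun _ _ => rfl⟩, ⟨fun a b hab => Prod.ext hab (ht.elim _ _), fun a => ⟨(a, 0), rfl⟩⟩,
    ⟨fun a b hab => Prod.ext hab ((h.bot_eq_zero _).trans (h.bot_eq_zero _).symm),
      fun a => ⟨(a, 0), rfl⟩⟩⟩

theorem AddSubgroup.mem_of_sub_mem {G : Type} [AddCommGroup G] (J : AddSubgroup G) {a b : G}
    (hb : b ∈ J) (h : a - b ∈ J) : a ∈ J := by
  simpa using J.add_mem h hb

/-- The ranks of the homology in degrees at least `2` of `R / u`. -/
def quotientBetti : ℕ → ℕ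
  | 0 => 0
  | n + 1 => transferBetti n

/-- The ranks of the Tor groups in degrees at least `3`. -/
def torBetti (n : ℕ) : ℕ := quotientBetti n + quotientBetti (n + 1)

theorem torBetti_add_six (n : ℕ) :
    torBetti (n + 6) = 2 * torBetti (n + 2) + torBetti (n + 1) := by
  change (2 * transferBetti (n + 1) + transferBetti n) +
    (2 * transferBetti (n + 2) + transferBetti (n + 1)) =
    2 * (transferBetti (n + 1) + transferBetti (n + 2)) + (transferBetti n + transferBetti (n + 1))
  ring

/-- The value at 9 is still zero, so 10 is the first index from which positivity persists. Four
consecutive positive values suffice, since the coefficient 2 in the recurrence multiplies the value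
four steps earlier. -/
theorem torBetti_pos (n : ℕ) : 1 ≤ torBetti (n + 10) := by
  induction n using Nat.strong_induction_on with
  | _ n ih =>
    match n with
    | 0 => decide
    | 1 => decide
    | 2 => decide
    | 3 => decide
    | n + 4 =>
      have h := torBetti_add_six (n + 8)
      have h' := ih n (by omega)
      rw [show n + 8 + 2 = n + 10 by ring] at h
      rw [show n + 4 + 10 = n + 8 + 6 by ring]
      omega

/-- Dropping the last term of the recurrence leaves at least a doubling every four steps. -/
theorem two_pow_le_torBetti (k n : ℕ) : 2 ^ k ≤ torBetti (n + 10 + 4 * k) := by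
  induction k with
  | zero => exact torBetti_pos n
  | succ k ih =>
    have h := torBetti_add_six (n + 8 + 4 * k)
    rw [show n + 10 + 4 * (k + 1) = n + 8 + 4 * k + 6 by ring, pow_succ]
    rw [show n + 10 + 4 * k = n + 8 + 4 * k + 2 by ring] at ih
    omega

theorem exists_le_torBetti (N : ℕ) : ∃ n₀, ∀ n, n₀ ≤ n → N ≤ torBetti n := by
  refine ⟨10 + 4 * N, fun n hn => ?_⟩
  obtain ⟨m, rfl⟩ := Nat.exists_eq_add_of_le hn
  have h := two_pow_le_torBetti N m
  rw [show 10 + 4 * N + m = m + 10 + 4 * N by ring]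
  exact (Nat.lt_two_pow_self).le.trans h

/-! ### The resolution of A and its Tor functors -/

namespace IsPolynomialBurnside

open GreenModule GreenModule.ProjectiveResolution MackeyFunctor

variable {p : ℕ} [Fact p.Prime] {R : GreenFunctor p} {x u : R.top}
  {ε : GreenFunctor.Hom R (burnside p).toGreenFunctor}

theorem augTop_surjective : Function.Surjective (augTop ε) := fun a => by
  obtain ⟨m, l, rfl⟩ := BurnsideRing.exists_eq p a
  exact ⟨m + R.tr (l : R.bot), by
    rw [map_add, augTop_tr, map_intCast, map_intCast, Int.cast_id]⟩

theorem augBot_surjective : Function.Surjective (augBot ε) := fun m =>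
  ⟨m, by rw [map_intCast, Int.cast_id]⟩

/-- `ε` as a morphism of modules. -/
noncomputable def augHom (ε : GreenFunctor.Hom R (burnside p).toGreenFunctor) :
    GreenModule.Hom (self R) ε.toModule where
  top :=
    { toFun := ε.top
      map_add' := ε.top.map_add
      map_smul' := ε.top.map_mul }
  bot :=
    { toFun := ε.bot
      map_add' := ε.bot.map_add
      map_smul' := ε.bot.map_mul }
  map_res := ε.map_res
  map_tr := ε.map_tr
  map_act := ε.map_smul

theorem augHom_surjective : (augHom ε).Surjective := ⟨augTop_surjective, augBot_surjective⟩

variable (hR : IsPolynomialBurnside x u ε)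
include hR

theorem isCyclicModulo : IsCyclicModulo x u (N := ε.toModule) (1 : BurnsideRing p) where
  top_surjective := fun (s : BurnsideRing p) => by
    obtain ⟨a, rfl⟩ := augTop_surjective (ε := ε) s
    exact ⟨a, mul_one (augTop ε a)⟩
  bot_surjective := fun (s : ℤ) => by
    obtain ⟨b, rfl⟩ := augBot_surjective (ε := ε) s
    refine ⟨b, ?_⟩
    change augBot ε b * BurnsideRing.res p 1 = augBot ε b
    rw [map_one, mul_one]
  smul_fst := by
    change augTop ε x * 1 = 0
    rw [mul_one, hR.augTop_fst]
  smul_snd := by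
    change augTop ε u * 1 = 0
    rw [mul_one, hR.augTop_snd]
  exists_top := fun a h => hR.ker_top a ((mul_one (augTop ε a)).symm.trans h)
  exists_bot := fun b h => by
    obtain ⟨c, hc⟩ := hR.ker_bot b (by
      have h' : augBot ε b * BurnsideRing.res p 1 = 0 := h
      rwa [map_one, mul_one] at h')
    exact ⟨c, 0, by rw [hc, mul_zero, add_zero]⟩

variable [R.IsTrivialAction]

theorem trIncl_exact_homothety : (trIncl R).Exact ((self R).homothety u) := by
  constructor
  · intro (a : R.top)
    exact ⟨hR.annihilator_snd a, by rintro ⟨b, rfl⟩; exact mul_tr_eq_zero hR.res_snd b⟩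
  · intro (b : R.bot)
    refine ⟨fun _ => ⟨b, rfl⟩, fun _ => ?_⟩
    change R.res u * b = 0
    rw [hR.res_snd, zero_mul]

/-- The resolution of the ideal generated by `u`. -/
noncomputable def imageResolution (Q : ProjectiveResolution (dualConst R)) :
    ProjectiveResolution (ker (cokerMk ((self R).homothety u))) :=
  Q.splice (trIncl R) self_isProjective hR.trIncl_top_injective trIncl_bot_injective _
    (kerLift_surjective (cokerMk_exact ((self R).homothety u)))
    (hR.trIncl_exact_homothety.kerLift _ _)

theorem imageResolution_acyclic (Q : ProjectiveResolution (dualConst R)) :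
    (hR.imageResolution Q).Acyclic x u 1 :=
  Acyclic.splice hR.trIncl_reflects_top hR.trIncl_reflects_bot

theorem mem_boundaries_image_top (Q : ProjectiveResolution (dualConst R)) (a : R.top) :
    a ∈ (rangeModulo x u ((hR.imageResolution Q).d 0)).top ↔ constCoeff ε a = 0 :=
  Iff.trans (by unfold imageResolution; exact mem_rangeModulo_splice_top (P₀ := self R) a)
    (hR.mem_rangeModulo_trIncl_top a)

theorem mem_boundaries_image_bot (Q : ProjectiveResolution (dualConst R)) (b : R.bot) :
    b ∈ (rangeModulo x u ((hR.imageResolution Q).d 0)).bot := by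
  unfold imageResolution
  exact (mem_rangeModulo_splice_bot (P₀ := self R) b).2 (mem_rangeModulo_trIncl_bot b)

/-- The resolution of `R / u`. -/
noncomputable def quotientResolution (Q : ProjectiveResolution (dualConst R)) :
    ProjectiveResolution (coker ((self R).homothety u)) :=
  (hR.imageResolution Q).splice (kerIncl (cokerMk ((self R).homothety u)))
      self_isProjective Subtype.val_injective Subtype.val_injective _ (cokerMk_surjective _)
      (kerIncl_exact _)

/-- The boundaries in degree zero are multiples of u up to the ideal, hence nothing new, and the
quotient is R/(x, u) = A. -/
theorem quotientResolution_zero (Q : ProjectiveResolution (dualConst R)) :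
    ((hR.quotientResolution Q).homologyModulo x u 0).IsIsomorphic (burnside p).toMackey := by
  let π : MackeyFunctor.Hom ((hR.quotientResolution Q).cycles x u 0).toMackey
      (burnside p).toMackey :=
    (augHom ε).toMackey.comp
      { top := ((hR.quotientResolution Q).cycles x u 0).top.subtype
        bot := ((hR.quotientResolution Q).cycles x u 0).bot.subtype
        map_res := fun _ => rfl
        map_tr := fun _ => rfl
        map_smul := fun _ _ => rfl }
  refine subquot_isIsomorphic π (fun a => ?_) (fun b => ?_) ?_ ?_
  · obtain ⟨a, rfl⟩ := augTop_surjective (ε := ε) a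
    exact ⟨⟨a, trivial⟩, rfl⟩
  · obtain ⟨b, rfl⟩ := augBot_surjective (ε := ε) b
    exact ⟨⟨b, trivial⟩, rfl⟩
  · rintro ⟨(a : R.top), h⟩
    have e : a ∈ (rangeModulo x u ((hR.quotientResolution Q).d 0)).top ↔
        a ∈ (rangeModulo x u (kerIncl (cokerMk ((self R).homothety u)))).top := by
      unfold quotientResolution
      exact mem_rangeModulo_splice_top (P₀ := self R) a
    refine Iff.trans (hR.mem_idealSmul_self_top a).symm (Iff.trans ?_ e.symm)
    refine ⟨idealSmul_le_rangeModulo_top _, fun ha => ?_⟩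
    obtain ⟨⟨m, hm⟩, h⟩ := mem_rangeModulo_top.1 ha
    obtain ⟨m, rfl⟩ := ((cokerMk_exact _).1 m).1 hm
    exact AddSubgroup.mem_of_sub_mem _ (snd_smul_mem_top m) h
  · rintro ⟨(a : R.bot), h⟩
    have e : a ∈ (rangeModulo x u ((hR.quotientResolution Q).d 0)).bot ↔
        a ∈ (rangeModulo x u (kerIncl (cokerMk ((self R).homothety u)))).bot := by
      unfold quotientResolution
      exact mem_rangeModulo_splice_bot (P₀ := self R) a
    refine Iff.trans (hR.mem_idealSmul_self_bot a).symm (Iff.trans ?_ e.symm)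
    refine ⟨idealSmul_le_rangeModulo_bot _, fun ha => ?_⟩
    obtain ⟨⟨m, hm⟩, h⟩ := mem_rangeModulo_bot.1 ha
    obtain ⟨m, rfl⟩ := ((cokerMk_exact _).2 m).1 hm
    exact AddSubgroup.mem_of_sub_mem _ (snd_smul_mem_bot m) h

/-- The differential out of degree one is multiplication by u, which is zero modulo the ideal, so
all of R consists of cycles. The boundaries are the transfers, and A modulo transfers is L. -/
theorem quotientResolution_one (Q : ProjectiveResolution (dualConst R)) :
    ((hR.quotientResolution Q).homologyModulo x u 1).IsIsomorphic (mackeyL p) := by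
  let π : MackeyFunctor.Hom ((hR.quotientResolution Q).cycles x u 1).toMackey (mackeyL p) :=
    (toMackeyL p).comp ((augHom ε).toMackey.comp
      { top := ((hR.quotientResolution Q).cycles x u 1).top.subtype
        bot := ((hR.quotientResolution Q).cycles x u 1).bot.subtype
        map_res := fun _ => rfl
        map_tr := fun _ => rfl
        map_smul := fun _ _ => rfl })
  refine subquot_isIsomorphic π (fun a => ?_) (fun b => ?_) ?_ ?_
  · obtain ⟨a, rfl⟩ := toMackeyL_top_surjective p a
    obtain ⟨a, rfl⟩ := augTop_surjective (ε := ε) a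
    exact ⟨⟨a, snd_smul_mem_top (M := self R) a⟩, rfl⟩
  · obtain ⟨b, rfl⟩ := toMackeyL_bot_surjective p b
    obtain ⟨b, rfl⟩ := augBot_surjective (ε := ε) b
    exact ⟨⟨b, snd_smul_mem_bot (M := self R) b⟩, rfl⟩
  · rintro ⟨(a : R.top), h⟩
    exact (toMackeyL_top_eq_zero p _).trans (hR.mem_boundaries_image_top Q a).symm
  · rintro ⟨(a : R.bot), h⟩
    exact ⟨fun _ => hR.mem_boundaries_image_bot Q a, fun _ => toMackeyL_bot_eq_zero p _⟩

/-- Degree two vanishes because the transfer ideal embeds modulo (x, u). From degree three on the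
complex is Q shifted by two. -/
theorem quotientResolution_add_two (Q : ProjectiveResolution (dualConst R)) (n : ℕ) :
    ((hR.quotientResolution Q).homologyModulo x u (n + 2)).IsElementary (quotientBetti n) := by
  cases n with
  | zero =>
    have h := acyclic_iff.1 (hR.imageResolution_acyclic Q)
    exact h
  | succ n => exact hR.homologyModulo_dualConst n Q

/-- The projection `R / u ⟶ A`. -/
noncomputable def quotientAug : GreenModule.Hom (coker ((self R).homothety u)) ε.toModule :=
  cokerDesc _ (augHom ε)
    (fun (a : R.top) => by
      change augTop ε (u * a) = 0
      rw [map_mul, hR.augTop_snd, zero_mul])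
    fun (b : R.bot) => by
      change augBot ε (R.res u * b) = 0
      rw [hR.res_snd, zero_mul, map_zero]

theorem quotientAug_surjective : hR.quotientAug.Surjective := by
  constructor
  · intro a
    obtain ⟨a, rfl⟩ := augHom_surjective.1 a
    exact ⟨(cokerMk _).top a, rfl⟩
  · intro a
    obtain ⟨a, rfl⟩ := augHom_surjective.2 a
    exact ⟨(cokerMk _).bot a, rfl⟩

/-- This is regularity of x modulo u, the point that allows A to be resolved by the cone of x on
R/u. -/
theorem homothety_quotient_top_injective :
    Function.Injective ((coker ((self R).homothety u)).homothety x).top := by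
  refine (injective_iff_map_eq_zero _).2 fun m h => ?_
  obtain ⟨a, rfl⟩ := (cokerMk_surjective ((self R).homothety u)).1 m
  have h1 := (map_smul (cokerMk ((self R).homothety u)).top x a).trans h
  obtain ⟨b, hb⟩ := ((cokerMk_exact _).1 _).1 h1
  obtain ⟨c, hc⟩ := hR.fst_regular a b hb.symm
  exact ((cokerMk_exact _).1 _).2 ⟨c, hc⟩

theorem homothety_quotient_bot_injective :
    Function.Injective ((coker ((self R).homothety u)).homothety x).bot := by
  refine (injective_iff_map_eq_zero _).2 fun m h => ?_
  obtain ⟨(a : R.bot), rfl⟩ := (cokerMk_surjective ((self R).homothety u)).2 m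
  have h1 := (map_smul (cokerMk ((self R).homothety u)).bot (R.res x) a).trans h
  obtain ⟨(b : R.bot), hb⟩ := ((cokerMk_exact _).2 _).1 h1
  have hb' : R.res u * b = R.res x * a := hb
  rw [hR.res_snd, zero_mul] at hb'
  have ha : a = 0 := hR.res_fst_regular a hb'.symm
  rw [ha]
  exact map_zero (cokerMk ((self R).homothety u)).bot

theorem homothety_exact_quotientAug :
    ((coker ((self R).homothety u)).homothety x).Exact hR.quotientAug := by
  constructor
  · intro m
    obtain ⟨(a : R.top), rfl⟩ := (cokerMk_surjective ((self R).homothety u)).1 m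
    constructor
    · intro h
      obtain ⟨c, d, hcd⟩ := hR.ker_top a h
      refine ⟨(cokerMk _).top c, (map_smul (cokerMk ((self R).homothety u)).top x c).symm.trans
        (sub_eq_zero.1 ((map_sub (cokerMk ((self R).homothety u)).top _ _).symm.trans
          (((cokerMk_exact _).1 _).2 ⟨-d, ?_⟩)))⟩
      change u * -d = x * c - a
      rw [hcd]
      ring
    · rintro ⟨m, hm⟩
      obtain ⟨(c : R.top), rfl⟩ := (cokerMk_surjective ((self R).homothety u)).1 m
      rw [← hm]
      change augTop ε (x * c) = 0
      rw [map_mul, hR.augTop_fst, zero_mul]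
  · intro m
    obtain ⟨(a : R.bot), rfl⟩ := (cokerMk_surjective ((self R).homothety u)).2 m
    constructor
    · intro h
      obtain ⟨c, hc⟩ := hR.ker_bot a h
      exact ⟨(cokerMk _).bot c, congrArg (cokerMk ((self R).homothety u)).bot hc.symm⟩
    · rintro ⟨m, hm⟩
      obtain ⟨(c : R.bot), rfl⟩ := (cokerMk_surjective ((self R).homothety u)).2 m
      rw [← hm]
      change augBot ε (R.res x * c) = 0
      rw [map_mul, hR.augBot_res_fst, zero_mul]

/-- The resolution of `A`. -/
noncomputable def augResolution (Q : ProjectiveResolution (dualConst R)) :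
    ProjectiveResolution ε.toModule :=
  (hR.quotientResolution Q).cone (hR.quotientResolution Q) (fun n => homothety _ x)
    (fun n => Hom.ext (LinearMap.ext fun c => map_smul ((hR.quotientResolution Q).d n).top x c)
      (LinearMap.ext fun c => map_smul ((hR.quotientResolution Q).d n).bot (R.res x) c))
    ((coker ((self R).homothety u)).homothety x)
    (Hom.ext (LinearMap.ext fun c => map_smul (hR.quotientResolution Q).aug.top x c)
      (LinearMap.ext fun c => map_smul (hR.quotientResolution Q).aug.bot (R.res x) c))
    hR.homothety_quotient_top_injective hR.homothety_quotient_bot_injective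
    hR.quotientAug hR.quotientAug_surjective hR.homothety_exact_quotientAug

theorem augResolution_zero (Q : ProjectiveResolution (dualConst R)) :
    ((hR.augResolution Q).homologyModulo x u 0).IsIsomorphic
      ((hR.quotientResolution Q).homologyModulo x u 0) :=
  homologyModulo_cone_zero (fun _ c => fst_smul_mem_top c) fun _ c => fst_smul_mem_bot c

theorem augResolution_succ (Q : ProjectiveResolution (dualConst R)) (n : ℕ) :
    ((hR.augResolution Q).homologyModulo x u (n + 1)).IsIsomorphic
      (((hR.quotientResolution Q).homologyModulo x u n).sum
        ((hR.quotientResolution Q).homologyModulo x u (n + 1))) :=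
  homologyModulo_cone_succ (fun _ c => fst_smul_mem_top c) (fun _ c => fst_smul_mem_bot c) n

variable (P : ProjectiveResolution ε.toModule)

theorem tor_isIsomorphic_homologyModulo (Q : ProjectiveResolution (dualConst R)) (i : ℕ) :
    (P.tor ε.toModule i).IsIsomorphic ((hR.augResolution Q).homologyModulo x u i) :=
  (hR.isCyclicModulo.tor_isIsomorphic P i).trans (homologyModulo_isIsomorphic _ _ i)

theorem tor_zero : (P.tor ε.toModule 0).IsIsomorphic (burnside p).toMackey :=
  let Q := ProjectiveResolution.standard (dualConst R)
  ((hR.tor_isIsomorphic_homologyModulo P Q 0).trans (hR.augResolution_zero Q)).trans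
    (hR.quotientResolution_zero Q)

theorem tor_one : (P.tor ε.toModule 1).IsIsomorphic ((burnside p).toMackey.sum (mackeyL p)) :=
  let Q := ProjectiveResolution.standard (dualConst R)
  ((hR.tor_isIsomorphic_homologyModulo P Q 1).trans (hR.augResolution_succ Q 0)).trans
    ((hR.quotientResolution_zero Q).sum (hR.quotientResolution_one Q))

theorem tor_two : (P.tor ε.toModule 2).IsIsomorphic (mackeyL p) :=
  let Q := ProjectiveResolution.standard (dualConst R)
  ((hR.tor_isIsomorphic_homologyModulo P Q 2).trans (hR.augResolution_succ Q 1)).trans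
    ((hR.quotientResolution_add_two Q 0).sum_isIsomorphic.trans (hR.quotientResolution_one Q))

theorem tor_add_three (n : ℕ) : (P.tor ε.toModule (n + 3)).IsElementary (torBetti n) :=
  let Q := ProjectiveResolution.standard (dualConst R)
  ((hR.quotientResolution_add_two Q n).sum (hR.quotientResolution_add_two Q (n + 1))).of_isIsomorphic
    ((hR.tor_isIsomorphic_homologyModulo P Q (n + 3)).trans
      (hR.augResolution_succ Q (n + 2))).symm

theorem tor_isFinitelyGenerated : ∀ i, (P.tor ε.toModule i).IsFinitelyGenerated
  | 0 => (burnside_isFinitelyGenerated p).of_isIsomorphic (hR.tor_zero P).symm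
  | 1 => ((burnside_isFinitelyGenerated p).sum (mackeyL_isFinitelyGenerated p)).of_isIsomorphic
      (hR.tor_one P).symm
  | 2 => (mackeyL_isFinitelyGenerated p).of_isIsomorphic (hR.tor_two P).symm
  | n + 3 => (hR.tor_add_three P n).isFinitelyGenerated

theorem exists_le_rank_tor (N : ℕ) :
    ∃ i₀, ∀ i, i₀ ≤ i → (N : ℕ∞) ≤ (P.tor ε.toModule i).rank := by
  obtain ⟨n₀, h⟩ := exists_le_torBetti N
  refine ⟨n₀ + 3, fun i hi => ?_⟩
  obtain ⟨m, rfl⟩ := Nat.exists_eq_add_of_le hi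
  rw [show n₀ + 3 + m = (n₀ + m) + 3 by ring]
  exact le_trans (Nat.cast_le.2 (h _ (Nat.le_add_right _ _))) (hR.tor_add_three P _).le_rank

/-- From index 3 on all Tor functors are elementary, so the isomorphism follows from equality of
exponents. For i ≥ 9 the lowest index involved is at least 4. -/
theorem tor_recurrence (i : ℕ) (hi : 9 ≤ i) : (P.tor ε.toModule i).IsIsomorphic
    (((P.tor ε.toModule (i - 4)).sum (P.tor ε.toModule (i - 4))).sum
      (P.tor ε.toModule (i - 5))) := by
  obtain ⟨n, rfl⟩ := Nat.exists_eq_add_of_le hi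
  rw [show 9 + n - 4 = n + 2 + 3 by omega, show 9 + n - 5 = n + 1 + 3 by omega,
    show 9 + n = n + 6 + 3 by omega]
  refine (hR.tor_add_three P (n + 6)).isIsomorphic ?_
  have h := ((hR.tor_add_three P (n + 2)).sum (hR.tor_add_three P (n + 2))).sum
    (hR.tor_add_three P (n + 1))
  rwa [← two_mul, ← torBetti_add_six] at h

end IsPolynomialBurnside

/-! ### Norms and ring homomorphisms -/

section ProperPart

variable {p : ℕ} [Fact p.Prime]

/-- The orbit size divides p. It is not 1, because a translation-invariant nonempty subset would be
the whole group. -/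
theorem card_orbit_properPart (S : ProperPart p) : Nat.card (MulAction.orbit (Cp p) S) = p := by
  have hcard : Nat.card (Cp p) = p := by simp [Cp]
  have hmul := MulAction.index_stabilizer (Cp p) S
  rw [← Nat.card_coe_set_eq] at hmul
  have hdvd : (MulAction.stabilizer (Cp p) S).index ∣ p := by
    conv_rhs => rw [← hcard]
    exact Subgroup.index_dvd_card _
  rcases (Nat.dvd_prime (Fact.out : p.Prime)).1 hdvd with h | h
  · exfalso
    rw [Subgroup.index_eq_one] at h
    obtain ⟨x, hx⟩ := Finset.nonempty_iff_ne_empty.2 S.2.1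
    refine S.2.2 (Finset.eq_univ_iff_forall.2 fun y => ?_)
    have hy : y * x⁻¹ ∈ MulAction.stabilizer (Cp p) S := h ▸ Subgroup.mem_top _
    have hS : (y * x⁻¹) • S = S := hy
    have hv : (open scoped Pointwise in (y * x⁻¹) • S.1) = S.1 := congrArg Subtype.val hS
    rw [← hv]
    exact Finset.mem_smul_finset.2 ⟨x, hx, by simp⟩
  · rw [← hmul, h]

theorem sum_properPart_eq_nsmul {B : Type} [AddCommMonoid B] (F : ProperPart p → B)
    (hF : ∀ (g : Cp p) S, F (g • S) = F S) :
    ∑ S, F S = p • ∑ o : ProperOrbit p, F (Quotient.out o) := by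
  classical
  rw [← (MulAction.selfEquivSigmaOrbits (Cp p) (ProperPart p)).symm.sum_comp F,
    Fintype.sum_sigma, Finset.smul_sum]
  refine Finset.sum_congr rfl fun o _ => ?_
  have : ∀ y : MulAction.orbit (Cp p) (Quotient.out o),
      F ((MulAction.selfEquivSigmaOrbits (Cp p) (ProperPart p)).symm ⟨o, y⟩) =
        F (Quotient.out o) := by
    rintro ⟨_, g, rfl⟩
    exact hF g _
  rw [Finset.sum_congr rfl fun y _ => this y, Finset.sum_const, Finset.card_univ,
    ← Nat.card_eq_fintype_card, card_orbit_properPart]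

variable (p) in
/-- The trivial action of `C_p` on a ring. -/
abbrev trivialAction (B : Type) [CommRing B] : MulSemiringAction (Cp p) B where
  smul := fun _ x => x
  one_smul := fun _ => rfl
  mul_smul := fun _ _ _ => rfl
  smul_zero := fun _ => rfl
  smul_add := fun _ _ _ => rfl
  smul_one := fun _ => rfl
  smul_mul := fun _ _ _ => rfl

/-- Expanding the p-th power over subsets of C_p, the empty and full subsets give the pure powers
and all other subsets fall into orbits of size p with equal terms. No division by p occurs, so any
commutative ring is allowed. -/
theorem add_pow_eq_mixedProduct {B : Type} [CommRing B] (a b : B) :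
    letI := trivialAction p B
    (a + b) ^ p = a ^ p + b ^ p + p * ∑ o : ProperOrbit p, mixedProduct a b (Quotient.out o) := by
  classical
  letI := trivialAction p B
  have hF : ∀ S : ProperPart p, mixedProduct a b S = a ^ S.1.card * b ^ (p - S.1.card) := by
    intro S
    have h1 : ∀ (g : Cp p) (x : B), g • x = x := fun _ _ => rfl
    simp [mixedProduct, h1, Finset.card_sdiff, Finset.card_univ, Cp]
  have hsum := sum_properPart_eq_nsmul (mixedProduct a b) (fun g S => by
    rw [hF, hF]
    have : (g • S).1.card = S.1.card := Finset.card_smul_finset g S.1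
    rw [this])
  rw [nsmul_eq_mul] at hsum
  have h := Finset.prod_add (fun _ : Cp p => a) (fun _ => b) Finset.univ
  have hne : (∅ : Finset (Cp p)) ≠ Finset.univ := Finset.univ_nonempty.ne_empty.symm
  rw [Finset.powerset_univ] at h
  have hs : ∑ t : Finset (Cp p), (∏ _i ∈ t, a) * ∏ _i ∈ Finset.univ \ t, b =
      a ^ p + b ^ p + ∑ S : ProperPart p, mixedProduct a b S := by
    rw [← Finset.add_sum_erase _ _ (Finset.mem_univ (Finset.univ : Finset (Cp p))),
      ← Finset.add_sum_erase _ _ (Finset.mem_erase.2 ⟨hne, Finset.mem_univ _⟩), ← add_assoc]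
    congr 1
    · simp [Cp]
    · exact Finset.sum_subtype (F := inferInstanceAs (Fintype (ProperPart p))) _
        (p := fun S : Finset (Cp p) => S ≠ ∅ ∧ S ≠ Finset.univ) (fun x => by simp) _
  rw [← hsum, ← hs, ← h]
  simp [Cp]

theorem mixedProduct_zero {B : Type} [CommRing B] [MulSemiringAction (Cp p) B] (S : ProperPart p) :
    mixedProduct (0 : B) 0 S = 0 := by
  obtain ⟨g, hg⟩ := Finset.nonempty_iff_ne_empty.2 S.2.1
  rw [mixedProduct, Finset.prod_eq_zero hg (smul_zero g), zero_mul]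

theorem map_mixedProduct {B B' : Type} [CommRing B] [CommRing B'] [MulSemiringAction (Cp p) B]
    [MulSemiringAction (Cp p) B'] (f : B →+* B') (hf : ∀ (g : Cp p) (b : B), f (g • b) = g • f b)
    (a b : B) (S : ProperPart p) : f (mixedProduct a b S) = mixedProduct (f a) (f b) S := by
  simp [mixedProduct, hf]

end ProperPart

namespace TambaraFunctor

variable {p : ℕ} [Fact p.Prime]

theorem nm_zero (T : TambaraFunctor p) : T.nm 0 = 0 := by
  have h := T.nm_add 0 0
  simp only [mixedProduct_zero, map_zero, Finset.sum_const_zero, add_zero] at h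
  exact left_eq_add.1 h

/-- The elements whose norm is preserved by a morphism of Green functors. -/
def normEqualizer {S T : TambaraFunctor p}
    (f : GreenFunctor.Hom S.toGreenFunctor T.toGreenFunctor) : Subring S.bot where
  carrier := {b | f.top (S.nm b) = T.nm (f.bot b)}
  mul_mem' := fun {a b} (ha : f.top (S.nm a) = T.nm (f.bot a))
      (hb : f.top (S.nm b) = T.nm (f.bot b)) => by
    change f.top (S.nm (a * b)) = T.nm (f.bot (a * b))
    rw [map_mul, map_mul, map_mul, map_mul, ha, hb]
  one_mem' := by
    change f.top (S.nm 1) = T.nm (f.bot 1)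
    rw [map_one, map_one, map_one, map_one]
  add_mem' := fun {a b} (ha : f.top (S.nm a) = T.nm (f.bot a))
      (hb : f.top (S.nm b) = T.nm (f.bot b)) => by
    change f.top (S.nm (a + b)) = T.nm (f.bot (a + b))
    rw [S.nm_add, map_add f.bot, T.nm_add, map_add, map_add, map_sum, ha, hb]
    simp only [f.map_tr, map_mixedProduct f.bot f.map_smul]
  zero_mem' := by
    change f.top (S.nm 0) = T.nm (f.bot 0)
    rw [nm_zero, map_zero, map_zero, nm_zero]
  neg_mem' := fun {a} (ha : f.top (S.nm a) = T.nm (f.bot a)) => by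
    change f.top (S.nm (-a)) = T.nm (f.bot (-a))
    -- The norm is not additive, so negatives are treated by expanding the norm of a + (-a) = 0 in
    -- both functors and cancelling the equal terms.
    have h1 := congrArg f.top (S.nm_add a (-a))
    have h2 := T.nm_add (f.bot a) (f.bot (-a))
    rw [add_neg_cancel, nm_zero, map_zero, map_add, map_add, map_sum, ha] at h1
    simp only [f.map_tr, map_mixedProduct f.bot f.map_smul] at h1
    rw [← map_add, add_neg_cancel, map_zero, nm_zero, h1] at h2
    exact add_left_cancel (add_right_cancel h2)

end TambaraFunctor

/-! ### The free Tambara functor on a fixed generator -/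

section Polynomial

open Polynomial

variable (p : ℕ)

/-- The pairs `(f, q)` with `f ≡ q(x, x ^ p)` modulo `p`. -/
noncomputable def polyTop : Subring (ℤ[X] × Polynomial ℤ[X]) where
  carrier := {z | ∃ h : ℤ[X], z.1 = z.2.eval (X ^ p) + p * h}
  mul_mem' := by
    rintro ⟨f, q⟩ ⟨f', q'⟩ ⟨h, hf⟩ ⟨h', hf'⟩
    refine ⟨h * q'.eval (X ^ p) + h' * q.eval (X ^ p) + p * h * h', ?_⟩
    change f = q.eval (X ^ p) + p * h at hf
    change f' = q'.eval (X ^ p) + p * h' at hf'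
    change f * f' = (q * q').eval (X ^ p) + _
    rw [hf, hf', eval_mul]
    ring
  one_mem' := ⟨0, by simp⟩
  add_mem' := by
    rintro ⟨f, q⟩ ⟨f', q'⟩ ⟨h, hf⟩ ⟨h', hf'⟩
    refine ⟨h + h', ?_⟩
    change f = q.eval (X ^ p) + p * h at hf
    change f' = q'.eval (X ^ p) + p * h' at hf'
    change f + f' = (q + q').eval (X ^ p) + _
    rw [hf, hf', eval_add]
    ring
  zero_mem' := ⟨0, by simp⟩
  neg_mem' := by
    rintro ⟨f, q⟩ ⟨h, hf⟩
    refine ⟨-h, ?_⟩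
    change f = q.eval (X ^ p) + p * h at hf
    change -f = (-q).eval (X ^ p) + _
    rw [hf, eval_neg]
    ring

/-- The inclusion of the polynomials in `x` and the norm of its restriction. -/
noncomputable def polyIncl : Polynomial ℤ[X] →+* polyTop p where
  toFun := fun q => ⟨(q.eval (X ^ p), q), 0, by simp⟩
  map_one' := Subtype.ext (Prod.ext eval_one rfl)
  map_mul' := fun _ _ => Subtype.ext (Prod.ext eval_mul rfl)
  map_zero' := Subtype.ext (Prod.ext eval_zero rfl)
  map_add' := fun _ _ => Subtype.ext (Prod.ext eval_add rfl)

/-- The transfer. -/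
noncomputable def polyTr : ℤ[X] →+ polyTop p where
  toFun := fun h => ⟨(p * h, 0), h, by simp⟩
  map_zero' := Subtype.ext (Prod.ext (mul_zero _) rfl)
  map_add' := fun _ _ => Subtype.ext (Prod.ext (mul_add _ _ _) (add_zero _).symm)

/-- The restriction. -/
noncomputable def polyRes : polyTop p →+* ℤ[X] :=
  (RingHom.fst _ _).comp (polyTop p).subtype

variable {p}

theorem polyTop_ext {z w : polyTop p} (h1 : z.1.1 = w.1.1) (h2 : z.1.2 = w.1.2) : z = w :=
  Subtype.ext (Prod.ext h1 h2)

/-- The fixed level is the polynomial ring in x and the norm plus the transfers. This normal form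
supports the construction of morphisms and the ring calculations that follow. -/
theorem exists_polyIncl_add_polyTr (z : polyTop p) : ∃ q h, z = polyIncl p q + polyTr p h := by
  obtain ⟨⟨f, q⟩, h, hf⟩ := z
  exact ⟨q, h, polyTop_ext hf (add_zero q).symm⟩

theorem polyTr_mul (z : polyTop p) (h : ℤ[X]) : polyTr p (polyRes p z * h) = z * polyTr p h :=
  polyTop_ext (mul_left_comm _ _ _) (mul_zero _).symm

variable [Fact p.Prime]

/-- Over the field with p elements the Frobenius is substitution of x^p, so the difference has all
coefficients divisible by p. This is why the norm lands in `polyTop`. -/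
theorem exists_pow_eq_expand_add (f : ℤ[X]) : ∃ h : ℤ[X], f ^ p = f.eval₂ C (X ^ p) + p * h := by
  have h : C (p : ℤ) ∣ f ^ p - expand ℤ p f := by
    rw [C_dvd_iff_dvd_coeff]
    intro i
    rw [← ZMod.intCast_zmod_eq_zero_iff_dvd, ← eq_intCast (Int.castRingHom (ZMod p)),
      ← coeff_map, Polynomial.map_sub, Polynomial.map_pow, map_expand, ZMod.expand_card,
      sub_self, coeff_zero]
  obtain ⟨h, hh⟩ := h
  refine ⟨h, ?_⟩
  have e : f.eval₂ C (X ^ p) = expand ℤ p f := rfl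
  rw [e, ← sub_eq_iff_eq_add', hh]
  simp

variable (p)

/-- The norm. -/
noncomputable def polyNm : ℤ[X] →* polyTop p where
  toFun := fun f => ⟨(f ^ p, f.map C), by
    obtain ⟨h, hh⟩ := exists_pow_eq_expand_add (p := p) f
    exact ⟨h, by rw [eval_map]; exact hh⟩⟩
  map_one' := polyTop_ext (one_pow p) (Polynomial.map_one C)
  map_mul' := fun f g => polyTop_ext (mul_pow f g p) (Polynomial.map_mul C)

/-- The free Tambara functor on a fixed generator. -/
noncomputable def TambaraFunctor.poly : TambaraFunctor p where
  top := polyTop p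
  bot := ℤ[X]
  act := trivialAction p ℤ[X]
  res := polyRes p
  tr := polyTr p
  smul_res := fun _ _ => rfl
  tr_smul := fun _ _ => rfl
  res_tr := fun y => by
    have h : ∀ g : Cp p, (letI := trivialAction p ℤ[X]; g • y) = y := fun _ => rfl
    simp only [h]
    simp [Cp, polyRes, polyTr]
  tr_res_mul := polyTr_mul
  nm := polyNm p
  nm_smul := fun _ _ => rfl
  res_nm := fun y => by
    have h : ∀ g : Cp p, (letI := trivialAction p ℤ[X]; g • y) = y := fun _ => rfl
    simp only [h]
    simp [Cp, polyRes, polyNm]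
  nm_add := fun a b => by
    rw [← map_sum]
    -- The restriction coordinate is the binomial expansion; the other coordinate is additive since
    -- it kills transfers.
    exact polyTop_ext (add_pow_eq_mixedProduct a b) ((Polynomial.map_add C).trans (add_zero _).symm)

/-- The generator. -/
noncomputable def polyGen : (TambaraFunctor.poly p).top := polyIncl p (C X)

end Polynomial

namespace TambaraFunctor

open Polynomial

variable {p : ℕ} [Fact p.Prime] (T : TambaraFunctor p) (y : T.top)

/-- Evaluation of integral polynomials at `res y`. -/
noncomputable def evalBot : ℤ[X] →+* T.bot := eval₂RingHom (Int.castRingHom _) (T.res y)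

/-- Evaluation of integral polynomials in two variables at `y` and the norm of `res y`. -/
noncomputable def evalTop : Polynomial ℤ[X] →+* T.top :=
  eval₂RingHom (eval₂RingHom (Int.castRingHom _) y) (T.nm (T.res y))

theorem evalBot_X : T.evalBot y X = T.res y := by simp [evalBot]

theorem evalTop_X : T.evalTop y X = T.nm (T.res y) := by simp [evalTop]

theorem evalTop_C_X : T.evalTop y (C X) = y := by simp [evalTop]

/-- Restrictions are fixed by C_p, so the subring generated by `res y` is fixed too. The target may
have a nontrivial action, yet only its invariants are met. -/
theorem smul_evalBot (g : Cp p) (f : ℤ[X]) : g • T.evalBot y f = T.evalBot y f := by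
  have h : (MulSemiringAction.toRingHom (Cp p) T.bot g).comp (T.evalBot y) = T.evalBot y := by
    refine Polynomial.ringHom_ext (fun n => ?_) ?_
    · simp [evalBot]
    · simp [evalBot, T.smul_res]
  exact RingHom.congr_fun h f

theorem res_nm_res : T.res (T.nm (T.res y)) = T.res y ^ p := by
  rw [T.res_nm, Finset.prod_congr rfl fun g _ => T.smul_res g y]
  simp [Cp]

theorem res_evalTop (q : Polynomial ℤ[X]) :
    T.res (T.evalTop y q) = T.evalBot y (q.eval (X ^ p)) := by
  have h : T.res.comp (T.evalTop y) = (T.evalBot y).comp (evalRingHom (X ^ p)) := by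
    refine Polynomial.ringHom_ext' (Polynomial.ringHom_ext (fun n => ?_) ?_) ?_
    · simp
    · simp [evalTop_C_X, evalBot_X]
    · simp [evalTop_X, evalBot_X, res_nm_res]
  exact RingHom.congr_fun h q

theorem res_tr_evalBot (h : ℤ[X]) : T.res (T.tr (T.evalBot y h)) = T.evalBot y (p * h) := by
  rw [T.res_tr, Finset.sum_congr rfl fun g _ => T.smul_evalBot y g h]
  simp [Cp]

theorem mul_tr_evalBot (a : T.top) {f : ℤ[X]} (hf : T.res a = T.evalBot y f) (h : ℤ[X]) :
    a * T.tr (T.evalBot y h) = T.tr (T.evalBot y (f * h)) := by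
  rw [← T.tr_res_mul, hf, map_mul (T.evalBot y)]

/-- The value of the morphism out of the free Tambara functor at the fixed level. -/
noncomputable def polyValue (z : polyTop p) : T.top :=
  T.evalTop y z.1.2 + T.tr (T.evalBot y z.2.choose)

theorem polyValue_eq (q : Polynomial ℤ[X]) (h : ℤ[X]) :
    T.polyValue y (polyIncl p q + polyTr p h) = T.evalTop y q + T.tr (T.evalBot y h) := by
  have hz := (polyIncl p q + polyTr p h).2.choose_spec
  have hp : (p : ℤ[X]) ≠ 0 := Nat.cast_ne_zero.2 (Fact.out : p.Prime).ne_zero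
  -- The polynomial h is unique, because p is not a zero divisor in ℤ[x]; so the choice in
  -- `polyValue` does no harm.
  have e : (polyIncl p q + polyTr p h).2.choose = h := by
    change q.eval (X ^ p) + p * h = (q + 0).eval (X ^ p) + _ at hz
    rw [add_zero] at hz
    exact (mul_left_cancel₀ hp (add_left_cancel hz)).symm
  rw [polyValue, e]
  change T.evalTop y (q + 0) + _ = _
  rw [add_zero]

/-- The morphism out of the free Tambara functor, at the fixed level. -/
noncomputable def polyDescTop : polyTop p →+* T.top where
  toFun := T.polyValue y
  map_one' := by
    have h := T.polyValue_eq y 1 0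
    rw [map_one, map_one, map_zero, map_zero, map_zero, add_zero, add_zero] at h
    exact h
  map_zero' := by
    have h := T.polyValue_eq y 0 0
    rw [map_zero, map_zero, map_zero, map_zero, map_zero, add_zero, add_zero] at h
    exact h
  map_add' := fun z w => by
    obtain ⟨q, h, rfl⟩ := exists_polyIncl_add_polyTr z
    obtain ⟨q', h', rfl⟩ := exists_polyIncl_add_polyTr w
    rw [add_add_add_comm, ← map_add, ← map_add, polyValue_eq, polyValue_eq, polyValue_eq,
      map_add, map_add, map_add]
    exact add_add_add_comm _ _ _ _
  map_mul' := fun z w => by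
    obtain ⟨q, h, rfl⟩ := exists_polyIncl_add_polyTr z
    obtain ⟨q', h', rfl⟩ := exists_polyIncl_add_polyTr w
    -- Products involving transfers are rewritten by Frobenius reciprocity, in particular tr h · tr
    -- h' = tr(p h h'). The same identities hold in T.
    have e : (polyIncl p q + polyTr p h) * (polyIncl p q' + polyTr p h') =
        polyIncl p (q * q') + polyTr p (q.eval (X ^ p) * h' + q'.eval (X ^ p) * h +
          p * h * h') := by
      rw [map_mul, map_add, map_add, add_mul, mul_add, mul_add, ← polyTr_mul,
        mul_comm (polyTr p h) (polyIncl p q'), ← polyTr_mul, ← polyTr_mul]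
      change polyIncl p q * polyIncl p q' + polyTr p (q.eval (X ^ p) * h') +
        (polyTr p (q'.eval (X ^ p) * h) + polyTr p (p * h * h')) = _
      ring
    rw [e, polyValue_eq, polyValue_eq, polyValue_eq, map_mul, map_add, map_add, map_add, map_add,
      add_mul, mul_add, mul_add, T.mul_tr_evalBot y _ (T.res_evalTop y q),
      mul_comm (T.tr (T.evalBot y h)) (T.evalTop y q'),
      T.mul_tr_evalBot y _ (T.res_evalTop y q'), T.mul_tr_evalBot y _ (T.res_tr_evalBot y h)]
    ring

theorem polyDescTop_eq (q : Polynomial ℤ[X]) (h : ℤ[X]) :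
    T.polyDescTop y (polyIncl p q + polyTr p h) = T.evalTop y q + T.tr (T.evalBot y h) :=
  T.polyValue_eq y q h

theorem polyDescTop_polyIncl (q : Polynomial ℤ[X]) :
    T.polyDescTop y (polyIncl p q) = T.evalTop y q := by
  have h := T.polyDescTop_eq y q 0
  rwa [map_zero, map_zero, map_zero, add_zero, add_zero] at h

theorem polyDescTop_polyTr (h : ℤ[X]) :
    T.polyDescTop y (polyTr p h) = T.tr (T.evalBot y h) := by
  have h' := T.polyDescTop_eq y 0 h
  rwa [map_zero, map_zero, zero_add, zero_add] at h'

/-- The underlying morphism of Green functors. -/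
noncomputable def polyDescGreen :
    GreenFunctor.Hom (TambaraFunctor.poly p).toGreenFunctor T.toGreenFunctor where
  top := T.polyDescTop y
  bot := T.evalBot y
  map_res := fun (z : polyTop p) => by
    change T.evalBot y (polyRes p z) = T.res (T.polyDescTop y z)
    obtain ⟨q, h, rfl⟩ := exists_polyIncl_add_polyTr z
    rw [polyDescTop_eq, map_add, map_add, map_add, res_evalTop, res_tr_evalBot]
    rfl
  map_tr := fun h => T.polyDescTop_polyTr y h
  map_smul := fun g (f : ℤ[X]) => (T.smul_evalBot y g f).symm

/-- The two variables differ: on the left x at the free level, on the right the outer variable n.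
Thus n is the norm of the restricted generator. -/
theorem polyNm_X : polyNm p X = polyIncl p X :=
  polyTop_ext eval_X.symm (map_X C)

/-- The elements with preserved norm form a subring, and ℤ[x] is generated as a ring by x, so only x
has to be checked. -/
theorem normEqualizer_polyDescGreen : normEqualizer (T.polyDescGreen y) = ⊤ := by
  refine (Subring.eq_top_iff' _).2 fun (f : ℤ[X]) => ?_
  have hX : (X : ℤ[X]) ∈ normEqualizer (T.polyDescGreen y) := by
    change T.polyDescTop y (polyNm p X) = T.nm (T.evalBot y X)
    rw [polyNm_X, polyDescTop_polyIncl, evalTop_X, evalBot_X]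
  induction f using Polynomial.induction_on' with
  | add f g hf hg => exact add_mem hf hg
  | monomial n a =>
    have e : monomial n a = ((a : ℤ) : ℤ[X]) * X ^ n := by
      rw [← C_mul_X_pow_eq_monomial, ← eq_intCast C]
    rw [e]
    exact mul_mem (intCast_mem _ a) (pow_mem hX n)

/-- The morphism out of the free Tambara functor with prescribed value at the generator. -/
noncomputable def polyDesc : TambaraFunctor.Hom (TambaraFunctor.poly p) T where
  toHom := T.polyDescGreen y
  map_nm := fun f => by
    have h : f ∈ normEqualizer (T.polyDescGreen y) := by
      rw [normEqualizer_polyDescGreen]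
      exact Subring.mem_top f
    exact h

theorem polyDesc_gen : (T.polyDesc y).top (polyGen p) = y :=
  (T.polyDescTop_polyIncl y (C X)).trans (T.evalTop_C_X y)

variable {T}

/-- The free level is generated by the restriction of the generator, the fixed level by the
generator, the norm of its restriction and the transfers, so Tambara morphisms have no further
freedom. -/
theorem poly_hom_ext {f g : TambaraFunctor.Hom (TambaraFunctor.poly p) T}
    (h : f.top (polyGen p) = g.top (polyGen p)) : f = g := by
  let ft : polyTop p →+* T.top := f.top
  let gt : polyTop p →+* T.top := g.top
  let fb : ℤ[X] →+* T.bot := f.bot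
  let gb : ℤ[X] →+* T.bot := g.bot
  have hres : polyRes p (polyIncl p (C X)) = X := eval_C
  have hX : fb X = gb X := by
    have h1 : fb (polyRes p (polyIncl p (C X))) = T.res (f.top (polyGen p)) := f.map_res _
    have h2 : gb (polyRes p (polyIncl p (C X))) = T.res (g.top (polyGen p)) := g.map_res _
    rw [hres] at h1 h2
    rw [h1, h2, h]
  have hb : fb = gb := Polynomial.ringHom_ext (fun n => by simp) hX
  have hi : ft.comp (polyIncl p) = gt.comp (polyIncl p) := by
    refine Polynomial.ringHom_ext' (Polynomial.ringHom_ext (fun n => by simp) h) ?_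
    have h1 : ft (polyNm p X) = T.nm (fb X) := f.map_nm _
    have h2 : gt (polyNm p X) = T.nm (gb X) := g.map_nm _
    rw [polyNm_X] at h1 h2
    exact h1.trans ((congrArg T.nm hX).trans h2.symm)
  have ht : ft = gt := by
    refine RingHom.ext fun z => ?_
    obtain ⟨q, k, rfl⟩ := exists_polyIncl_add_polyTr z
    have h1 : ft (polyTr p k) = T.tr (fb k) := f.map_tr k
    have h2 : gt (polyTr p k) = T.tr (gb k) := g.map_tr k
    rw [map_add, map_add, h1, h2, hb]
    exact congrArg (· + _) (RingHom.congr_fun hi q)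
  exact TambaraFunctor.Hom.ext ht hb

theorem poly_isFreeOnFixed : (TambaraFunctor.poly p).IsFreeOnFixed (polyGen p) := fun T y =>
  ⟨T.polyDesc y, T.polyDesc_gen y, fun _ h => poly_hom_ext (h.trans (T.polyDesc_gen y).symm)⟩

end TambaraFunctor

/-! ### Transport along isomorphisms and the algebra of the explicit model -/

namespace TambaraFunctor

variable {p : ℕ} [Fact p.Prime]

/-- The identity morphism. -/
def Hom.id (R : TambaraFunctor p) : Hom R R where
  top := RingHom.id _
  bot := RingHom.id _
  map_res := fun _ => rfl
  map_tr := fun _ => rfl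
  map_smul := fun _ _ => rfl
  map_nm := fun _ => rfl

/-- The composite of two morphisms. -/
def Hom.comp {R S T : TambaraFunctor p} (g : Hom S T) (f : Hom R S) : Hom R T where
  top := g.top.comp f.top
  bot := g.bot.comp f.bot
  map_res := fun a => (congrArg g.bot (f.map_res a)).trans (g.map_res _)
  map_tr := fun a => (congrArg g.top (f.map_tr a)).trans (g.map_tr _)
  map_smul := fun k a => (congrArg g.bot (f.map_smul k a)).trans (g.map_smul k _)
  map_nm := fun a => (congrArg g.top (f.map_nm a)).trans (g.map_nm _)

theorem IsFreeOnFixed.hom_ext {R T : TambaraFunctor p} {x : R.top} (hR : R.IsFreeOnFixed x)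
    {f g : Hom R T} (h : f.top x = g.top x) : f = g :=
  (hR T (g.top x)).unique h rfl

theorem IsFreeOnFixed.exists_iso {R S : TambaraFunctor p} {x : R.top} {y : S.top}
    (hR : R.IsFreeOnFixed x) (hS : S.IsFreeOnFixed y) :
    ∃ (f : Hom R S) (g : Hom S R), f.top x = y ∧ g.top y = x ∧ g.comp f = Hom.id R ∧
      f.comp g = Hom.id S := by
  obtain ⟨f, hf, -⟩ := hR S y
  obtain ⟨g, hg, -⟩ := hS R x
  exact ⟨f, g, hf, hg, hR.hom_ext ((congrArg g.top hf).trans hg),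
    hS.hom_ext ((congrArg f.top hg).trans hf)⟩

section Poly

open Polynomial

theorem evalBot_zero (f : ℤ[X]) : (burnside p).evalBot 0 f = (f.coeff 0 : ℤ) := by
  have h : ∀ φ : ℤ[X] →+* ℤ, φ X = 0 → φ = constantCoeff := fun φ hφ =>
    Polynomial.ringHom_ext' (RingHom.ext_int _ _) (hφ.trans coeff_X_zero.symm)
  exact RingHom.congr_fun (h ((burnside p).evalBot 0)
    (((burnside p).evalBot_X 0).trans (map_zero _))) f

theorem evalTop_zero (q : Polynomial ℤ[X]) :
    (burnside p).evalTop 0 q = (((q.coeff 0).coeff 0 : ℤ) : BurnsideRing p) := by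
  have h : ∀ φ : Polynomial ℤ[X] →+* BurnsideRing p, φ (C X) = 0 → φ X = 0 →
      φ = (Int.castRingHom (BurnsideRing p)).comp
        ((constantCoeff (R := ℤ)).comp (constantCoeff (R := ℤ[X]))) := fun φ h1 h2 => by
    refine Polynomial.ringHom_ext' (Polynomial.ringHom_ext' (RingHom.ext_int _ _) ?_) ?_
    · rw [RingHom.comp_apply, h1]
      simp
    · rw [h2]
      simp
  exact RingHom.congr_fun (h ((burnside p).evalTop 0) ((burnside p).evalTop_C_X 0)
    (((burnside p).evalTop_X 0).trans ((congrArg (burnside p).nm (map_zero _)).trans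
      (burnside p).nm_zero))) q

/-- The difference of the norm of the restriction of the generator and its `p`-th power. -/
noncomputable def polyDiff (p : ℕ) [Fact p.Prime] : (TambaraFunctor.poly p).top :=
  polyIncl p (X - C (X ^ p))

theorem fst_polyDiff : (polyIncl p (X - C (X ^ p))).1.1 = 0 := by
  change (X - C (X ^ p) : Polynomial ℤ[X]).eval (X ^ p) = 0
  simp

theorem polyTr_one_sub : polyTr p 1 - (p : polyTop p) = ⟨(0, -(p : Polynomial ℤ[X])),
    1, by simp⟩ := by
  refine polyTop_ext ?_ ?_
  · change (p : ℤ[X]) * 1 - ((p : polyTop p) : ℤ[X] × Polynomial ℤ[X]).1 = 0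
    simp
  · change (0 : Polynomial ℤ[X]) - ((p : polyTop p) : ℤ[X] × Polynomial ℤ[X]).2 = -p
    simp

theorem exists_eq_mul_of_eval {q : Polynomial ℤ[X]} (h : q.eval (X ^ p) = 0) :
    ∃ r, (X - C (X ^ p)) * r = q := by
  obtain ⟨r, hr⟩ := dvd_iff_isRoot.2 h
  exact ⟨r, hr.symm⟩

/-- Both u and t - p have restriction zero, so products with them are visible only in the second
coordinate, where the ring ℤ[x, n] is a domain and divisibility by n - x^p is tested by substituting
n = x^p. -/
theorem isPolynomialBurnside_poly : IsPolynomialBurnside (R := (poly p).toGreenFunctor)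
    (polyGen p) (polyDiff p) ((burnside p).polyDesc 0).toHom where
  smul_eq := fun _ _ => rfl
  res_snd := fst_polyDiff
  natCast_regular := fun (b : ℤ[X]) h => by
    have h' : (p : ℤ[X]) * b = 0 := h
    exact (mul_eq_zero.1 h').resolve_left (Nat.cast_ne_zero.2 (Fact.out : p.Prime).ne_zero)
  res_surjective := fun (f : ℤ[X]) => ⟨polyIncl p (C f), eval_C⟩
  annihilator_snd := fun (a : polyTop p) h => by
    obtain ⟨q, k, rfl⟩ := exists_polyIncl_add_polyTr a
    have h2 : (X - C (X ^ p)) * (q + 0) = 0 := congrArg (fun z : polyTop p => z.1.2) h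
    rw [add_zero] at h2
    have hq : q = 0 := (mul_eq_zero.1 h2).resolve_left (X_sub_C_ne_zero _)
    refine ⟨k, ?_⟩
    rw [hq, map_zero, zero_add]
    rfl
  ker_res := fun (a : polyTop p) h => by
    obtain ⟨q, k, rfl⟩ := exists_polyIncl_add_polyTr a
    have h1 : q.eval (X ^ p) + p * k = 0 := h
    -- Vanishing restriction says that q + pk has the root n = x^p, which writes q as -pk plus a
    -- multiple of n - x^p.
    obtain ⟨r, hr⟩ := exists_eq_mul_of_eval (p := p) (q := q + C (p * k)) (by
      rw [eval_add, eval_C, h1])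
    refine ⟨polyIncl p (C k), polyIncl p r, ?_⟩
    change (polyTr p 1 - (p : polyTop p)) * polyIncl p (C k) +
      polyIncl p (X - C (X ^ p)) * polyIncl p r = _
    rw [polyTr_one_sub]
    refine polyTop_ext ?_ ?_
    · change 0 * _ + (polyIncl p (X - C (X ^ p))).1.1 * _ = q.eval (X ^ p) + p * k
      rw [fst_polyDiff, h1]
      ring
    · change -(p : Polynomial ℤ[X]) * C k + (X - C (X ^ p)) * r = q + 0
      rw [hr, C_mul, C_eq_natCast]
      ring
  syzygy := fun (a b : polyTop p) h => by
    obtain ⟨q, k, rfl⟩ := exists_polyIncl_add_polyTr a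
    obtain ⟨q', k', rfl⟩ := exists_polyIncl_add_polyTr b
    replace h : (polyTr p 1 - (p : polyTop p)) * (polyIncl p q + polyTr p k) +
      polyIncl p (X - C (X ^ p)) * (polyIncl p q' + polyTr p k') = 0 := h
    rw [polyTr_one_sub] at h
    have h2 : -(p : Polynomial ℤ[X]) * (q + 0) + (X - C (X ^ p)) * (q' + 0) = 0 :=
      congrArg (fun z : polyTop p => z.1.2) h
    rw [add_zero, add_zero] at h2
    -- Substituting n = x^p into -pq + (n - x^p)q' = 0 shows that q vanishes there; writing q = (n -
    -- x^p)r and cancelling then yields q' = pr.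
    have h3 := congrArg (eval (X ^ p : ℤ[X])) h2
    have hp : (p : ℤ[X]) ≠ 0 := Nat.cast_ne_zero.2 (Fact.out : p.Prime).ne_zero
    simp only [eval_add, eval_mul, eval_neg, eval_natCast, eval_sub, eval_X, eval_C, sub_self,
      zero_mul, add_zero, eval_zero, mul_eq_zero, neg_eq_zero, hp, false_or] at h3
    obtain ⟨r, rfl⟩ := exists_eq_mul_of_eval h3
    have h4 : q' = p * r := by
      refine mul_left_cancel₀ (X_sub_C_ne_zero (X ^ p : ℤ[X])) ?_
      linear_combination h2
    refine ⟨polyIncl p r, k, k', ?_, ?_⟩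
    · change polyIncl p (X - C (X ^ p)) * polyIncl p r + polyTr p k = _
      rw [map_mul]
    · change (p : polyTop p) * polyIncl p r + polyTr p k' = _
      rw [h4, map_mul, map_natCast]
  fst_regular := fun (a b : polyTop p) h => by
    obtain ⟨q, k, rfl⟩ := exists_polyIncl_add_polyTr a
    have h1 : (C X : Polynomial ℤ[X]).eval (X ^ p) * (q.eval (X ^ p) + p * k) =
        (polyIncl p (X - C (X ^ p))).1.1 * b.1.1 := congrArg (fun z : polyTop p => z.1.1) h
    have h2 : C X * (q + 0) = (X - C (X ^ p)) * b.1.2 :=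
      congrArg (fun z : polyTop p => z.1.2) h
    rw [fst_polyDiff, zero_mul, eval_C, mul_eq_zero, or_iff_right X_ne_zero] at h1
    -- Here x q is a multiple of n - x^p, so q vanishes at n = x^p. The restriction of a is zero as
    -- well, and a becomes a multiple of u.
    have h3 := congrArg (eval (X ^ p : ℤ[X])) h2
    simp only [add_zero, eval_mul, eval_sub, eval_X, eval_C, sub_self, zero_mul, mul_eq_zero,
      X_ne_zero, false_or] at h3
    obtain ⟨r, hr⟩ := exists_eq_mul_of_eval h3
    refine ⟨polyIncl p r, polyTop_ext ?_ ?_⟩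
    · change (polyIncl p (X - C (X ^ p))).1.1 * _ = q.eval (X ^ p) + p * k
      rw [fst_polyDiff, zero_mul, h1]
    · exact hr.trans (add_zero q).symm
  res_fst_regular := fun (b : ℤ[X]) h => by
    have h' : (C X : Polynomial ℤ[X]).eval (X ^ p) * b = 0 := h
    rw [eval_C] at h'
    exact (mul_eq_zero.1 h').resolve_left X_ne_zero
  map_fst := (burnside p).polyDesc_gen 0
  map_snd := by
    refine ((burnside p).polyDescTop_polyIncl 0 _).trans ?_
    rw [map_sub, evalTop_X, map_pow, map_pow, evalTop_C_X, map_zero, nm_zero,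
      zero_pow (Fact.out : p.Prime).ne_zero, sub_self]
  ker_top := fun (a : polyTop p) h => by
    obtain ⟨q, k, rfl⟩ := exists_polyIncl_add_polyTr a
    have h1 : (((q.coeff 0).coeff 0 : ℤ) : BurnsideRing p) +
        ((k.coeff 0 : ℤ) : BurnsideRing p) * BurnsideRing.t p = 0 := by
      rw [← evalTop_zero (p := p), ← evalBot_zero (p := p)]
      exact ((burnside p).polyDescTop_eq 0 q k).symm.trans h
    have h2 : (q.coeff 0).coeff 0 = 0 := by
      have := congrArg (BurnsideRing.constPart p) h1
      simpa [BurnsideRing.constPart_t] using this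
    rw [h2, Int.cast_zero, zero_add] at h1
    have h3 := BurnsideRing.intCast_mul_t_eq_zero p h1
    obtain ⟨k', rfl⟩ := X_dvd_iff.2 h3
    obtain ⟨r, hr⟩ := X_dvd_iff.2 h2
    obtain ⟨s, hs⟩ := X_dvd_iff.2 (show (q - C (q.coeff 0)).coeff 0 = 0 by simp)
    obtain ⟨n, hn⟩ := Nat.exists_eq_succ_of_ne_zero (Fact.out : p.Prime).ne_zero
    -- Write q = x r + n s, where n denotes the norm variable, and replace that variable by u + x^p.
    -- In the code `n` is instead the exponent p - 1.
    have hq : q = C X * (C r + C X ^ n * s) + (X - C (X ^ p)) * s := by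
      rw [sub_eq_iff_eq_add.1 hs, hr, C_mul, C_pow]
      have hpow : (C X : Polynomial ℤ[X]) ^ p = C X ^ n * C X :=
        (congrArg _ hn).trans (pow_succ _ _)
      linear_combination s * hpow
    have ht : polyTr p (X * k') = polyIncl p (C X) * polyTr p k' := by
      rw [← polyTr_mul]
      exact congrArg (fun w => polyTr p (w * k')) eval_C.symm
    refine ⟨polyIncl p (C r + C X ^ n * s) + polyTr p k', polyIncl p s, ?_⟩
    change _ = polyIncl p (C X) * (polyIncl p (C r + C X ^ n * s) + polyTr p k') +
      polyIncl p (X - C (X ^ p)) * polyIncl p s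
    rw [ht, mul_add, ← map_mul, ← map_mul, add_right_comm, ← map_add, ← hq]
  ker_bot := fun (b : ℤ[X]) h => by
    have h1 : b.coeff 0 = 0 := ((evalBot_zero b).symm.trans h)
    obtain ⟨c, hc⟩ := X_dvd_iff.2 h1
    exact ⟨c, hc.trans (congrArg (· * c) (eval_C (x := (X ^ p : ℤ[X]))).symm)⟩

end Poly

end TambaraFunctor

theorem IsPolynomialBurnside.of_iso {p : ℕ} [Fact p.Prime] {R S : GreenFunctor p}
    (f : GreenFunctor.Hom R S) (g : GreenFunctor.Hom S R) (hgt : ∀ a, g.top (f.top a) = a)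
    (hgb : ∀ b, g.bot (f.bot b) = b) (hft : ∀ a, f.top (g.top a) = a)
    (hfb : ∀ b, f.bot (g.bot b) = b) {x u : R.top}
    {ε : GreenFunctor.Hom R (burnside p).toGreenFunctor}
    {ε' : GreenFunctor.Hom S (burnside p).toGreenFunctor}
    (ht : ∀ a, ε.top a = ε'.top (f.top a)) (hb : ∀ b, ε.bot b = ε'.bot (f.bot b))
    (h : IsPolynomialBurnside (f.top x) (f.top u) ε') : IsPolynomialBurnside x u ε := by
  have it : Function.Injective f.top := Function.LeftInverse.injective hgt
  have ib : Function.Injective f.bot := Function.LeftInverse.injective hgb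
  constructor
  · exact fun k b => ib (by rw [f.map_smul, h.smul_eq])
  · exact ib (by rw [f.map_res, h.res_snd, map_zero])
  · intro b hb
    refine ib ((h.natCast_regular _ ?_).trans (map_zero _).symm)
    rw [← map_natCast f.bot, ← map_mul, hb, map_zero]
  · intro b
    obtain ⟨a, ha⟩ := h.res_surjective (f.bot b)
    exact ⟨g.top a, by rw [← g.map_res, ha, hgb]⟩
  · intro a ha
    obtain ⟨b, hb⟩ := h.annihilator_snd (f.top a) (by rw [← map_mul, ha, map_zero])
    exact ⟨g.bot b, by rw [← g.map_tr, hb, hgt]⟩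
  · intro a ha
    obtain ⟨c, d, hcd⟩ := h.ker_res (f.top a) (by rw [← f.map_res, ha, map_zero])
    refine ⟨g.top c, g.top d, it ?_⟩
    simpa [f.map_tr, hft] using hcd
  · intro a b hab
    obtain ⟨c, b₁, b₂, h1, h2⟩ := h.syzygy (f.top a) (f.top b) (by
      simpa [f.map_tr] using congrArg f.top hab)
    refine ⟨g.top c, g.bot b₁, g.bot b₂, it ?_, it ?_⟩
    · simpa [f.map_tr, hft, hfb] using h1
    · simpa [f.map_tr, hft, hfb] using h2
  · intro a b hab
    obtain ⟨c, hc⟩ := h.fst_regular (f.top a) (f.top b) (by rw [← map_mul, hab, map_mul])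
    exact ⟨g.top c, it (by rw [map_mul, hft, hc])⟩
  · intro b hb
    refine ib ((h.res_fst_regular _ ?_).trans (map_zero _).symm)
    rw [← f.map_res, ← map_mul, hb, map_zero]
  · rw [ht, h.map_fst]
  · rw [ht, h.map_snd]
  · intro a ha
    obtain ⟨c, d, hcd⟩ := h.ker_top (f.top a) (by rw [← ht, ha])
    exact ⟨g.top c, g.top d, it (by rw [map_add, map_mul, map_mul, hft, hft, hcd])⟩
  · intro b hb'
    obtain ⟨c, hc⟩ := h.ker_bot (f.bot b) (by rw [← hb, hb'])
    exact ⟨g.bot c, ib (by rw [map_mul, f.map_res, hfb, hc])⟩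

/-- Free objects are uniquely isomorphic and so are their augmentations, so u is transported from
the explicit model. -/
theorem TambaraFunctor.IsFreeOnFixed.isPolynomialBurnside {p : ℕ} [Fact p.Prime]
    {R : TambaraFunctor p} {x : R.top} (hR : R.IsFreeOnFixed x)
    (ε : TambaraFunctor.Hom R (burnside p)) (hε : ε.top x = 0) :
    ∃ u, IsPolynomialBurnside (R := R.toGreenFunctor) x u ε.toHom := by
  obtain ⟨f, g, hf, hg, hgf, hfg⟩ := hR.exists_iso (poly_isFreeOnFixed (p := p))
  have e : ε = ((burnside p).polyDesc 0).comp f := hR.hom_ext (hε.trans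
    ((congrArg ((burnside p).polyDesc 0).top hf).trans ((burnside p).polyDesc_gen 0)).symm)
  have hft : ∀ a, f.top (g.top a) = a := fun a =>
    congrArg (fun k : TambaraFunctor.Hom (poly p) (poly p) => k.top a) hfg
  refine ⟨g.top (polyDiff p), IsPolynomialBurnside.of_iso f.toHom g.toHom
    (fun a => congrArg (fun k : TambaraFunctor.Hom R R => k.top a) hgf)
    (fun b => congrArg (fun k : TambaraFunctor.Hom R R => k.bot b) hgf) hft
    (fun b => congrArg (fun k : TambaraFunctor.Hom (poly p) (poly p) => k.bot b) hfg)
    (ε' := ((burnside p).polyDesc 0).toHom)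
    (fun a => by rw [e]; rfl) (fun b => by rw [e]; rfl) ?_⟩
  rw [hf, hft]
  exact isPolynomialBurnside_poly

theorem proposition3p7 (p : ℕ) [Fact p.Prime] :
    -- the free Tambara functor on a fixed generator exists
    (∃ (R : TambaraFunctor p) (x : R.top), R.IsFreeOnFixed x) ∧
    ∀ (R : TambaraFunctor p) (x : R.top), R.IsFreeOnFixed x →
      -- the Burnside functor is an `R`-module through the augmentation `x ↦ 0`
      (∃! ε : TambaraFunctor.Hom R (burnside p), ε.top x = 0) ∧
      ∀ ε : TambaraFunctor.Hom R (burnside p), ε.top x = 0 →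
        Nonempty (GreenModule.ProjectiveResolution ε.toHom.toModule) ∧
        -- `P.tor N i` is `Tor_i^R(A, N)`, computed from an arbitrary projective resolution `P`
        ∀ P : GreenModule.ProjectiveResolution ε.toHom.toModule,
          let A : MackeyFunctor p := (burnside p).toMackey
          let L : MackeyFunctor p := mackeyL p
          let g : MackeyFunctor p := MackeyFunctor.g p
          let O : MackeyFunctor p := MackeyFunctor.zero p
          let T : ℕ → MackeyFunctor p := fun i => P.tor ε.toHom.toModule i
          (T 0).IsIsomorphic A ∧
          (T 1).IsIsomorphic (A.sum L) ∧
          (T 2).IsIsomorphic L ∧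
          (T 3).IsIsomorphic O ∧ (T 4).IsIsomorphic O ∧
          (T 5).IsIsomorphic g ∧ (T 6).IsIsomorphic g ∧
          (T 7).IsIsomorphic O ∧ (T 8).IsIsomorphic O ∧
          (∀ i, 9 ≤ i →
            (T i).IsIsomorphic (((T (i - 4)).sum (T (i - 4))).sum (T (i - 5)))) ∧
          (∀ i, (T i).rank ≠ ⊤) ∧
          (∀ N : ℕ, ∃ i₀, ∀ i, i₀ ≤ i → (N : ℕ∞) ≤ (T i).rank) := by
  refine ⟨⟨TambaraFunctor.poly p, polyGen p, TambaraFunctor.poly_isFreeOnFixed⟩,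
    fun R x hx => ⟨hx (burnside p) (0 : BurnsideRing p), fun ε hε => ?_⟩⟩
  obtain ⟨u, hR⟩ := hx.isPolynomialBurnside ε hε
  have : R.toGreenFunctor.IsTrivialAction := ⟨hR.smul_eq⟩
  refine ⟨⟨GreenModule.ProjectiveResolution.standard _⟩, fun P => ?_⟩
  refine ⟨hR.tor_zero P, hR.tor_one P, hR.tor_two P,
    (hR.tor_add_three P 0).isIsomorphic MackeyFunctor.isElementary_zero,
    (hR.tor_add_three P 1).isIsomorphic MackeyFunctor.isElementary_zero,
    (hR.tor_add_three P 2).isIsomorphic MackeyFunctor.isElementary_g,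
    (hR.tor_add_three P 3).isIsomorphic MackeyFunctor.isElementary_g,
    (hR.tor_add_three P 4).isIsomorphic MackeyFunctor.isElementary_zero,
    (hR.tor_add_three P 5).isIsomorphic MackeyFunctor.isElementary_zero,
    hR.tor_recurrence P, fun i => (hR.tor_isFinitelyGenerated P i).rank_ne_top,
    hR.exists_le_rank_tor P⟩
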